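/- **Conventions.** A filtered spectrum is a functor $X:\mathbb Z^{op}\to \mathcal Sp$, $n\mapsto X^n$. Put $\pi_{x,y}X=\pi_x(X^{x+y})$; the transition maps induce $\tau:\pi_{x,y}X\to\pi_{x,y-1}X$. For $k\ge 0$ let $X/\tau^k$ be the filtered spectrum with $n$-th term $\mathrm{cofib}(X^{n+k}\to X^n)$, let $a\mapsto[a]$ be the projection $\pi_{x,y}X\to\pi_{x,y}(X/\tau)$, and let $\delta:\pi_{x,y}(X/\tau)\to\pi_{x-1,y+2}X$ be the boundary map. Let $\tau^{-1}X=\mathrm{colim}_n X^{-n}$. We call $X$ *complete* if $\lim_n X^n=0$, and *strongly complete* if moreover $\varprojlim^1_k\pi_{x,y}(X/\tau^k)=0$ for all $x,y$ (so that $\pi_{x,y}X\cong\varprojlim_k(\pi_{x,y}X)/\tau^k$). The $\tau$-Bockstein spectral sequence of $X$ has, for $r\ge2$, $E_r^{x,y}=Z_r/B_r$ with $Z_r=\{a\in\pi_{x,y}(X/\tau):\delta a\in\tau^{r-2}\pi_{x-1,y+r}X\}$ and $B_r=\{[c]: c\in\pi_{x,y}X,\ \tau^{r-2}c=0\}$;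 the differential $d_r:E_r^{x,y}\to E_r^{x-1,y+r}$ sends the class of $a$ to the class of $[c]$, where $\delta a=\tau^{r-2}c$. A class of $E_r$ is called a *permanent cycle* if it has a representative $a$ with $\delta a=0$. Fix a real number $\alpha>-1$. The linear t-structure for the line $y=\alpha x$ on filtered spectra has as connective objects those $X$ for which every $X^n$ is $\lceil n/(\alpha+1)\rceil$-connective (equivalently, $\pi_{x,y}X=0$ for $y>\alpha x$). A map $f:X\to Y$ exhibits $X$ as the connective cover $\tau_{\ge0}^{y=\alpha x}Y$ if $X$ is connective and the cofibre of $f$ lies in $\tau_{\le-1}$, i.e. $\pi_k(\mathrm{cofib}(f)^n)=0$ for $k\ge\lceil n/(\alpha+1)\rceil$. A nonzero differential $d_r(a)=b\ne0$ with $a$ in bidegree $(x,y)$ is *line-crossing* if $y\le\alpha x$ and $y+r>\alpha(x-1)$. A class $b\in\pi_{x,y}Y$ *drops to the line* if $y>\alpha x$, $[b]\neq0$ and $\tau^lb\ne0$, where $l=y-\lfloor\alpha x\rfloor$; a *dropped lift* of such a $b$ is a class $a\in\pi_{x,\lfloor\alpha x\rfloor}X$ with $f(a)=\tau^lb$. **Theorem.**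 Let $f:X\to Y$ be a map of filtered spectra. Then $f$ exhibits $X$ as $\tau_{\ge 0}^{y=\alpha x}Y$ if and only if the following conditions hold. 1. $X$ is strongly complete. 2. $X/\tau$ is connective in the linear t-structure for $y=\alpha x$. 3. $\tau^{-1}f:\tau^{-1}X\to\tau^{-1}Y$ is an equivalence. 4. For all $r\ge2$ the map $(*)\ E_r(X)\to E_r(Y)$ satisfies: (a) it is an isomorphism in bidegrees $(x,y)$ with $y+r\le\alpha(x-1)$; if $y+r>\alpha(x-1)$ and $y\le\alpha x$, its image in bidegree $(x,y)$ consists precisely of the permanent cycles; (b) it is injective in bidegree $(x,y)$ unless $y=\lfloor\alpha x\rfloor$. Conditions (1)–(4) also imply that $f$ exhibits $X$ as $\tau_{\ge0}^{y=\alpha x}Y$ if in (4a) "the permanent cycles" is replaced by "the classes $b$ that do not support a line-crossing differential $d_s(b)$, $s\ge r$". Suppose now that $Y$ is strongly complete and that $f$ exhibits $X$ as $\tau_{\ge0}^{y=\alpha x}Y$. Then (4) also holds with this replacement in (4a), and: 5. If $b\in\pi_{x,y}Y$ drops to the line, then $b$ has a unique dropped lift $a\in\pi_{x,y-l}X$,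 and $\tau^ka=0\iff\tau^{k+l}b=0$ for all $k\ge0$. 6. For $r\ge2$, the nonzero elements of the kernel of $(*)$ in bidegree $(x,\lfloor\alpha x\rfloor)$ are precisely the classes in $E_r(X)$ of $[a]$, for $a$ a dropped lift of a class $b\in\pi_{x,y}Y$ (for some $y$) with $\tau^{l+r-2}b\ne0$. 7. Let $b\in\pi_{x,y}Y$ drop to the line with dropped lift $a$, and let $r>1$ be minimal with $\tau^{l+r-1}b=0$. Then there is a class $z\in E_r(Y)$ in bidegree $(x+1,\lfloor\alpha x\rfloor-r)$ which survives to $E_{l+r}(Y)$ with $d_{l+r}(z)=[b]$ there; if $[b]$ is nonzero in $E_{l+r}(Y)$, this is a line-crossing differential. The class $z$ has a unique lift $\tilde z\in E_r(X)$ along $(*)$, and $d_r(\tilde z)=[a]\neq0$. Conversely, let $d_r(\tilde z)=[a]\ne0$ be a differential in $E_r(X)$, $r\geq 2$, with $a$ a dropped lift of $b$. Then $r$ is minimal among the integers $r>1$ with $\tau^{l+r-1}b=0$, the class $f(\tilde z)$ survives to $E_{l+r}(Y)$, and $d_{l+r}(f(\tilde z))=[b]$. Moreover there is a class $b'\in\pi_{x,y'}Y$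 that drops to the line, with dropped lift $a'$ and $l'=y'-\lfloor\alpha x\rfloor$, such that $[a']=[a]$ in $E_r(X)$, $r$ is minimal among the integers $r>1$ with $\tau^{l'+r-1}b'=0$, and $d_{l'+r}(f(\tilde z))=[b']\ne0$ is a line-crossing differential in the spectral sequence of $Y$. 8. Let $d_r(\tilde z)=v\neq0$ be a differential in the spectral sequence of $X$, $r\ge2$. Either $f(v)\ne0$ in $E_r(Y)$, so that it lifts the nonzero differential $d_r(f(\tilde z))=f(v)$ of $Y$, or $v=[a]$ for a dropped lift $a$ of a class $b$ such that $r>1$ is minimal with $\tau^{l+r-1}b=0$ and $d_{l+r}(f(\tilde z))=[b]$ is a (nonzero) line-crossing differential in the spectral sequence of $Y$, i.e. the differential is of the form described in (7). -/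

import Mathlib

/-!
# Filtered spectra, linear t-structures and the τ-Bockstein spectral sequence

The ∞-category of spectra is modelled by `Ω`-spectra: sequences of pointed topological spaces
`E n`, `n : ℤ`, with weak homotopy equivalences `E n → Ω E (n + 1)`.  A filtered spectrum is a
functor from `ℤᵒᵖ` to `Ω`-spectra, and a map of filtered spectra is a natural transformation
(every object and every map of the ∞-category `Fun(ℤᵒᵖ, Sp)` is represented in this way).
-/

open CategoryTheory Opposite
open scoped unitInterval

universe u

noncomputable section

namespace LinearT

/-! ### Pointed spaces -/

/-- Pointed topological spaces. -/
structure PtdSpace where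
  /-- The underlying type. -/
  carrier : Type u
  /-- The topology. -/
  [top : TopologicalSpace carrier]
  /-- The base point. -/
  pt : carrier

attribute [instance] PtdSpace.top

instance : CoeSort PtdSpace.{u} (Type u) := ⟨PtdSpace.carrier⟩

/-- Pointed continuous maps. -/
@[ext]
structure PMap (P Q : PtdSpace.{u}) where
  /-- The underlying continuous map. -/
  toMap : C(P, Q)
  map_pt : toMap P.pt = Q.pt

instance (P Q : PtdSpace.{u}) : CoeFun (PMap P Q) (fun _ => P → Q) := ⟨fun f => f.toMap⟩

theorem PMap.ext_apply {P Q : PtdSpace.{u}} {f g : PMap P Q} (h : ∀ p, f p = g p) : f = g :=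
  PMap.ext (ContinuousMap.ext h)

theorem PMap.continuous {P Q : PtdSpace.{u}} (f : PMap P Q) : Continuous f := f.toMap.continuous

/-- The identity map. -/
def PMap.id (P : PtdSpace.{u}) : PMap P P := ⟨ContinuousMap.id P, rfl⟩

/-- `g.comp f` is `g ∘ f`. -/
def PMap.comp {P Q R : PtdSpace.{u}} (g : PMap Q R) (f : PMap P Q) : PMap P R :=
  ⟨g.toMap.comp f.toMap, by
    simp only [ContinuousMap.comp_apply, f.map_pt, g.map_pt]⟩

/-! ### Homotopy groups of spaces -/

/-- The map on homotopy groups induced by a continuous map `f` with `f x = y`. -/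
def homotopyMap (N : Type) {X Y : Type u} [TopologicalSpace X] [TopologicalSpace Y]
    (f : C(X, Y)) {x : X} {y : Y} (h : f x = y) : HomotopyGroup N X x → HomotopyGroup N Y y :=
  Quotient.map
    (fun p : GenLoop N X x => (⟨f.comp p.1, fun t ht => by
      rw [ContinuousMap.comp_apply, p.2 t ht, h]⟩ : GenLoop N Y y))
    (fun _ _ H => ContinuousMap.HomotopicRel.comp_continuousMap H f)

/-- Weak homotopy equivalences between nonempty spaces: bijections on `π₀` and on all homotopy
groups, for all base points. -/
def IsWeakEquiv {P Q : PtdSpace.{u}} (f : PMap P Q) : Prop :=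
  ∀ (n : ℕ) (x : P), Function.Bijective
    (homotopyMap (Fin n) f.toMap (rfl : f.toMap x = f.toMap x))

/-- `π₂` of a pointed space, written additively. -/
abbrev PiTwo (P : PtdSpace.{u}) : Type u := Additive (HomotopyGroup (Fin 2) P P.pt)

/-- The homomorphism induced by a pointed map on `π₂`. -/
def piTwoMap {P Q : PtdSpace.{u}} (f : PMap P Q) : PiTwo P →+ PiTwo Q where
  toFun a := Additive.ofMul (homotopyMap (Fin 2) f.toMap f.map_pt a.toMul)
  map_zero' := by
    change Additive.ofMul (homotopyMap (Fin 2) f.toMap f.map_pt 1) = 0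
    rw [HomotopyGroup.one_def]
    refine congrArg Additive.ofMul ?_
    rw [HomotopyGroup.one_def]
    refine congrArg (Quotient.mk _) ?_
    ext t
    exact f.map_pt
  map_add' a b := by
    refine Quotient.inductionOn₂ (s₁ := GenLoop.Homotopic.setoid (Fin 2) P.pt)
      (s₂ := GenLoop.Homotopic.setoid (Fin 2) P.pt) a b fun p q => ?_
    have h1 := HomotopyGroup.mul_spec (i := (0 : Fin 2)) (p := p) (q := q)
    refine (congrArg (fun c => Additive.ofMul (homotopyMap (Fin 2) f.toMap f.map_pt c)) h1).trans ?_
    refine Eq.trans ?_ (HomotopyGroup.mul_spec (i := (0 : Fin 2))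
      (p := (⟨f.toMap.comp p.1, fun t ht => by
        rw [ContinuousMap.comp_apply, p.2 t ht, f.map_pt]⟩ : GenLoop (Fin 2) Q Q.pt))
      (q := ⟨f.toMap.comp q.1, fun t ht => by
        rw [ContinuousMap.comp_apply, q.2 t ht, f.map_pt]⟩)).symm
    refine congrArg (Quotient.mk _) ?_
    ext t
    simp only [GenLoop.transAt, GenLoop.coe_copy, GenLoop.mk_apply, ContinuousMap.comp_apply]
    change f.toMap (if _ then _ else _) = _
    split_ifs <;> rfl

theorem piTwoMap_comp {P Q R : PtdSpace.{u}} (g : PMap Q R) (f : PMap P Q) (a : PiTwo P) :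
    piTwoMap (g.comp f) a = piTwoMap g (piTwoMap f a) :=
  Quotient.inductionOn (s := GenLoop.Homotopic.setoid (Fin 2) P.pt) a fun _ => rfl

/-! ### Loop spaces and homotopy fibres -/

/-- The loop space of a pointed space. -/
def loop (P : PtdSpace.{u}) : PtdSpace.{u} where
  carrier := LoopSpace P P.pt
  pt := Path.refl P.pt

/-- A point of the loop space as a path. -/
def asPath {P : PtdSpace.{u}} (γ : loop P) : Path P.pt P.pt := γ

theorem continuous_asPath {P : PtdSpace.{u}} {Z : Type*} [TopologicalSpace Z]
    {g : Z → loop P} {t : Z → I} (hg : Continuous g) (ht : Continuous t) :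
    Continuous fun z => asPath (g z) (t z) :=
  (Path.continuous_uncurry_iff.2 hg : Continuous fun p : Z × I => asPath (g p.1) p.2).comp
    (continuous_id.prodMk ht)

/-- The map induced on loop spaces. -/
def loopMap {P Q : PtdSpace.{u}} (f : PMap P Q) : PMap (loop P) (loop Q) where
  toMap :=
    { toFun := fun γ : Path P.pt P.pt =>
        ({ toFun := fun t => f (γ t)
           continuous_toFun := f.continuous.comp γ.continuous
           source' := by rw [γ.source, f.map_pt]
           target' := by rw [γ.target, f.map_pt] } : Path Q.pt Q.pt)
      continuous_toFun := Path.continuous_uncurry_iff.1 <|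
        f.continuous.comp (Path.continuous_uncurry_iff.2 continuous_id) }
  map_pt := by
    refine Path.ext ?_
    funext t
    exact f.map_pt

/-- The homotopy fibre of `f : P → Q`: points `p` of `P` with a path in `Q` from the base point
to `f p`. -/
def fib {P Q : PtdSpace.{u}} (f : PMap P Q) : PtdSpace.{u} where
  carrier := {w : P × C(I, Q) // w.2 0 = Q.pt ∧ w.2 1 = f w.1}
  pt := ⟨(P.pt, ContinuousMap.const I Q.pt), rfl, f.map_pt.symm⟩

/-- The projection of the homotopy fibre of `P → Q` to `P`. -/
def fibProj {P Q : PtdSpace.{u}} (f : PMap P Q) : PMap (fib f) P where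
  toMap := ⟨fun w => w.1.1, continuous_fst.comp continuous_subtype_val⟩
  map_pt := rfl

/-- The inclusion of `Ω Q` into the homotopy fibre of `P → Q`. -/
def fibIncl {P Q : PtdSpace.{u}} (f : PMap P Q) : PMap (loop Q) (fib f) where
  toMap :=
    { toFun := fun γ : Path Q.pt Q.pt =>
        ⟨(P.pt, γ.toContinuousMap), γ.source, γ.target.trans f.map_pt.symm⟩
      continuous_toFun := Continuous.subtype_mk
        (continuous_const.prodMk continuous_induced_dom) _ }
  map_pt := rfl

/-- The map of homotopy fibres induced by a commutative square. -/
def fibMap {P Q P' Q' : PtdSpace.{u}} {f : PMap P Q} {f' : PMap P' Q'}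
    (a : PMap P P') (b : PMap Q Q') (h : ∀ p, b (f p) = f' (a p)) : PMap (fib f) (fib f') where
  toMap :=
    { toFun := fun w => ⟨(a w.1.1, b.toMap.comp w.1.2), by
        rw [ContinuousMap.comp_apply, w.2.1, b.map_pt], by
        rw [ContinuousMap.comp_apply, w.2.2]; exact h _⟩
      continuous_toFun := Continuous.subtype_mk
        ((a.continuous.comp (continuous_fst.comp continuous_subtype_val)).prodMk
          ((ContinuousMap.continuous_postcomp b.toMap).comp
            (continuous_snd.comp continuous_subtype_val))) _ }
  map_pt := by
    refine Subtype.ext (Prod.ext a.map_pt ?_)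
    ext t
    exact b.map_pt

/-- The canonical map from the homotopy fibre of `Ω f` to the loop space of the homotopy fibre of
`f`, which interchanges the two path coordinates. -/
def fibLoop {P Q : PtdSpace.{u}} (f : PMap P Q) : PMap (fib (loopMap f)) (loop (fib f)) where
  toMap :=
    { toFun := fun w =>
        ({ toFun := fun t => ⟨(asPath w.1.1 t,
              ⟨fun s => asPath (w.1.2 s) t,
                continuous_asPath (w.1.2.continuous) continuous_const⟩), by
              change asPath (w.1.2 0) t = Q.pt
              rw [w.2.1]; rfl, by
              change asPath (w.1.2 1) t = _
              rw [w.2.2]; rfl⟩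
           continuous_toFun := by
             refine Continuous.subtype_mk (Continuous.prodMk (asPath w.1.1).continuous
               (ContinuousMap.continuous_of_continuous_uncurry _ ?_)) _
             exact continuous_asPath (w.1.2.continuous.comp continuous_snd) continuous_fst
           source' := by
             refine Subtype.ext (Prod.ext (Path.source _) ?_)
             ext s
             exact Path.source _
           target' := by
             refine Subtype.ext (Prod.ext (Path.target _) ?_)
             ext s
             exact Path.target _ } : Path (fib f).pt (fib f).pt)
      continuous_toFun := by
        refine Path.continuous_uncurry_iff.1 (Continuous.subtype_mk (Continuous.prodMk
          (continuous_asPath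
            ((continuous_fst.comp continuous_subtype_val).comp continuous_fst) continuous_snd)
          (ContinuousMap.continuous_of_continuous_uncurry _ ?_)) _)
        exact continuous_asPath (ContinuousEval.continuous_eval.comp
          (((continuous_snd.comp continuous_subtype_val).comp
            (continuous_fst.comp continuous_fst)).prodMk continuous_snd))
          (continuous_snd.comp continuous_fst) }
  map_pt := by
    refine Path.ext ?_
    funext t
    rfl

/-! ### Homotopy limits of towers and mapping telescopes -/

/-- The homotopy limit of a tower `⋯ → P 2 → P 1 → P 0`: sequences of points `w n` of `P n` with
paths from `w n` to the image of `w (n + 1)`. -/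
def holimSpace (P : ℕ → PtdSpace.{u}) (p : ∀ n, PMap (P (n + 1)) (P n)) : PtdSpace.{u} where
  carrier := {w : (∀ n, P n) × (∀ n, C(I, P n)) //
    ∀ n, w.2 n 0 = w.1 n ∧ w.2 n 1 = p n (w.1 (n + 1))}
  pt := ⟨(fun n => (P n).pt, fun n => ContinuousMap.const I (P n).pt),
    fun n => ⟨rfl, (p n).map_pt.symm⟩⟩

/-- Functoriality of the homotopy limit. -/
def holimSpaceMap {P Q : ℕ → PtdSpace.{u}} {p : ∀ n, PMap (P (n + 1)) (P n)}
    {q : ∀ n, PMap (Q (n + 1)) (Q n)} (a : ∀ n, PMap (P n) (Q n))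
    (h : ∀ n z, a n (p n z) = q n (a (n + 1) z)) : PMap (holimSpace P p) (holimSpace Q q) where
  toMap :=
    { toFun := fun w => ⟨(fun n => a n (w.1.1 n), fun n => (a n).toMap.comp (w.1.2 n)),
        fun n => ⟨by rw [ContinuousMap.comp_apply, (w.2 n).1],
          by rw [ContinuousMap.comp_apply, (w.2 n).2]; exact h n _⟩⟩
      continuous_toFun := Continuous.subtype_mk (Continuous.prodMk
        (continuous_pi fun n => (a n).continuous.comp
          ((continuous_apply n).comp (continuous_fst.comp continuous_subtype_val)))
        (continuous_pi fun n => (ContinuousMap.continuous_postcomp (a n).toMap).comp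
          ((continuous_apply n).comp (continuous_snd.comp continuous_subtype_val)))) _ }
  map_pt := by
    refine Subtype.ext (Prod.ext ?_ ?_)
    · funext n
      exact (a n).map_pt
    · funext n
      ext t
      exact (a n).map_pt

/-- The canonical map from the homotopy limit of loop spaces to the loop space of the homotopy
limit. -/
def holimSpaceLoop (P : ℕ → PtdSpace.{u}) (p : ∀ n, PMap (P (n + 1)) (P n)) :
    PMap (holimSpace (fun n => loop (P n)) (fun n => loopMap (p n))) (loop (holimSpace P p)) where
  toMap :=
    { toFun := fun w =>
        ({ toFun := fun t => ⟨(fun n => asPath (w.1.1 n) t,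
              fun n => ⟨fun s => asPath (w.1.2 n s) t,
                continuous_asPath (w.1.2 n).continuous continuous_const⟩), fun n => ⟨by
              change asPath (w.1.2 n 0) t = _
              rw [(w.2 n).1], by
              change asPath (w.1.2 n 1) t = _
              rw [(w.2 n).2]; rfl⟩⟩
           continuous_toFun := by
             refine Continuous.subtype_mk (Continuous.prodMk
               (continuous_pi fun n => (asPath (w.1.1 n)).continuous)
               (continuous_pi fun n => ContinuousMap.continuous_of_continuous_uncurry _ ?_)) _
             exact continuous_asPath ((w.1.2 n).continuous.comp continuous_snd) continuous_fst
           source' := by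
             refine Subtype.ext (Prod.ext (funext fun n => Path.source _) (funext fun n => ?_))
             ext s
             exact Path.source _
           target' := by
             refine Subtype.ext (Prod.ext (funext fun n => Path.target _) (funext fun n => ?_))
             ext s
             exact Path.target _ } : Path (holimSpace P p).pt (holimSpace P p).pt)
      continuous_toFun := by
        refine Path.continuous_uncurry_iff.1 (Continuous.subtype_mk (Continuous.prodMk
          (continuous_pi fun n => continuous_asPath
            ((continuous_apply n).comp
              ((continuous_fst.comp continuous_subtype_val).comp continuous_fst)) continuous_snd)
          (continuous_pi fun n => ContinuousMap.continuous_of_continuous_uncurry _ ?_)) _)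
        exact continuous_asPath (ContinuousEval.continuous_eval.comp
          (((continuous_apply n).comp ((continuous_snd.comp continuous_subtype_val).comp
            (continuous_fst.comp continuous_fst))).prodMk continuous_snd))
          (continuous_snd.comp continuous_fst) }
  map_pt := by
    refine Path.ext ?_
    funext t
    rfl

/-- The gluing relation of the mapping telescope: `(n, z, 1)` is identified with
`(n + 1, p z, 0)`. -/
inductive TelRel (P : ℕ → PtdSpace.{u}) (p : ∀ n, PMap (P n) (P (n + 1))) :
    (Σ n, P n × I) → (Σ n, P n × I) → Prop
  | glue (n : ℕ) (z : P n) : TelRel P p ⟨n, z, 1⟩ ⟨n + 1, p n z, 0⟩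

/-- The mapping telescope, i.e. the homotopy colimit, of a sequence `P 0 → P 1 → P 2 → ⋯`. -/
abbrev Telescope (P : ℕ → PtdSpace.{u}) (p : ∀ n, PMap (P n) (P (n + 1))) : Type u :=
  Quot (TelRel P p)

/-- Functoriality of the mapping telescope. -/
def telescopeMap {P Q : ℕ → PtdSpace.{u}} {p : ∀ n, PMap (P n) (P (n + 1))}
    {q : ∀ n, PMap (Q n) (Q (n + 1))} (a : ∀ n, PMap (P n) (Q n))
    (h : ∀ n z, a (n + 1) (p n z) = q n (a n z)) : C(Telescope P p, Telescope Q q) where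
  toFun := Quot.map (fun w => ⟨w.1, a w.1 w.2.1, w.2.2⟩) (by
    rintro _ _ ⟨n, z⟩
    change TelRel Q q ⟨n, a n z, 1⟩ ⟨n + 1, a (n + 1) (p n z), 0⟩
    rw [h]
    exact TelRel.glue n (a n z))
  continuous_toFun := by
    refine continuous_quot_lift _ (continuous_quot_mk.comp (continuous_sigma fun n => ?_))
    exact continuous_sigmaMk.comp (((a n).continuous.comp continuous_fst).prodMk continuous_snd)

/-- The map induced on sets of path components. -/
def pathComponentsMap {X Y : Type u} [TopologicalSpace X] [TopologicalSpace Y] (f : C(X, Y)) :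
    ZerothHomotopy X → ZerothHomotopy Y :=
  Quotient.map f (fun _ _ h => h.map f.continuous)

/-! ### Spectra -/

/-- Sequences of pointed spaces with structure maps `E n → Ω E (n + 1)`. -/
structure PreSpec where
  /-- The `n`-th space. -/
  level : ℤ → PtdSpace.{u}
  /-- The adjoint structure maps. -/
  str : ∀ n, PMap (level n) (loop (level (n + 1)))

namespace PreSpec

/-- The condition of being an `Ω`-spectrum. -/
def IsOmega (E : PreSpec.{u}) : Prop := ∀ n, IsWeakEquiv (E.str n)

/-- Maps strictly compatible with the structure maps. -/
@[ext]
structure Hom (E F : PreSpec.{u}) where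
  /-- The map on `n`-th spaces. -/
  app : ∀ n, PMap (E.level n) (F.level n)
  comm : ∀ n, (F.str n).comp (app n) = (loopMap (app (n + 1))).comp (E.str n)

instance : Category PreSpec.{u} where
  Hom := Hom
  id E := ⟨fun n => PMap.id _, fun n => rfl⟩
  comp {E F G} f g := ⟨fun n => (g.app n).comp (f.app n), fun n => by
    have h1 := f.comm n
    have h2 := g.comm n
    calc (G.str n).comp ((g.app n).comp (f.app n))
        = ((G.str n).comp (g.app n)).comp (f.app n) := rfl
      _ = (loopMap (g.app (n + 1))).comp ((F.str n).comp (f.app n)) := by rw [h2]; rfl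
      _ = _ := by rw [h1]; rfl⟩

theorem comm_apply {E F : PreSpec.{u}} (f : E ⟶ F) (n : ℤ) (z : E.level n) :
    F.str n (f.app n z) = loopMap (f.app (n + 1)) (E.str n z) :=
  congrArg (fun g : PMap (E.level n) (loop (F.level (n + 1))) => g z) (f.comm n)

theorem hom_ext {E F : PreSpec.{u}} {f g : E ⟶ F} (h : ∀ n z, f.app n z = g.app n z) : f = g :=
  Hom.ext (funext fun n => PMap.ext_apply (h n))

/-- The homotopy group `π_k E` of an `Ω`-spectrum, for `k : ℤ`.  It is `π_{j + k}(E j)` for any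
`j` with `j + k ≥ 0`; we take `j = 2 - k`. -/
abbrev pi (E : PreSpec.{u}) (k : ℤ) : Type u := PiTwo (E.level (2 - k))

/-- The homomorphism induced on homotopy groups. -/
def piMap {E F : PreSpec.{u}} (f : E ⟶ F) (k : ℤ) : E.pi k →+ F.pi k := piTwoMap (f.app (2 - k))

theorem piMap_comp {E F G : PreSpec.{u}} (f : E ⟶ F) (g : F ⟶ G) (k : ℤ) (a : E.pi k) :
    piMap (f ≫ g) k a = piMap g k (piMap f k a) := piTwoMap_comp _ _ a

/-- The identification of `E m` and `E m'` for equal integers `m` and `m'`. -/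
def levelCast (E : PreSpec.{u}) {m m' : ℤ} (h : m = m') : PMap (E.level m) (E.level m') := by
  subst h
  exact PMap.id _

theorem levelCast_natural {E F : PreSpec.{u}} (f : E ⟶ F) {m m' : ℤ} (h : m = m') :
    (F.levelCast h).comp (f.app m) = (f.app m').comp (E.levelCast h) := by
  subst h
  rfl

/-- The cofibre of a map of spectra, constructed as the suspension of the homotopy fibre: its
`n`-th space is the homotopy fibre of the map of `(n + 1)`-st spaces.  It is an `Ω`-spectrum
if `E` and `F` are. -/
def cofib {E F : PreSpec.{u}} (f : E ⟶ F) : PreSpec.{u} where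
  level n := fib (f.app (n + 1))
  str n := (fibLoop (f.app (n + 1 + 1))).comp
    (fibMap (E.str (n + 1)) (F.str (n + 1)) (comm_apply f (n + 1)))

/-- The map of cofibres induced by a commutative square. -/
def cofibMap {E F E' F' : PreSpec.{u}} {f : E ⟶ F} {f' : E' ⟶ F'} (a : E ⟶ E') (b : F ⟶ F')
    (h : f ≫ b = a ≫ f') : cofib f ⟶ cofib f' where
  app n := fibMap (a.app (n + 1)) (b.app (n + 1)) (fun z =>
    congrArg (fun g : E ⟶ F' => g.app (n + 1) z) h)
  comm n := by
    refine PMap.ext_apply fun w => ?_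
    refine Path.ext ?_
    funext t
    refine Subtype.ext (Prod.ext ?_ ?_)
    · exact congrArg (fun γ => asPath γ t) (comm_apply a (n + 1) w.1.1)
    · ext s
      exact congrArg (fun γ => asPath γ t) (comm_apply b (n + 1) (w.1.2 s))

/-- The map `π_k F → π_k (cofib f)`. -/
def toCofib {E F : PreSpec.{u}} (f : E ⟶ F) (k : ℤ) : F.pi k →+ (cofib f).pi k :=
  piTwoMap ((fibIncl (f.app (2 - k + 1))).comp (F.str (2 - k)))

theorem toCofib_natural {E F E' F' : PreSpec.{u}} {f : E ⟶ F} {f' : E' ⟶ F'} (a : E ⟶ E')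
    (b : F ⟶ F') (h : f ≫ b = a ≫ f') (k : ℤ) (z : F.pi k) :
    piMap (cofibMap a b h) k (toCofib f k z) = toCofib f' k (piMap b k z) := by
  refine (piTwoMap_comp _ _ z).symm.trans (Eq.trans ?_ (piTwoMap_comp _ _ z))
  refine congrArg (fun g => piTwoMap g z) (PMap.ext_apply fun w => ?_)
  refine Subtype.ext (Prod.ext (a.app _).map_pt ?_)
  ext t
  exact congrArg (fun γ => asPath γ t) (comm_apply b (2 - k) w).symm

/-- The boundary map `π_k (cofib f) → π_{k'} E`, where `k' = k - 1`. -/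
def boundary {E F : PreSpec.{u}} (f : E ⟶ F) {k k' : ℤ} (hk : k' + 1 = k) :
    (cofib f).pi k →+ E.pi k' :=
  piTwoMap ((E.levelCast (by omega : 2 - k + 1 = 2 - k')).comp (fibProj (f.app (2 - k + 1))))

theorem boundary_natural {E F E' F' : PreSpec.{u}} {f : E ⟶ F} {f' : E' ⟶ F'} (a : E ⟶ E')
    (b : F ⟶ F') (h : f ≫ b = a ≫ f') {k k' : ℤ} (hk : k' + 1 = k) (z : (cofib f).pi k) :
    piMap a k' (boundary f hk z) = boundary f' hk (piMap (cofibMap a b h) k z) := by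
  refine (piTwoMap_comp _ _ z).symm.trans (Eq.trans ?_ (piTwoMap_comp _ _ z))
  refine congrArg (fun g => piTwoMap g z) (PMap.ext_apply fun w => ?_)
  exact (congrArg (fun g : PMap (E.level (2 - k + 1)) (E'.level (2 - k')) => g w.1.1)
    (levelCast_natural a (by omega : 2 - k + 1 = 2 - k'))).symm

/-- The homotopy limit of a tower of spectra, formed levelwise. -/
def holim (E : ℕ → PreSpec.{u}) (p : ∀ n, E (n + 1) ⟶ E n) : PreSpec.{u} where
  level m := holimSpace (fun n => (E n).level m) (fun n => (p n).app m)
  str m := (holimSpaceLoop (fun n => (E n).level (m + 1)) (fun n => (p n).app (m + 1))).comp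
    (holimSpaceMap (fun n => (E n).str m) (fun n z => comm_apply (p n) m z))

end PreSpec

open PreSpec

/-! ### Filtered spectra -/

/-- Filtered objects `⋯ → X 1 → X 0 → X (-1) → ⋯`. -/
abbrev Fil : Type (u + 1) := ℤᵒᵖ ⥤ PreSpec.{u}

namespace Fil

/-- A filtered spectrum is a diagram of `Ω`-spectra. -/
def IsSpectrum (X : Fil.{u}) : Prop := ∀ n : ℤ, (X.obj (op n)).IsOmega

/-- The transition map `X n → X m` for `m ≤ n`. -/
abbrev trans (X : Fil.{u}) {m n : ℤ} (h : m ≤ n) : X.obj (op n) ⟶ X.obj (op m) :=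
  X.map (homOfLE h).op

/-- The cofibre of a map of filtered spectra, formed pointwise. -/
def cofib {X Y : Fil.{u}} (f : X ⟶ Y) : Fil.{u} where
  obj n := PreSpec.cofib (f.app n)
  map g := cofibMap (X.map g) (Y.map g) (f.naturality g).symm
  map_id n := by
    refine hom_ext fun m w => Subtype.ext (Prod.ext ?_ ?_)
    · change (X.map (𝟙 n)).app (m + 1) w.1.1 = _
      rw [X.map_id]; rfl
    · change ((Y.map (𝟙 n)).app (m + 1)).toMap.comp w.1.2 = _
      rw [Y.map_id]; rfl
  map_comp g g' := by
    refine hom_ext fun m w => Subtype.ext (Prod.ext ?_ ?_)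
    · change (X.map (g ≫ g')).app (m + 1) w.1.1 = _
      rw [X.map_comp]; rfl
    · change ((Y.map (g ≫ g')).app (m + 1)).toMap.comp w.1.2 = _
      rw [Y.map_comp]; rfl

/-- The shifted filtered spectrum `n ↦ X (n + r)`, the source of the map `τ ^ r` to `X`. -/
def shift (X : Fil.{u}) (r : ℕ) : Fil.{u} :=
  (Monotone.functor (f := fun n : ℤ => n + r) (fun _ _ h => by simpa using h)).op ⋙ X

/-- The map `τ ^ r`, given by the transition maps `X (n + r) → X n`. -/
def tauPow (X : Fil.{u}) (r : ℕ) : shift X r ⟶ X where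
  app n := X.trans (by omega : n.unop ≤ n.unop + r)
  naturality _ _ g := by
    change X.map _ ≫ X.map _ = X.map _ ≫ X.map _
    rw [← X.map_comp, ← X.map_comp]
    rfl

/-- The filtered spectrum `X / τ ^ r`, whose `n`-th term is the cofibre of `X (n + r) → X n`. -/
def modTau (X : Fil.{u}) (r : ℕ) : Fil.{u} := cofib (tauPow X r)

/-- The projection `X / τ ^ (r + 1) → X / τ ^ r`, at filtration `n`. -/
def modTauProj (X : Fil.{u}) (r : ℕ) (n : ℤ) :
    (modTau X (r + 1)).obj (op n) ⟶ (modTau X r).obj (op n) :=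
  cofibMap (X.trans (by push_cast; omega : n + (r : ℤ) ≤ n + ((r + 1 : ℕ) : ℤ))) (𝟙 _) (by
    change X.map _ ≫ 𝟙 _ = X.map _ ≫ X.map _
    rw [← X.map_comp, Category.comp_id]
    rfl)

/-- The map `X / τ ^ r → Y / τ ^ r` induced by `f : X → Y`, at filtration `n`. -/
def modTauMap {X Y : Fil.{u}} (f : X ⟶ Y) (r : ℕ) (n : ℤ) :
    (modTau X r).obj (op n) ⟶ (modTau Y r).obj (op n) :=
  cofibMap (f.app (op (n + r))) (f.app (op n)) (f.naturality _)

/-- The bigraded homotopy groups `π_{x,y} X = π_x (X (x + y))`. -/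
abbrev bi (X : Fil.{u}) (x y : ℤ) : Type u := (X.obj (op (x + y))).pi x

/-- The map `π_{x,y} X → π_{x,y} Y` induced by `f : X → Y`. -/
def biMap {X Y : Fil.{u}} (f : X ⟶ Y) (x y : ℤ) : bi X x y →+ bi Y x y :=
  piMap (f.app (op (x + y))) x

/-- For `y' ≤ y`, multiplication by `τ ^ (y - y')`, from `π_{x,y} X` to `π_{x,y'} X`.  (The value
for `y' > y` is irrelevant.) -/
def tau (X : Fil.{u}) (x y y' : ℤ) : bi X x y →+ bi X x y' :=
  if h : y' ≤ y then piMap (X.trans (by omega : x + y' ≤ x + y)) x else 0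

theorem tau_natural {X Y : Fil.{u}} (f : X ⟶ Y) (x y y' : ℤ) (a : bi X x y) :
    biMap f x y' (tau X x y y' a) = tau Y x y y' (biMap f x y a) := by
  unfold tau
  split_ifs
  · refine (piMap_comp _ _ _ a).symm.trans (Eq.trans ?_ (piMap_comp _ _ _ a))
    exact congrArg (fun g => piMap g x a) (f.naturality _)
  · exact map_zero _

/-- `π_{x,y} (X / τ)`, which is the `E₂`-page of the `τ`-Bockstein spectral sequence. -/
abbrev gr (X : Fil.{u}) (x y : ℤ) : Type u := bi (modTau X 1) x y

/-- The map `π_{x,y} (X / τ) → π_{x,y} (Y / τ)`. -/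
def grMap {X Y : Fil.{u}} (f : X ⟶ Y) (x y : ℤ) : gr X x y →+ gr Y x y :=
  piMap (modTauMap f 1 (x + y)) x

/-- The mod `τ` projection `a ↦ [a]`, from `π_{x,y} X` to `π_{x,y} (X / τ)`. -/
def red (X : Fil.{u}) (x y : ℤ) : bi X x y →+ gr X x y :=
  toCofib ((tauPow X 1).app (op (x + y))) x

theorem red_natural {X Y : Fil.{u}} (f : X ⟶ Y) (x y : ℤ) (a : bi X x y) :
    grMap f x y (red X x y a) = red Y x y (biMap f x y a) :=
  toCofib_natural _ _ _ _ _

/-- The boundary map `δ` from `π_{x,y} (X / τ)` to `π_{x',y'} X`, with `x' = x - 1` and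
`y' = y + 2`. -/
def delta (X : Fil.{u}) {x y x' y' : ℤ} (hx : x' + 1 = x) (hy : y' = y + 2) :
    gr X x y →+ bi X x' y' :=
  (piMap (X.trans (by push_cast; omega : x' + y' ≤ x + y + ((1 : ℕ) : ℤ))) x').comp
    (boundary ((tauPow X 1).app (op (x + y))) hx)

theorem delta_natural {X Y : Fil.{u}} (f : X ⟶ Y) {x y x' y' : ℤ} (hx : x' + 1 = x)
    (hy : y' = y + 2) (a : gr X x y) :
    biMap f x' y' (delta X hx hy a) = delta Y hx hy (grMap f x y a) := by
  refine Eq.trans ?_ (congrArg (piMap (Y.trans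
    (by push_cast; omega : x' + y' ≤ x + y + ((1 : ℕ) : ℤ))) x')
    (boundary_natural (f.app (op (x + y + ((1 : ℕ) : ℤ)))) (f.app (op (x + y)))
      (f.naturality _) hx a))
  refine (piMap_comp _ _ _ _).symm.trans (Eq.trans ?_ (piMap_comp _ _ _ _))
  exact congrArg (fun g => piMap g x' _) (f.naturality _)

/-! ### Completeness and inversion of `τ` -/

/-- `X` is complete if `lim X n`, the homotopy limit for `n → ∞`, is zero.  (It is computed along
the cofinal subset of natural numbers.) -/
def IsComplete (X : Fil.{u}) : Prop :=
  ∀ k : ℤ, Subsingleton ((holim (fun n : ℕ => X.obj (op (n : ℤ)))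
    (fun n => X.trans (by push_cast; omega : (n : ℤ) ≤ ((n + 1 : ℕ) : ℤ)))).pi k)

/-- The vanishing of `lim¹` of a tower of abelian groups, i.e. of the cokernel of
`(v n) ↦ (v n - p (v (n + 1)))` on the product. -/
def LimOneVanishes (A : ℕ → Type u) [∀ n, AddCommGroup (A n)] (p : ∀ n, A (n + 1) →+ A n) :
    Prop :=
  Function.Surjective fun (v : ∀ n, A n) (n : ℕ) => v n - p n (v (n + 1))

/-- `X` is strongly complete if it is complete and `lim¹` of the groups `π_{x,y} (X / τ ^ r)`,
`r → ∞`, vanishes for all `x` and `y`. -/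
def IsStronglyComplete (X : Fil.{u}) : Prop :=
  IsComplete X ∧ ∀ x y : ℤ, LimOneVanishes (fun r : ℕ => bi (modTau X r) x y)
    (fun r => piMap (modTauProj X r (x + y)) x)

/-- The `m`-th space of `τ⁻¹ X = colim X (-n)`, `n → ∞`: the mapping telescope of the `m`-th
spaces. -/
abbrev TauInv (X : Fil.{u}) (m : ℤ) : Type u :=
  Telescope (fun n : ℕ => (X.obj (op (-(n : ℤ)))).level m)
    (fun n => (X.trans (by push_cast; omega : -((n + 1 : ℕ) : ℤ) ≤ -(n : ℤ))).app m)

/-- The map of `m`-th spaces `τ⁻¹ X → τ⁻¹ Y`. -/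
def tauInvMap {X Y : Fil.{u}} (f : X ⟶ Y) (m : ℤ) : C(TauInv X m, TauInv Y m) :=
  telescopeMap (fun n : ℕ => (f.app (op (-(n : ℤ)))).app m) (fun n z =>
    congrArg (fun g : X.obj (op (-(n : ℤ))) ⟶ Y.obj (op (-((n + 1 : ℕ) : ℤ))) => g.app m z)
      (f.naturality _))

/-- `τ⁻¹ f` is an equivalence of spectra, i.e. induces isomorphisms on all homotopy groups.
Mapping telescopes of `Ω`-spectra are `Ω`-spectra, so that `π_k (τ⁻¹ X)` is the set of path
components of the `(-k)`-th space. -/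
def TauInvEquiv {X Y : Fil.{u}} (f : X ⟶ Y) : Prop :=
  ∀ m : ℤ, Function.Bijective (pathComponentsMap (tauInvMap f m))

/-! ### The linear t-structure -/

/-- Connective objects of the linear t-structure for the line `y = α x`: the `n`-th term lies in
the connective part of the t-structure on spectra generated by the sphere of dimension
`⌈n / (α + 1)⌉`. -/
def IsConnective (α : ℝ) (X : Fil.{u}) : Prop :=
  ∀ n k : ℤ, k < ⌈(n : ℝ) / (α + 1)⌉ → Subsingleton ((X.obj (op n)).pi k)

/-- Objects of `τ_{≤ -1}` of the linear t-structure for the line `y = α x`: the `n`-th term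
receives only zero maps from spheres of dimension at least `⌈n / (α + 1)⌉`. -/
def IsCoconnective (α : ℝ) (X : Fil.{u}) : Prop :=
  ∀ n k : ℤ, ⌈(n : ℝ) / (α + 1)⌉ ≤ k → Subsingleton ((X.obj (op n)).pi k)

/-- `f : X → Y` exhibits `X` as the connective cover of `Y` in the linear t-structure for
`y = α x`: in the cofibre sequence `X → Y → C` the object `X` is connective and `C` lies in
`τ_{≤ -1}`. -/
def ExhibitsCover (α : ℝ) {X Y : Fil.{u}} (f : X ⟶ Y) : Prop :=
  IsConnective α X ∧ IsCoconnective α (cofib f)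

/-! ### The `τ`-Bockstein spectral sequence -/

/-- The cycles `Z_r`, `r ≥ 2`: classes `a` in `π_{x,y} (X / τ)` with `δ a` divisible by
`τ ^ (r - 2)`. -/
def cycles (X : Fil.{u}) (r x y : ℤ) : AddSubgroup (gr X x y) :=
  (tau X (x - 1) (y + r) (y + 2)).range.comap (delta X (sub_add_cancel x 1) rfl)

/-- The boundaries `B_r`, `r ≥ 2`: the classes `[c]` with `c` in `π_{x,y} X` and
`τ ^ (r - 2) c = 0`. -/
def boundaries (X : Fil.{u}) (r x y : ℤ) : AddSubgroup (gr X x y) :=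
  (tau X x y (y - (r - 2))).ker.map (red X x y)

/-- The group `E_r` in bidegree `(x, y)`, for `r ≥ 2`. -/
abbrev Page (X : Fil.{u}) (r x y : ℤ) : Type u :=
  cycles X r x y ⧸ (boundaries X r x y).addSubgroupOf (cycles X r x y)

theorem grMap_mem_cycles {X Y : Fil.{u}} (f : X ⟶ Y) (r x y : ℤ) {a : gr X x y}
    (ha : a ∈ cycles X r x y) : grMap f x y a ∈ cycles Y r x y := by
  obtain ⟨c, hc⟩ := ha
  exact ⟨biMap f _ _ c, by rw [← tau_natural, hc, delta_natural]⟩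

theorem grMap_mem_boundaries {X Y : Fil.{u}} (f : X ⟶ Y) (r x y : ℤ) {a : gr X x y}
    (ha : a ∈ boundaries X r x y) : grMap f x y a ∈ boundaries Y r x y := by
  obtain ⟨c, hc, rfl⟩ := ha
  refine ⟨biMap f x y c, ?_, (red_natural f x y c).symm⟩
  rw [SetLike.mem_coe, AddMonoidHom.mem_ker, ← tau_natural, AddMonoidHom.mem_ker.1 hc, map_zero]

/-- The map `E_r(X) → E_r(Y)` induced by `f : X → Y`. -/
def pageMap {X Y : Fil.{u}} (f : X ⟶ Y) (r x y : ℤ) : Page X r x y →+ Page Y r x y :=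
  QuotientAddGroup.map _ _
    (((grMap f x y).comp (cycles X r x y).subtype).codRestrict (cycles Y r x y)
      fun a => grMap_mem_cycles f r x y a.2)
    fun _ ha => grMap_mem_boundaries f r x y ha

/-- The class `a` in `π_{x,y} (X / τ)` survives to `E_r` and represents `e` there. -/
def Represents {X : Fil.{u}} {r x y : ℤ} (a : gr X x y) (e : Page X r x y) : Prop :=
  ∃ h : a ∈ cycles X r x y, (QuotientAddGroup.mk ⟨a, h⟩ : Page X r x y) = e

/-- The class `e` in `E_r` survives to `E_s` and becomes `e'` there. -/
def SurvivesTo {X : Fil.{u}} {r s x y : ℤ} (e : Page X r x y) (e' : Page X s x y) : Prop :=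
  ∃ a : gr X x y, Represents a e ∧ Represents a e'

/-- `d_r z = w`: there are a representative `a` of `z` and a class `c` with
`δ a = τ ^ (r - 2) c` such that `[c]` represents `w`.  The bidegree of `w` is that of `z` plus
`(-1, r)`. -/
def IsDiff {X : Fil.{u}} {r x y x' y' : ℤ} (z : Page X r x y) (w : Page X r x' y') : Prop :=
  ∃ (hx : x' + 1 = x) (_ : y' = y + r) (a : gr X x y) (c : bi X x' y'),
    Represents a z ∧ delta X hx rfl a = tau X x' y' (y + 2) c ∧ Represents (red X x' y' c) w

/-- `d_r z = w` is a line-crossing differential for `y = α x`. -/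
def IsLineCrossing (α : ℝ) {X : Fil.{u}} {r x y x' y' : ℤ} (z : Page X r x y)
    (w : Page X r x' y') : Prop :=
  IsDiff z w ∧ w ≠ 0 ∧ (y : ℝ) ≤ α * x ∧ α * (x - 1) < y + r

/-- The class `e` of `E_r` supports a line-crossing differential `d_s`, for some `s ≥ r`. -/
def SupportsLineCrossing (α : ℝ) {X : Fil.{u}} {r x y : ℤ} (e : Page X r x y) : Prop :=
  ∃ (s : ℤ) (e' : Page X s x y) (w : Page X s (x - 1) (y + s)),
    r ≤ s ∧ SurvivesTo e e' ∧ IsLineCrossing α e' w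

/-- The class `e` of `E_r` is a permanent cycle in the strong sense that it has a representative
in the kernel of `δ`, i.e. one that lifts to `π_{x,y} X`. -/
def IsPermanentCycle {X : Fil.{u}} {r x y : ℤ} (e : Page X r x y) : Prop :=
  ∃ a : gr X x y, Represents a e ∧ delta X (sub_add_cancel x 1) rfl a = 0

/-- The conditions on the maps of `E_r`-pages, `r ≥ 2`; here `S` is the predicate that singles out
the image in the bidegrees `(x, y)` with `y ≤ α x` and `y + r > α (x - 1)`. -/
structure PageConditions (α : ℝ) {X Y : Fil.{u}} (f : X ⟶ Y)
    (S : ∀ {r x y : ℤ}, Page Y r x y → Prop) : Prop where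
  bijective : ∀ r x y : ℤ, 2 ≤ r → (y + r : ℝ) ≤ α * (x - 1) →
    Function.Bijective (pageMap f r x y)
  image : ∀ r x y : ℤ, 2 ≤ r → α * (x - 1) < y + r → (y : ℝ) ≤ α * x →
    ∀ e : Page Y r x y, (∃ e₀ : Page X r x y, pageMap f r x y e₀ = e) ↔ S e
  injective : ∀ r x y : ℤ, 2 ≤ r → y ≠ ⌊α * x⌋ → Function.Injective (pageMap f r x y)

/-! ### Dropped lifts -/

/-- `b` in `π_{x,y} Y` drops to the line `y = α x`: it lies above the line, `[b] ≠ 0`, and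
`τ ^ l b ≠ 0`, where `l = y - ⌊α x⌋`. -/
def Drops (α : ℝ) {Y : Fil.{u}} {x y : ℤ} (b : bi Y x y) : Prop :=
  α * x < y ∧ red Y x y b ≠ 0 ∧ tau Y x y ⌊α * x⌋ b ≠ 0

/-- `b` in `π_{x,y} Y` drops to the line, and `a` in `π_{x,y₀} X`, `y₀ = ⌊α x⌋`, is a dropped lift
of `b`, i.e. a lift of `τ ^ l b` along `f`. -/
def IsDroppedLift (α : ℝ) {X Y : Fil.{u}} (f : X ⟶ Y) {x y y₀ : ℤ} (b : bi Y x y)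
    (a : bi X x y₀) : Prop :=
  Drops α b ∧ y₀ = ⌊α * x⌋ ∧ biMap f x y₀ a = tau Y x y y₀ b

/-- `r > 1` is minimal with `τ ^ (l + r - 1) b = 0`, where `l = y - ⌊α x⌋`. -/
def IsTorsionOrder (α : ℝ) {Y : Fil.{u}} {x y : ℤ} (b : bi Y x y) (r : ℤ) : Prop :=
  1 < r ∧ tau Y x y (⌊α * x⌋ - (r - 1)) b = 0 ∧
    ∀ s : ℤ, 1 < s → s < r → tau Y x y (⌊α * x⌋ - (s - 1)) b ≠ 0

/-- In the spectral sequence of `Y`, the class `z` of `E_r` survives to `E_{l + r}`, where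
`l = y - ⌊α x⌋`, and `d_{l + r} z = [b]`; if `[b]` is nonzero in `E_{l + r}`, this is a
line-crossing differential. -/
def HitsDropping (α : ℝ) {Y : Fil.{u}} {r x₁ y₁ x y : ℤ} (z : Page Y r x₁ y₁) (b : bi Y x y) :
    Prop :=
  ∃ (z' : Page Y (y - ⌊α * x⌋ + r) x₁ y₁) (w : Page Y (y - ⌊α * x⌋ + r) x y),
    SurvivesTo z z' ∧ Represents (red Y x y b) w ∧ IsDiff z' w ∧
      (w ≠ 0 → IsLineCrossing α z' w)

/-- A differential `d_r zt = v` in the spectral sequence of `X` which comes from a line-crossing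
differential in that of `Y`: there are a class `b` that drops to the line, with dropped lift `a`,
such that `r > 1` is minimal with `τ ^ (l + r - 1) b = 0`, the class `v` is represented by `[a]`,
and `d_{l + r} (f zt) = [b]` is a (nonzero) line-crossing differential. -/
def IsDroppedDiff (α : ℝ) {X Y : Fil.{u}} (f : X ⟶ Y) {r x₁ y₁ x y₀ : ℤ} (zt : Page X r x₁ y₁)
    (v : Page X r x y₀) : Prop :=
  IsDiff zt v ∧ ∃ (y : ℤ) (b : bi Y x y) (a : bi X x y₀),
    IsDroppedLift α f b a ∧ IsTorsionOrder α b r ∧ Represents (red X x y₀ a) v ∧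
    ∃ (z' : Page Y (y - ⌊α * x⌋ + r) x₁ y₁) (w : Page Y (y - ⌊α * x⌋ + r) x y),
      SurvivesTo (pageMap f r x₁ y₁ zt) z' ∧ Represents (red Y x y b) w ∧ IsLineCrossing α z' w

end Fil

end LinearT

end

noncomputable section

namespace LinearT

/-! ### Generalized loops and their homotopies -/

/-! Write `L x = ⌊α * x⌋`. The long exact sequence of the cofibre turns the statement that `f` is a
connective cover into a statement about bigraded groups (`IsBiCover`): π_{x,y} X vanishes for y > L
x, and `f` is bijective on π_{x,y} for y ≤ L x. The only geometric input about the line is L (x - 1)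
≤ L x + 1, which is what α > -1 provides. Everything else is algebra in the exact triangle formed by
`tau`, `red` and `delta`, together with two limit facts: τ⁻¹ is a colimit of homotopy groups, and
(strong) completeness excludes compatible systems of τ-divisions (respectively infinitely
τ-divisible classes). The topological half of the file extracts these facts from the models:
exactness from homotopy fibres, colimits from telescopes, limits from homotopy limits of towers.

Sufficiency (`isBiCover_of_pages`). Above the line X/τ vanishes, so classes of X are infinitely
τ-divisible and completeness kills them. Surjectivity: τ⁻¹f provides a lift of some τ^d b, and one
factor τ at a time is removed using the E₂-page. Injectivity: page injectivity off the line pushes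
the divisibility of a class in the kernel up to the line; if the class were nonzero, the last
nonzero τ-multiple of the quotient, δ z, would map to zero. The permanent cycle f(z) lifts to a
class with δ = 0, and comparing the two classes on a page where `f` is bijective gives δ z = 0.

Necessity (`IsBiCover.pageConditions`). Vanishing above the line and bijectivity below allow every
element in a diagram chase to be lifted, except one: if f(a) = τ b with a on the line, then b lies
above the line and need not lift. This exception is the kernel on the line, and it produces the
dropped lifts.

For strongly complete Y, infinitely divisible classes vanish. Hence a class supporting no
line-crossing differential has δ = 0 (`IsStronglyComplete.isPermanentCycle`), and every class
staying nonzero has a maximal τ-division (`IsStronglyComplete.exists_division`). The relation δ u =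
τ^(r-2) a in X maps to δ f(u) = τ^(l+r-2) b in Y, so a d_r onto [a] is the shadow of a d_(l+r) onto
[b]; maximality of the division makes the latter nonzero. -/

theorem genLoop_homotopic_of {N : Type} {X : Type u} [TopologicalSpace X] {x : X}
    {f g : GenLoop N X x} (H : I → (N → I) → X)
    (hc : Continuous fun p : I × (N → I) => H p.1 p.2)
    (h0 : ∀ t, H 0 t = f t) (h1 : ∀ t, H 1 t = g t)
    (hb : ∀ s, ∀ t ∈ Cube.boundary N, H s t = x) : GenLoop.Homotopic f g :=
  ⟨{ toFun := fun p => H p.1 p.2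
     continuous_toFun := hc
     map_zero_left := h0
     map_one_left := h1
     prop' := fun s t ht => (hb s t ht).trans (f.2 t ht).symm }⟩

theorem exists_of_genLoop_homotopic {N : Type} {X : Type u} [TopologicalSpace X] {x : X}
    {f g : GenLoop N X x} (h : GenLoop.Homotopic f g) :
    ∃ H : I → (N → I) → X, (Continuous fun p : I × (N → I) => H p.1 p.2) ∧
      (∀ t, H 0 t = f t) ∧ (∀ t, H 1 t = g t) ∧ ∀ s, ∀ t ∈ Cube.boundary N, H s t = x := by
  obtain ⟨H⟩ := h
  refine ⟨fun s t => H (s, t), H.continuous, H.apply_zero, H.apply_one, fun s t ht => ?_⟩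
  exact (H.eq_fst s ht).trans (f.2 t ht)

/-- The class in `π₂` of a generalized loop. -/
def PiTwo.mk {P : PtdSpace.{u}} (g : GenLoop (Fin 2) P P.pt) : PiTwo P :=
  Additive.ofMul (Quotient.mk (GenLoop.Homotopic.setoid (Fin 2) P.pt) g)

theorem PiTwo.mk_surjective {P : PtdSpace.{u}} (a : PiTwo P) : ∃ g, PiTwo.mk g = a :=
  Quotient.exists_rep (s := GenLoop.Homotopic.setoid (Fin 2) P.pt) a

theorem PiTwo.mk_eq_mk {P : PtdSpace.{u}} {g g' : GenLoop (Fin 2) P P.pt} :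
    PiTwo.mk g = PiTwo.mk g' ↔ GenLoop.Homotopic g g' :=
  Quotient.eq (r := GenLoop.Homotopic.setoid (Fin 2) P.pt)

theorem PiTwo.mk_eq_zero {P : PtdSpace.{u}} {g : GenLoop (Fin 2) P P.pt} :
    PiTwo.mk g = 0 ↔ GenLoop.Homotopic g GenLoop.const :=
  PiTwo.mk_eq_mk (g' := GenLoop.const)

/-- The image of a generalized loop under a pointed map. -/
def PMap.genLoop {P Q : PtdSpace.{u}} {N : Type} (f : PMap P Q) (g : GenLoop N P P.pt) :
    GenLoop N Q Q.pt :=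
  ⟨f.toMap.comp g.1, fun t ht => by rw [ContinuousMap.comp_apply, g.2 t ht, f.map_pt]⟩

theorem piTwoMap_mk {P Q : PtdSpace.{u}} (f : PMap P Q) (g : GenLoop (Fin 2) P P.pt) :
    piTwoMap f (PiTwo.mk g) = PiTwo.mk (f.genLoop g) := rfl

theorem piTwoMap_id (P : PtdSpace.{u}) (a : PiTwo P) : piTwoMap (PMap.id P) a = a := by
  obtain ⟨g, rfl⟩ := PiTwo.mk_surjective a
  rfl

theorem IsWeakEquiv.homotopyMap_bijective {P Q : PtdSpace.{u}} {f : PMap P Q}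
    (hf : IsWeakEquiv f) (n : ℕ) {x : P} {y : Q} (h : f.toMap x = y) :
    Function.Bijective (homotopyMap (Fin n) f.toMap h) := by
  subst h
  exact hf n x

theorem IsWeakEquiv.piTwoMap_bijective {P Q : PtdSpace.{u}} {f : PMap P Q}
    (hf : IsWeakEquiv f) : Function.Bijective (piTwoMap f) :=
  hf.homotopyMap_bijective 2 f.map_pt

/-! ### The fibre sequence -/

/-- Generalized loops in a homotopy fibre from their two components. -/
def fibGenLoop {P Q : PtdSpace.{u}} (f : PMap P Q) {N : Type} (g : (N → I) → P)
    (c : (N → I) → I → Q) (hg : Continuous g)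
    (hc : Continuous fun p : (N → I) × I => c p.1 p.2) (h0 : ∀ t, c t 0 = Q.pt)
    (h1 : ∀ t, c t 1 = f (g t)) (hgb : ∀ t ∈ Cube.boundary N, g t = P.pt)
    (hcb : ∀ t ∈ Cube.boundary N, ∀ s, c t s = Q.pt) : GenLoop N (fib f) (fib f).pt :=
  ⟨{ toFun := fun t => ⟨(g t, ⟨c t, hc.comp (by fun_prop : Continuous fun s : I => (t, s))⟩),
        h0 t, h1 t⟩
     continuous_toFun := Continuous.subtype_mk (hg.prodMk
        (ContinuousMap.continuous_of_continuous_uncurry _ hc)) _ },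
    fun t ht => Subtype.ext (Prod.ext (hgb t ht) (ContinuousMap.ext (hcb t ht)))⟩

theorem fib_homotopic_of {P Q : PtdSpace.{u}} {f : PMap P Q} {N : Type}
    {w w' : GenLoop N (fib f) (fib f).pt} (G : I → (N → I) → P) (C : I → (N → I) → I → Q)
    (hG : Continuous fun p : I × (N → I) => G p.1 p.2)
    (hC : Continuous fun p : (I × (N → I)) × I => C p.1.1 p.1.2 p.2)
    (h0 : ∀ u t, C u t 0 = Q.pt) (h1 : ∀ u t, C u t 1 = f (G u t))
    (hG0 : ∀ t, G 0 t = (w t).1.1) (hG1 : ∀ t, G 1 t = (w' t).1.1)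
    (hC0 : ∀ t s, C 0 t s = (w t).1.2 s) (hC1 : ∀ t s, C 1 t s = (w' t).1.2 s)
    (hGb : ∀ u, ∀ t ∈ Cube.boundary N, G u t = P.pt)
    (hCb : ∀ u, ∀ t ∈ Cube.boundary N, ∀ s, C u t s = Q.pt) : GenLoop.Homotopic w w' := by
  refine genLoop_homotopic_of (fun u t => ⟨(G u t, ⟨C u t, hC.comp
    (by fun_prop : Continuous fun s : I => ((u, t), s))⟩), h0 u t, h1 u t⟩)
    (Continuous.subtype_mk (hG.prodMk (ContinuousMap.continuous_of_continuous_uncurry _ hC)) _)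
    (fun t => ?_) (fun t => ?_) fun u t ht => ?_
  · exact Subtype.ext (Prod.ext (hG0 t) (ContinuousMap.ext (hC0 t)))
  · exact Subtype.ext (Prod.ext (hG1 t) (ContinuousMap.ext (hC1 t)))
  · exact Subtype.ext (Prod.ext (hGb u t ht) (ContinuousMap.ext (hCb u t ht)))

theorem continuous_fib_snd {P Q : PtdSpace.{u}} {f : PMap P Q} {Z : Type*} [TopologicalSpace Z]
    {w : Z → fib f} {s : Z → I} (hw : Continuous w) (hs : Continuous s) :
    Continuous fun z => (w z).1.2 (s z) :=
  ContinuousEval.continuous_eval.comp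
    (((continuous_snd.comp continuous_subtype_val).comp hw).prodMk hs)

theorem continuous_fib_fst {P Q : PtdSpace.{u}} {f : PMap P Q} {Z : Type*} [TopologicalSpace Z]
    {w : Z → fib f} (hw : Continuous w) : Continuous fun z => (w z).1.1 :=
  (continuous_fst.comp continuous_subtype_val).comp hw

/-- Exactness of `π₂ (fib f) → π₂ P → π₂ Q`. -/
theorem piTwo_exact_base {P Q : PtdSpace.{u}} (f : PMap P Q) (a : PiTwo P) :
    piTwoMap f a = 0 ↔ ∃ w, piTwoMap (fibProj f) w = a := by
  constructor
  · obtain ⟨g, rfl⟩ := PiTwo.mk_surjective a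
    intro h
    rw [piTwoMap_mk, PiTwo.mk_eq_zero] at h
    obtain ⟨H, hc, h0, h1, hb⟩ := exists_of_genLoop_homotopic h
    -- The path coordinate of `fib` starts at the base point and ends at `f p`, so the null homotopy
    -- is traversed backwards.
    refine ⟨PiTwo.mk (fibGenLoop f g (fun t s => H (σ s) t) g.1.continuous ?_ ?_ ?_ g.2
      fun t ht s => hb _ t ht), rfl⟩
    · exact hc.comp (by fun_prop : Continuous fun p : (Fin 2 → I) × I => (σ p.2, p.1))
    · intro t
      rw [unitInterval.symm_zero, h1]; rfl
    · intro t
      rw [unitInterval.symm_one, h0]; rfl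
  · rintro ⟨w, rfl⟩
    obtain ⟨w, rfl⟩ := PiTwo.mk_surjective w
    rw [piTwoMap_mk, piTwoMap_mk, PiTwo.mk_eq_zero]
    refine genLoop_homotopic_of (fun u t => (w t).1.2 (σ u))
      (continuous_fib_snd (w.1.continuous.comp continuous_snd) (by fun_prop)) ?_ ?_ ?_
    · intro t
      rw [unitInterval.symm_zero]
      exact (w t).2.2
    · intro t
      rw [unitInterval.symm_one]
      exact (w t).2.1
    · intro u t ht
      rw [show w t = (fib f).pt from w.2 t ht]
      rfl

/-- Generalized loops in a loop space. -/
def loopGenLoop {P : PtdSpace.{u}} {N : Type} (c : (N → I) → I → P)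
    (hc : Continuous fun p : (N → I) × I => c p.1 p.2) (h0 : ∀ t, c t 0 = P.pt)
    (h1 : ∀ t, c t 1 = P.pt) (hcb : ∀ t ∈ Cube.boundary N, ∀ s, c t s = P.pt) :
    GenLoop N (loop P) (loop P).pt :=
  ⟨{ toFun := fun t => (⟨⟨c t, hc.comp (by fun_prop : Continuous fun s : I => (t, s))⟩,
        h0 t, h1 t⟩ : Path P.pt P.pt)
     continuous_toFun := Path.continuous_uncurry_iff.1 hc },
    fun t ht => Path.ext (funext (hcb t ht))⟩

theorem loop_homotopic_of {P : PtdSpace.{u}} {N : Type}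
    {w w' : GenLoop N (loop P) (loop P).pt} (C : I → (N → I) → I → P)
    (hC : Continuous fun p : (I × (N → I)) × I => C p.1.1 p.1.2 p.2)
    (h0 : ∀ u t, C u t 0 = P.pt) (h1 : ∀ u t, C u t 1 = P.pt)
    (hC0 : ∀ t s, C 0 t s = asPath (w t) s) (hC1 : ∀ t s, C 1 t s = asPath (w' t) s)
    (hCb : ∀ u, ∀ t ∈ Cube.boundary N, ∀ s, C u t s = P.pt) : GenLoop.Homotopic w w' := by
  refine genLoop_homotopic_of (fun u t => (⟨⟨C u t, hC.comp
    (by fun_prop : Continuous fun s : I => ((u, t), s))⟩, h0 u t, h1 u t⟩ : Path P.pt P.pt))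
    (Path.continuous_uncurry_iff.1 hC) (fun t => ?_) (fun t => ?_) fun u t ht => ?_
  · exact Path.ext (funext (hC0 t))
  · exact Path.ext (funext (hC1 t))
  · exact Path.ext (funext (hCb u t ht))

/-- Exactness of `π₂ (Ω Q) → π₂ (fib f) → π₂ P`. -/
theorem piTwo_exact_fib {P Q : PtdSpace.{u}} (f : PMap P Q) (w : PiTwo (fib f)) :
    piTwoMap (fibProj f) w = 0 ↔ ∃ c, piTwoMap (fibIncl f) c = w := by
  constructor
  · obtain ⟨w, rfl⟩ := PiTwo.mk_surjective w
    intro h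
    rw [piTwoMap_mk, PiTwo.mk_eq_zero] at h
    obtain ⟨H, hc, h0, h1, hb⟩ := exists_of_genLoop_homotopic h
    -- the path of `w t` followed by the image of the track of the homotopy
    let D : (Fin 2 → I) → ℝ → Q := fun t v =>
      if v ≤ 1 then (w t).1.2 (Set.projIcc 0 1 zero_le_one v)
      else f (H (Set.projIcc 0 1 zero_le_one (v - 1)) t)
    have hw : Continuous fun t => w t := w.1.continuous
    have hD : Continuous fun p : (Fin 2 → I) × ℝ => D p.1 p.2 := by
      refine Continuous.if_le ?_ ?_ continuous_snd continuous_const ?_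
      · exact continuous_fib_snd (hw.comp continuous_fst)
          (continuous_projIcc.comp continuous_snd)
      · have hp : Continuous fun p : (Fin 2 → I) × ℝ =>
            ((Set.projIcc 0 1 zero_le_one (p.2 - 1) : I), p.1) :=
          (continuous_projIcc.comp (by fun_prop)).prodMk continuous_fst
        exact f.continuous.comp (hc.comp hp)
      · rintro ⟨t, v⟩ (rfl : v = 1)
        simp only [sub_self, Set.projIcc_left, Set.projIcc_right]
        change (w t).1.2 1 = f (H 0 t)
        rw [h0]
        exact (w t).2.2
    have hD0 : ∀ t, D t 0 = Q.pt := fun t => by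
      simp only [D, zero_le_one, if_true, Set.projIcc_left]
      exact (w t).2.1
    have hDb : ∀ t ∈ Cube.boundary (Fin 2), ∀ v, D t v = Q.pt := fun t ht v => by
      simp only [D, hb _ t ht]
      rw [show w t = (fib f).pt from w.2 t ht]
      split_ifs
      · rfl
      · exact f.map_pt
    have hD1 : ∀ t (u : I), D t (1 + u) = f (H u t) := fun t u => by
      simp only [D]
      split_ifs with h
      · have hu : u = 0 := le_antisymm (by
          have : (u : ℝ) ≤ 0 := by linarith
          exact this) u.2.1
        subst hu
        rw [h0, Set.Icc.coe_zero, add_zero, Set.projIcc_right]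
        exact (w t).2.2
      · simp
    have hDw : ∀ t (s : I), D t s = (w t).1.2 s := fun t s => by
      simp only [D, if_pos s.2.2, Set.projIcc_val]
    refine ⟨PiTwo.mk (loopGenLoop (fun t s => D t (2 * s)) ?_ ?_ ?_ fun t ht s => hDb t ht _), ?_⟩
    · exact hD.comp (by fun_prop : Continuous fun p : (Fin 2 → I) × I => (p.1, 2 * (p.2 : ℝ)))
    · intro t
      simpa using hD0 t
    · intro t
      have := hD1 t 1
      rw [h1] at this
      rw [show (2 : ℝ) * ((1 : I) : ℝ) = 1 + ((1 : I) : ℝ) by norm_num, this]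
      exact f.map_pt
    · rw [piTwoMap_mk, PiTwo.mk_eq_mk]
      -- At time `u` the path coordinate is the initial piece of `D t` of length `1 + u`, whose
      -- endpoint is `f (H u t)`: all of `w t` at `u = 0`, the whole loop at `u = 1`.
      refine GenLoop.Homotopic.symm (fib_homotopic_of H (fun u t s => D t (s * (1 + u))) hc
        ?_ ?_ ?_ h0 h1 ?_ ?_ hb fun u t ht s => hDb t ht _)
      · exact hD.comp (by fun_prop : Continuous fun p : (I × (Fin 2 → I)) × I =>
          (p.1.2, (p.2 : ℝ) * (1 + (p.1.1 : ℝ))))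
      · intro u t
        simpa using hD0 t
      · intro u t
        simpa using hD1 t u
      · intro t s
        simpa using hDw t s
      · intro t s
        change D t _ = D t _
        congr 1
        rw [Set.Icc.coe_one]
        ring
  · rintro ⟨c, rfl⟩
    obtain ⟨c, rfl⟩ := PiTwo.mk_surjective c
    rfl

/-- Exactness of `π₂ (Ω P) → π₂ (Ω Q) → π₂ (fib f)`. -/
theorem piTwo_exact_loop {P Q : PtdSpace.{u}} (f : PMap P Q) (c : PiTwo (loop Q)) :
    piTwoMap (fibIncl f) c = 0 ↔ ∃ a, piTwoMap (loopMap f) a = c := by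
  constructor
  · obtain ⟨c, rfl⟩ := PiTwo.mk_surjective c
    intro h
    rw [piTwoMap_mk, PiTwo.mk_eq_zero] at h
    obtain ⟨W, hW, W0, W1, hb⟩ := exists_of_genLoop_homotopic h
    have hC : Continuous fun p : (I × (Fin 2 → I)) × I => (W p.1.1 p.1.2).1.2 p.2 :=
      continuous_fib_snd (hW.comp continuous_fst) continuous_snd
    have b0 : ∀ u t, (W u t).1.2 0 = Q.pt := fun u t => (W u t).2.1
    have b1 : ∀ u t, (W u t).1.2 1 = f (W u t).1.1 := fun u t => (W u t).2.2
    have g0 : ∀ t, (W 0 t).1.1 = P.pt := fun t => by rw [W0]; rfl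
    have g1 : ∀ t, (W 1 t).1.1 = P.pt := fun t => by rw [W1]; rfl
    have c0 : ∀ t s, (W 0 t).1.2 s = asPath (c t) s := fun t s => by rw [W0]; rfl
    have c1 : ∀ t s, (W 1 t).1.2 s = Q.pt := fun t s => by rw [W1]; rfl
    have bb : ∀ u, ∀ t ∈ Cube.boundary (Fin 2), ∀ s, (W u t).1.2 s = Q.pt := fun u t ht s => by
      rw [hb u t ht]; rfl
    have c01 : ∀ t, (W 0 t).1.2 1 = Q.pt := fun t => by rw [b1, g0, f.map_pt]
    refine ⟨PiTwo.mk (loopGenLoop (fun t s => (W (σ s) t).1.1) ?_ ?_ ?_ ?_), ?_⟩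
    · exact continuous_fib_fst (hW.comp
        (by fun_prop : Continuous fun p : (Fin 2 → I) × I => (σ p.2, p.1)))
    · intro t
      rw [unitInterval.symm_zero, g1]
    · intro t
      rw [unitInterval.symm_one, g0]
    · intro t ht s
      rw [hb _ t ht]; rfl
    · rw [piTwoMap_mk, PiTwo.mk_eq_mk]
      -- In the square of values `(W u t).1.2 s` the edges `s = 0` and `u = 1` are constant. The
      -- edge `u = 0` is `c t`, the edge `s = 1` is the image under `f` of the loop just built, and
      -- both are deformed to the antidiagonal `u = σ s`.
      refine GenLoop.Homotopic.symm (GenLoop.Homotopic.trans (g := loopGenLoop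
        (fun t s => (W (σ s) t).1.2 s) ?_ ?_ ?_ fun t ht s => bb _ t ht s) ?_ ?_)
      · exact hC.comp (by fun_prop : Continuous fun p : (Fin 2 → I) × I => ((σ p.2, p.1), p.2))
      · intro t
        rw [b0]
      · intro t
        rw [unitInterval.symm_one, c01]
      · refine loop_homotopic_of (fun u t s => (W (u * σ s) t).1.2 s) ?_ ?_ ?_ ?_ ?_
          fun u t ht s => bb _ t ht s
        · exact hC.comp (by fun_prop : Continuous fun p : (I × (Fin 2 → I)) × I =>
            ((p.1.1 * σ p.2, p.1.2), p.2))
        · intro u t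
          rw [b0]
        · intro u t
          rw [unitInterval.symm_one, mul_zero, c01]
        · intro t s
          rw [zero_mul, c0]
        · intro t s
          rw [one_mul]; rfl
      · refine loop_homotopic_of (fun u t s => (W (σ s) t).1.2 (σ (σ u * σ s))) ?_ ?_ ?_ ?_ ?_
          fun u t ht s => bb _ t ht _
        · exact hC.comp (by fun_prop : Continuous fun p : (I × (Fin 2 → I)) × I =>
            ((σ p.2, p.1.2), σ (σ p.1.1 * σ p.2)))
        · intro u t
          rw [unitInterval.symm_zero, c1]
        · intro u t
          rw [unitInterval.symm_one, mul_zero, unitInterval.symm_zero, c01]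
        · intro t s
          have : σ (σ 0 * σ s) = s := by
            rw [unitInterval.symm_zero, one_mul, unitInterval.symm_symm]
          exact congrArg (fun v => (W (σ s) t).1.2 v) this
        · intro t s
          have : σ (σ 1 * σ s) = 1 := by
            rw [unitInterval.symm_one, zero_mul, unitInterval.symm_zero]
          exact (congrArg (fun v => (W (σ s) t).1.2 v) this).trans (b1 _ _)
  · rintro ⟨a, rfl⟩
    obtain ⟨a, rfl⟩ := PiTwo.mk_surjective a
    rw [piTwoMap_mk, piTwoMap_mk, PiTwo.mk_eq_zero]
    have ha : Continuous fun t => a t := a.1.continuous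
    -- The loop is shrunk to its initial segment of length `σ u`, whose image under `f` serves as
    -- path coordinate.
    refine fib_homotopic_of (fun u t => asPath (a t) (σ u))
      (fun u t s => f (asPath (a t) (σ u * s))) ?_ ?_ ?_ ?_ ?_ ?_ ?_ ?_ ?_ ?_
    · exact continuous_asPath (ha.comp continuous_snd) (by fun_prop)
    · exact f.continuous.comp (continuous_asPath (ha.comp (by fun_prop)) (by fun_prop))
    · intro u t
      rw [mul_zero, (asPath (a t)).source, f.map_pt]
    · intro u t
      rw [mul_one]
    · intro t
      rw [unitInterval.symm_zero, (asPath (a t)).target]; rfl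
    · intro t
      rw [unitInterval.symm_one, (asPath (a t)).source]; rfl
    · intro t s
      rw [unitInterval.symm_zero, one_mul]; rfl
    · intro t s
      rw [unitInterval.symm_one, zero_mul, (asPath (a t)).source, f.map_pt]; rfl
    · intro u t ht
      rw [show a t = (loop P).pt from a.2 t ht]; rfl
    · intro u t ht s
      rw [show a t = (loop P).pt from a.2 t ht]
      exact f.map_pt

/-! ### The long exact sequence of a cofibre -/

namespace PreSpec

theorem piMap_id (E : PreSpec.{u}) (k : ℤ) (a : E.pi k) : piMap (𝟙 E) k a = a :=
  piTwoMap_id _ a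

theorem piTwoMap_levelCast_bijective (E : PreSpec.{u}) {m m' : ℤ} (h : m = m') :
    Function.Bijective (piTwoMap (E.levelCast h)) := by
  subst h
  refine ⟨fun a b hab => ?_, fun a => ⟨a, piTwoMap_id _ a⟩⟩
  rwa [show E.levelCast rfl = PMap.id _ from rfl, piTwoMap_id, piTwoMap_id] at hab

/-- Since the cofibre is the homotopy fibre one level up, exactness at the target is exactness at π₂
(Ω Q) in the fibre sequence, transported along the structure maps, which are bijective on π₂. The
next two lemmas treat the other two spots of the long exact sequence in the same way. -/
theorem toCofib_eq_zero_iff {E F : PreSpec.{u}} (f : E ⟶ F) (hE : E.IsOmega) (hF : F.IsOmega)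
    (k : ℤ) (z : F.pi k) : toCofib f k z = 0 ↔ ∃ a, piMap f k a = z := by
  have h0 : toCofib f k z = piTwoMap (fibIncl (f.app (2 - k + 1))) (piTwoMap (F.str (2 - k)) z) :=
    piTwoMap_comp _ _ z
  rw [h0]
  refine (piTwo_exact_loop _ _).trans ?_
  have key : ∀ a : E.pi k, piTwoMap (F.str (2 - k)) (piMap f k a) =
      piTwoMap (loopMap (f.app (2 - k + 1))) (piTwoMap (E.str (2 - k)) a) := fun a => by
    rw [piMap, ← piTwoMap_comp, f.comm, piTwoMap_comp]
  constructor
  · rintro ⟨c, hc⟩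
    obtain ⟨a, rfl⟩ := (hE (2 - k)).piTwoMap_bijective.2 c
    exact ⟨a, (hF (2 - k)).piTwoMap_bijective.1 ((key a).trans hc)⟩
  · rintro ⟨a, rfl⟩
    exact ⟨_, (key a).symm⟩

theorem boundary_eq_zero_iff {E F : PreSpec.{u}} (f : E ⟶ F) (hF : F.IsOmega) {k k' : ℤ}
    (hk : k' + 1 = k) (w : (cofib f).pi k) : boundary f hk w = 0 ↔ ∃ z, toCofib f k z = w := by
  have h : 2 - k + 1 = 2 - k' := by omega
  have h0 : boundary f hk w =
      piTwoMap (E.levelCast h) (piTwoMap (fibProj (f.app (2 - k + 1))) w) := piTwoMap_comp _ _ w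
  rw [h0, map_eq_zero_iff _ (piTwoMap_levelCast_bijective E _).1]
  refine (piTwo_exact_fib (f.app (2 - k + 1)) w).trans ?_
  constructor
  · rintro ⟨c, hc⟩
    obtain ⟨z, rfl⟩ := (hF (2 - k)).piTwoMap_bijective.2 c
    exact ⟨z, (piTwoMap_comp _ _ _).trans hc⟩
  · rintro ⟨z, hz⟩
    exact ⟨_, (piTwoMap_comp _ _ _).symm.trans hz⟩

theorem piMap_eq_zero_iff {E F : PreSpec.{u}} (f : E ⟶ F) {k k' : ℤ} (hk : k' + 1 = k)
    (a : E.pi k') : piMap f k' a = 0 ↔ ∃ w : (cofib f).pi k, boundary f hk w = a := by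
  have h : 2 - k + 1 = 2 - k' := by omega
  obtain ⟨a, rfl⟩ := (piTwoMap_levelCast_bijective E h).2 a
  have key : piMap f k' (piTwoMap (E.levelCast h) a) =
      piTwoMap (F.levelCast h) (piTwoMap (f.app (2 - k + 1)) a) := by
    rw [piMap, ← piTwoMap_comp, ← levelCast_natural, piTwoMap_comp]
  rw [key, map_eq_zero_iff _ (piTwoMap_levelCast_bijective F h).1, piTwo_exact_base]
  constructor
  · rintro ⟨w, rfl⟩
    exact ⟨w, piTwoMap_comp _ _ w⟩
  · rintro ⟨w, hw⟩
    exact ⟨w, (piTwoMap_levelCast_bijective E h).1 ((piTwoMap_comp _ _ w).symm.trans hw)⟩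

end PreSpec

/-! ### Path components of mapping telescopes -/

section Telescope

variable {P : ℕ → PtdSpace.{u}} {p : ∀ n, PMap (P n) (P (n + 1))}

/-- The composite `P n → P N` of the maps of a sequence. -/
def telIter (p : ∀ n, PMap (P n) (P (n + 1))) {n N : ℕ} (h : n ≤ N) (z : P n) : P N :=
  Nat.leRecOn (C := fun n => P n) h (fun {k} z => p k z) z

theorem telIter_self {n : ℕ} (z : P n) : telIter p le_rfl z = z :=
  Nat.leRecOn_self (C := fun n => (P n).carrier) z

theorem telIter_succ {n N : ℕ} (h : n ≤ N) (z : P n) :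
    telIter p (Nat.le_succ_of_le h) z = p N (telIter p h z) :=
  Nat.leRecOn_succ (C := fun n => (P n).carrier) h z

theorem telIter_trans {n N M : ℕ} (h : n ≤ N) (h' : N ≤ M) (z : P n) :
    telIter p h' (telIter p h z) = telIter p (h.trans h') z :=
  (Nat.leRecOn_trans (C := fun n => (P n).carrier) h h' z).symm

theorem telIter_map {n N : ℕ} (h : n + 1 ≤ N) (z : P n) :
    telIter p h (p n z) = telIter p (Nat.le_of_succ_le h) z := by
  rw [← telIter_trans (Nat.le_succ n) h, telIter_succ le_rfl, telIter_self]

theorem continuous_telIter {n N : ℕ} (h : n ≤ N) : Continuous (telIter p h) := by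
  induction N, h using Nat.le_induction with
  | base => exact continuous_id.congr fun z => (telIter_self z).symm
  | succ N h ih => exact ((p N).continuous.comp ih).congr fun z => (telIter_succ h z).symm

/-- The class of a point in the mapping telescope. -/
def telMk (p : ∀ n, PMap (P n) (P (n + 1))) (n : ℕ) (z : P n) (t : I) : Telescope P p :=
  Quot.mk _ ⟨n, z, t⟩

theorem continuous_telMk (n : ℕ) : Continuous fun w : P n × I => telMk p n w.1 w.2 :=
  continuous_quot_mk.comp (@continuous_sigmaMk ℕ (fun n => (P n).carrier × I) _ n)

theorem telMk_one (n : ℕ) (z : P n) : telMk p n z 1 = telMk p (n + 1) (p n z) 0 :=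
  Quot.sound (TelRel.glue n z)

theorem joined_telMk_zero (n : ℕ) (z : P n) (t : I) :
    Joined (telMk p n z 0) (telMk p n z t) :=
  ⟨{ toFun := fun s => telMk p n z (s * t)
     continuous_toFun := (continuous_telMk n).comp (by fun_prop : Continuous fun s : I => (z, s * t))
     source' := by simp
     target' := by simp }⟩

theorem joined_telMk {n : ℕ} {z z' : P n} (h : Joined z z') :
    Joined (telMk p n z 0) (telMk p n z' 0) :=
  h.map ((continuous_telMk n).comp (by fun_prop : Continuous fun z : P n => (z, (0 : I))))

theorem joined_telIter {n N : ℕ} (h : n ≤ N) (z : P n) :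
    Joined (telMk p n z 0) (telMk p N (telIter p h z) 0) := by
  induction N, h using Nat.le_induction with
  | base => rw [telIter_self]
  | succ N h ih =>
    refine ih.trans ?_
    rw [telIter_succ h, ← telMk_one]
    exact joined_telMk_zero _ _ _

open Classical in
/-- The retraction of a neighbourhood of the image of `P n` in the telescope to `P n`, extended
by the base point. -/
def telRetract (p : ∀ n, PMap (P n) (P (n + 1))) (n : ℕ) : Telescope P p → P n :=
  Quot.lift (fun w : Σ k, P k × I =>
    if h : w.1 = n then (if w.2.2 = 1 then (P n).pt else h ▸ w.2.1)
    else if h : w.1 + 1 = n then (if w.2.2 = 0 then (P n).pt else h ▸ p w.1 w.2.1)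
    else (P n).pt) (by
    rintro _ _ ⟨k, z⟩
    by_cases h : k + 1 = n
    · subst h
      simp
    · by_cases h1 : k = n
      · subst h1
        simp
      · simp [h, h1])

/-- The neighbourhood of the image of `P n` in the telescope on which the retraction to `P n`
is continuous. -/
def telNhd (p : ∀ n, PMap (P n) (P (n + 1))) (n : ℕ) : Set (Telescope P p) :=
  {q | Quot.lift (fun w : Σ k, P k × I => (w.1 = n ∧ w.2.2 ≠ 1) ∨ (w.1 + 1 = n ∧ w.2.2 ≠ 0)) (by
    rintro _ _ ⟨k, z⟩
    refine propext ?_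
    by_cases h : k + 1 = n <;> simp [h]) q}

theorem telMk_mem_telNhd {n k : ℕ} {z : P k} {t : I} :
    telMk p k z t ∈ telNhd p n ↔ (k = n ∧ t ≠ 1) ∨ (k + 1 = n ∧ t ≠ 0) := Iff.rfl

theorem telRetract_telMk_self {n : ℕ} {z : P n} {t : I} (ht : t ≠ 1) :
    telRetract p n (telMk p n z t) = z := by
  simp [telRetract, telMk, ht]

theorem telRetract_telMk_succ {n : ℕ} {z : P n} {t : I} (ht : t ≠ 0) :
    telRetract p (n + 1) (telMk p n z t) = p n z := by
  simp [telRetract, telMk, ht]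

theorem isOpen_telescope_iff {U : Set (Telescope P p)} :
    IsOpen U ↔ ∀ k, IsOpen {w : P k × I | telMk p k w.1 w.2 ∈ U} :=
  isOpen_coinduced.trans isOpen_sigma_iff

/-- On the n-th cylinder the set is V × [0,1), on the preceding one p⁻¹V × (0,1], and it is empty on
all others. The case of all of `P n` shows that the neighbourhood is open; general V gives
continuity of the retraction. -/
theorem isOpen_telNhd_inter (n : ℕ) {V : Set (P n)} (hV : IsOpen V) :
    IsOpen (telNhd p n ∩ telRetract p n ⁻¹' V) := by
  rw [isOpen_telescope_iff]
  intro k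
  by_cases h : k = n
  · subst h
    have : {w : P k × I | telMk p k w.1 w.2 ∈ telNhd p k ∩ telRetract p k ⁻¹' V} =
        V ×ˢ ({1}ᶜ : Set I) := by
      ext ⟨z, t⟩
      by_cases ht : t = 1
      · simp [telMk_mem_telNhd, ht]
      · simp [telMk_mem_telNhd, ht, telRetract_telMk_self]
    rw [this]
    exact hV.prod isOpen_compl_singleton
  · by_cases h' : k + 1 = n
    · subst h'
      have : {w : P k × I | telMk p k w.1 w.2 ∈ telNhd p (k + 1) ∩ telRetract p (k + 1) ⁻¹' V} =
          (p k ⁻¹' V) ×ˢ ({0}ᶜ : Set I) := by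
        ext ⟨z, t⟩
        by_cases ht : t = 0
        · simp [telMk_mem_telNhd, ht]
        · simp [telMk_mem_telNhd, ht, telRetract_telMk_succ]
      rw [this]
      exact (hV.preimage (p k).continuous).prod isOpen_compl_singleton
    · simp [telMk_mem_telNhd, h, h']

theorem isOpen_telNhd (n : ℕ) : IsOpen (telNhd p n) := by
  simpa using isOpen_telNhd_inter (p := p) n isOpen_univ

theorem continuousOn_telRetract (n : ℕ) : ContinuousOn (telRetract p n) (telNhd p n) :=
  (continuousOn_open_iff (isOpen_telNhd n)).2 fun _ hV => isOpen_telNhd_inter n hV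

theorem exists_mem_telNhd (q : Telescope P p) : ∃ n, q ∈ telNhd p n := by
  obtain ⟨⟨k, z, t⟩, rfl⟩ := Quot.exists_rep q
  by_cases ht : t = 1
  · exact ⟨k + 1, Or.inr ⟨rfl, by simp [ht]⟩⟩
  · exact ⟨k, Or.inl ⟨rfl, ht⟩⟩

/-- A point of the telescope becomes joined to a given point `z'` of `P m` after passing to a
later stage. -/
def TelJoined (p : ∀ n, PMap (P n) (P (n + 1))) (m : ℕ) (z' : P m) : Telescope P p → Prop :=
  Quot.lift (fun w : Σ k, P k × I => ∃ (N : ℕ) (h : w.1 ≤ N) (h' : m ≤ N),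
    Joined (telIter p h w.2.1) (telIter p h' z')) (by
    rintro _ _ ⟨k, z⟩
    refine propext ⟨?_, ?_⟩
    · rintro ⟨N, h, h', H⟩
      refine ⟨N + 1, Nat.succ_le_succ h, Nat.le_succ_of_le h', ?_⟩
      rw [telIter_map, telIter_succ h, telIter_succ h']
      exact H.map (p N).continuous
    · rintro ⟨N, h, h', H⟩
      refine ⟨N, Nat.le_of_succ_le h, h', ?_⟩
      rwa [telIter_map] at H)

theorem TelJoined.of_joined {m : ℕ} {z' : P m} {n : ℕ} {z₁ z₂ : P n} {t₁ t₂ : I}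
    (h : Joined z₁ z₂) (H : TelJoined p m z' (telMk p n z₁ t₁)) :
    TelJoined p m z' (telMk p n z₂ t₂) := by
  obtain ⟨N, h₁, h₂, H⟩ := H
  exact ⟨N, h₁, h₂, (h.symm.map (continuous_telIter h₁)).trans H⟩

theorem telJoined_retract {m : ℕ} {z' : P m} {n : ℕ} {q : Telescope P p} (hq : q ∈ telNhd p n) :
    TelJoined p m z' q ↔ TelJoined p m z' (telMk p n (telRetract p n q) 0) := by
  obtain ⟨⟨k, z, t⟩, rfl⟩ := Quot.exists_rep q
  change telMk p k z t ∈ _ at hq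
  change TelJoined p m z' (telMk p k z t) ↔
    TelJoined p m z' (telMk p n (telRetract p n (telMk p k z t)) 0)
  obtain ⟨rfl, ht⟩ | ⟨rfl, ht⟩ := telMk_mem_telNhd.1 hq
  · rw [telRetract_telMk_self ht]
    exact ⟨TelJoined.of_joined (Joined.refl _), TelJoined.of_joined (Joined.refl _)⟩
  · rw [telRetract_telMk_succ ht, ← telMk_one]
    exact ⟨TelJoined.of_joined (Joined.refl _), TelJoined.of_joined (Joined.refl _)⟩

/-- `TelJoined` is locally constant along a path: near a given time the path stays in one `telNhd p
n`, where the retraction turns short pieces of it into paths in `P n`. Connectedness of the interval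
finishes the argument, and path components of the telescope become the colimit of those of the
stages. -/
theorem TelJoined.of_joined_telescope {m : ℕ} {z' : P m} {q q' : Telescope P p}
    (h : Joined q q') (H : TelJoined p m z' q) : TelJoined p m z' q' := by
  obtain ⟨γ⟩ := h
  have : LocallyPathConnectedSpace I := (convex_Icc (0 : ℝ) 1).locallyPathConnectedSpace
  have hl : IsLocallyConstant fun s : I => TelJoined p m z' (γ s) := by
    rw [IsLocallyConstant.iff_eventually_eq]
    intro s₀
    obtain ⟨n, hn⟩ := exists_mem_telNhd (γ s₀)
    have hO : IsOpen (γ ⁻¹' telNhd p n) := (isOpen_telNhd n).preimage γ.continuous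
    obtain ⟨W, ⟨hW, hWc⟩, hWO⟩ :=
      (path_connected_basis s₀).mem_iff.1 (hO.mem_nhds (show s₀ ∈ γ ⁻¹' telNhd p n from hn))
    filter_upwards [hW] with s hs
    obtain ⟨δ, hδ⟩ := hWc.joinedIn s₀ (mem_of_mem_nhds hW) s hs
    have hJ : Joined (telRetract p n (γ s₀)) (telRetract p n (γ s)) :=
      ⟨{ toFun := fun t => telRetract p n (γ (δ t))
         continuous_toFun := (continuousOn_telRetract n).comp_continuous
          (γ.continuous.comp δ.continuous) fun t => hWO (hδ t)
         source' := by rw [δ.source]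
         target' := by rw [δ.target] }⟩
    have hs' : γ s ∈ telNhd p n := hWO hs
    refine propext ?_
    rw [telJoined_retract hn, telJoined_retract hs']
    exact ⟨TelJoined.of_joined hJ.symm, TelJoined.of_joined hJ⟩
  have := hl.apply_eq_of_preconnectedSpace 0 1
  simp only [γ.source, γ.target] at this
  exact this.mp H

theorem exists_joined_of_joined_telMk {n m : ℕ} {z : P n} {z' : P m}
    (h : Joined (telMk p n z 0) (telMk p m z' 0)) :
    ∃ (N : ℕ) (h : n ≤ N) (h' : m ≤ N), Joined (telIter p h z) (telIter p h' z') :=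
  TelJoined.of_joined_telescope (z' := z') h.symm ⟨m, le_rfl, le_rfl, Joined.refl _⟩

variable {Q : ℕ → PtdSpace.{u}} {q : ∀ n, PMap (Q n) (Q (n + 1))} (a : ∀ n, PMap (P n) (Q n))

theorem telIter_natural (h : ∀ n z, a (n + 1) (p n z) = q n (a n z)) {n N : ℕ} (hn : n ≤ N) (z : P n) :
    a N (telIter p hn z) = telIter q hn (a n z) := by
  induction N, hn using Nat.le_induction with
  | base => rw [telIter_self, telIter_self]
  | succ N hn ih => rw [telIter_succ hn, telIter_succ hn, h, ih]

theorem zerothHomotopy_mk_eq {X : Type u} [TopologicalSpace X] {x y : X} :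
    (Quotient.mk (pathSetoid X) x = Quotient.mk (pathSetoid X) y) ↔ Joined x y := Quotient.eq

theorem surjective_telescope_iff (h : ∀ n z, a (n + 1) (p n z) = q n (a n z)) :
    Function.Surjective (pathComponentsMap (telescopeMap a h)) ↔
      ∀ n (z : Q n), ∃ (N : ℕ) (hn : n ≤ N) (x : P N), Joined (a N x) (telIter q hn z) := by
  constructor
  · intro hs n z
    obtain ⟨e, he⟩ := hs (Quotient.mk _ (telMk q n z 0))
    obtain ⟨w, rfl⟩ := Quotient.exists_rep e
    obtain ⟨⟨k, x, t⟩, rfl⟩ := Quot.exists_rep w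
    have hj : Joined (telMk q k (a k x) t) (telMk q n z 0) := zerothHomotopy_mk_eq.1 he
    obtain ⟨N, h₁, h₂, H⟩ := exists_joined_of_joined_telMk ((joined_telMk_zero _ _ t).trans hj)
    refine ⟨N, h₂, telIter p h₁ x, ?_⟩
    rwa [telIter_natural a h]
  · intro hs e
    obtain ⟨w, rfl⟩ := Quotient.exists_rep e
    obtain ⟨⟨k, z, t⟩, rfl⟩ := Quot.exists_rep w
    obtain ⟨N, hn, x, hx⟩ := hs k z
    refine ⟨Quotient.mk _ (telMk p N x 0), zerothHomotopy_mk_eq.2 ?_⟩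
    change Joined (telMk q N (a N x) 0) (telMk q k z t)
    exact (joined_telMk hx).trans ((joined_telIter hn z).symm.trans (joined_telMk_zero k z t))

theorem injective_telescope_iff (h : ∀ n z, a (n + 1) (p n z) = q n (a n z)) :
    Function.Injective (pathComponentsMap (telescopeMap a h)) ↔
      ∀ n (x x' : P n), Joined (a n x) (a n x') →
        ∃ (N : ℕ) (hn : n ≤ N), Joined (telIter p hn x) (telIter p hn x') := by
  constructor
  · intro hi n x x' hj
    have : Quotient.mk (pathSetoid _) (telMk p n x 0) = Quotient.mk _ (telMk p n x' 0) :=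
      hi (zerothHomotopy_mk_eq.2 (joined_telMk hj))
    obtain ⟨N, h₁, h₂, H⟩ := exists_joined_of_joined_telMk (zerothHomotopy_mk_eq.1 this)
    exact ⟨N, h₁, H⟩
  · intro hi e e' he
    obtain ⟨w, rfl⟩ := Quotient.exists_rep e
    obtain ⟨w', rfl⟩ := Quotient.exists_rep e'
    obtain ⟨⟨k, x, t⟩, rfl⟩ := Quot.exists_rep w
    obtain ⟨⟨k', x', t'⟩, rfl⟩ := Quot.exists_rep w'
    have hj : Joined (telMk q k (a k x) t) (telMk q k' (a k' x') t') := zerothHomotopy_mk_eq.1 he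
    obtain ⟨N, h₁, h₂, H⟩ := exists_joined_of_joined_telMk
      ((joined_telMk_zero _ _ t).trans (hj.trans (joined_telMk_zero _ _ t').symm))
    rw [← telIter_natural a h, ← telIter_natural a h] at H
    obtain ⟨M, hM, H⟩ := hi N _ _ H
    refine zerothHomotopy_mk_eq.2 ?_
    change Joined (telMk p k x t) (telMk p k' x' t')
    refine (joined_telMk_zero k x t).symm.trans (Joined.trans ?_ (joined_telMk_zero k' x' t'))
    exact (joined_telIter h₁ x).trans ((joined_telIter hM _).trans ((joined_telMk H).trans
      ((joined_telIter hM _).symm.trans (joined_telIter h₂ x').symm)))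

end Telescope

/-! ### Path components and homotopy groups of `Ω`-spectra -/

theorem tail_mem_boundary {n : ℕ} {t : Fin (n + 1) → I}
    (ht : t ∈ Cube.boundary (Fin (n + 1))) :
    (t 0 = 0 ∨ t 0 = 1) ∨ (fun i : Fin n => t i.succ) ∈ Cube.boundary (Fin n) := by
  obtain ⟨i, hi⟩ := ht
  refine Fin.cases (fun h => Or.inl h) (fun j h => Or.inr ⟨j, h⟩) i hi

theorem cons_mem_boundary {n : ℕ} {t : Fin n → I} (s : I) (ht : t ∈ Cube.boundary (Fin n)) :
    (Fin.cons s t : Fin (n + 1) → I) ∈ Cube.boundary (Fin (n + 1)) := by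
  obtain ⟨i, hi⟩ := ht
  exact ⟨i.succ, by simpa using hi⟩

theorem continuous_finCons (n : ℕ) :
    Continuous fun p : (Fin n → I) × I => (Fin.cons p.2 p.1 : Fin (n + 1) → I) :=
  continuous_pi (Fin.cases (by simpa using continuous_snd) fun i => by
    simpa using (by fun_prop : Continuous fun p : (Fin n → I) × I => p.1 i))

/-- A generalized loop of a loop space as a generalized loop of one dimension more. -/
def uncurryLoop {P : PtdSpace.{u}} {n : ℕ} (g : GenLoop (Fin n) (loop P) (loop P).pt) :
    GenLoop (Fin (n + 1)) P P.pt :=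
  ⟨⟨fun t => asPath (g fun i => t i.succ) (t 0), continuous_asPath
      (g.1.continuous.comp (by fun_prop : Continuous fun (t : Fin (n + 1) → I) (i : Fin n) =>
        t i.succ)) (by fun_prop)⟩, fun t ht => by
    obtain (h | h) | h := tail_mem_boundary ht
    · exact (congrArg (asPath _) h).trans (Path.source _)
    · exact (congrArg (asPath _) h).trans (Path.target _)
    · exact congrArg (fun γ => asPath γ (t 0)) (g.2 _ h)⟩

/-- The identification of `π_n (Ω P)` and `π_{n + 1} P`. -/
def loopShift (P : PtdSpace.{u}) (n : ℕ) :
    HomotopyGroup (Fin n) (loop P) (loop P).pt → HomotopyGroup (Fin (n + 1)) P P.pt :=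
  Quotient.map uncurryLoop fun g g' H => by
    obtain ⟨H, hc, h0, h1, hb⟩ := exists_of_genLoop_homotopic H
    refine genLoop_homotopic_of (fun u t => asPath (H u fun i => t i.succ) (t 0))
      (continuous_asPath (hc.comp (by fun_prop : Continuous fun p : I × (Fin (n + 1) → I) =>
        (p.1, fun i : Fin n => p.2 i.succ))) (by fun_prop)) (fun t => ?_) (fun t => ?_)
      fun u t ht => ?_
    · rw [h0]; rfl
    · rw [h1]; rfl
    · obtain (h | h) | h := tail_mem_boundary ht
      · rw [h, Path.source]
      · rw [h, Path.target]
      · rw [hb _ _ h]; rfl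

theorem loopShift_bijective (P : PtdSpace.{u}) (n : ℕ) : Function.Bijective (loopShift P n) := by
  constructor
  · intro a a' haa
    obtain ⟨g, rfl⟩ := Quotient.exists_rep a
    obtain ⟨g', rfl⟩ := Quotient.exists_rep a'
    have H : GenLoop.Homotopic (uncurryLoop g) (uncurryLoop g') := Quotient.exact haa
    obtain ⟨H, hc, h0, h1, hb⟩ := exists_of_genLoop_homotopic H
    refine Quotient.sound (show GenLoop.Homotopic g g' from
      loop_homotopic_of (fun u t s => H u (Fin.cons s t)) ?_ ?_ ?_ ?_ ?_ ?_)
    · exact hc.comp ((by fun_prop : Continuous fun p : (I × (Fin n → I)) × I => p.1.1).prodMk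
        ((continuous_finCons n).comp
          (by fun_prop : Continuous fun p : (I × (Fin n → I)) × I => (p.1.2, p.2))))
    · intro u t
      exact hb u _ ⟨0, Or.inl rfl⟩
    · intro u t
      exact hb u _ ⟨0, Or.inr rfl⟩
    · intro t s
      rw [h0]; rfl
    · intro t s
      rw [h1]; rfl
    · intro u t ht s
      exact hb u _ (cons_mem_boundary s ht)
  · intro b
    obtain ⟨g, rfl⟩ := Quotient.exists_rep b
    refine ⟨Quotient.mk _ (loopGenLoop (fun t s => g (Fin.cons s t))
      (g.1.continuous.comp (continuous_finCons n)) (fun t => g.2 _ ⟨0, Or.inl rfl⟩)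
      (fun t => g.2 _ ⟨0, Or.inr rfl⟩) fun t ht s => g.2 _ (cons_mem_boundary s ht)), ?_⟩
    refine congrArg (Quotient.mk _) (GenLoop.ext _ _ fun t => ?_)
    change g (Fin.cons (t 0) (Fin.tail t)) = g t
    rw [Fin.cons_self_tail]

namespace PreSpec

/-- The generalized loop `(t₀, t₁) ↦ σ(σ(z)(t₁))(t₀)` given by a point `z` of the `m`-th space
of a spectrum with structure maps `σ`. -/
def pointGenLoop (E : PreSpec.{u}) {m : ℤ} (z : E.level m) :
    GenLoop (Fin 2) (E.level (m + 1 + 1)) (E.level (m + 1 + 1)).pt :=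
  uncurryLoop ((E.str (m + 1)).genLoop (uncurryLoop (n := 0)
    ⟨ContinuousMap.const _ (E.str m z), fun _ ⟨i, _⟩ => i.elim0⟩))

/-- The map from path components of the `m`-th space to `π_{-m}`. -/
def componentsToPi (E : PreSpec.{u}) (m : ℤ) (e : ZerothHomotopy (E.level m)) : E.pi (-m) :=
  piTwoMap (E.levelCast (by omega : m + 1 + 1 = 2 - -m)) (Additive.ofMul
    (loopShift _ 1 (homotopyMap (Fin 1) (E.str (m + 1)).toMap (E.str (m + 1)).map_pt
      (loopShift _ 0 (homotopyMap (Fin 0) (E.str m).toMap (E.str m).map_pt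
        (HomotopyGroup.pi0EquivZerothHomotopy.symm e))))))

theorem componentsToPi_mk (E : PreSpec.{u}) (m : ℤ) (z : E.level m) :
    E.componentsToPi m (Quotient.mk _ z) =
      piTwoMap (E.levelCast (by omega : m + 1 + 1 = 2 - -m)) (PiTwo.mk (E.pointGenLoop z)) := rfl

theorem IsOmega.componentsToPi_bijective {E : PreSpec.{u}} (hE : E.IsOmega) (m : ℤ) :
    Function.Bijective (E.componentsToPi m) :=
  (piTwoMap_levelCast_bijective E _).comp ((loopShift_bijective _ 1).comp
    (((hE (m + 1)).homotopyMap_bijective 1 _).comp ((loopShift_bijective _ 0).comp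
      (((hE m).homotopyMap_bijective 0 _).comp (Equiv.bijective _)))))

theorem componentsToPi_natural {E F : PreSpec.{u}} (f : E ⟶ F) (m : ℤ) (z : E.level m) :
    F.componentsToPi m (Quotient.mk _ (f.app m z)) =
      piMap f (-m) (E.componentsToPi m (Quotient.mk _ z)) := by
  rw [componentsToPi_mk, componentsToPi_mk, piMap, ← piTwoMap_comp, ← levelCast_natural,
    piTwoMap_comp, piTwoMap_mk]
  refine congrArg (fun g => piTwoMap _ (PiTwo.mk g)) (GenLoop.ext _ _ fun t => ?_)
  change asPath (F.str (m + 1) (asPath (F.str m (f.app m z)) (t 1))) (t 0) =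
    f.app (m + 1 + 1) (asPath (E.str (m + 1) (asPath (E.str m z) (t 1))) (t 0))
  rw [comm_apply f m z]
  change asPath (F.str (m + 1) (f.app (m + 1) (asPath (E.str m z) (t 1)))) (t 0) = _
  rw [comm_apply f (m + 1)]
  rfl

/-- Converts the statements about paths in telescopes into equations in homotopy groups. -/
theorem IsOmega.joined_iff {E : PreSpec.{u}} (hE : E.IsOmega) {m : ℤ} {z z' : E.level m} :
    Joined z z' ↔
      E.componentsToPi m (Quotient.mk _ z) = E.componentsToPi m (Quotient.mk _ z') := by
  exact zerothHomotopy_mk_eq.symm.trans (hE.componentsToPi_bijective m).1.eq_iff.symm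

theorem IsOmega.exists_point {E : PreSpec.{u}} (hE : E.IsOmega) {m : ℤ} (a : E.pi (-m)) :
    ∃ z : E.level m, E.componentsToPi m (Quotient.mk _ z) = a := by
  obtain ⟨e, rfl⟩ := (hE.componentsToPi_bijective m).2 a
  obtain ⟨z, rfl⟩ := Quotient.exists_rep e
  exact ⟨z, rfl⟩

end PreSpec

namespace Fil

open PreSpec

/-! ### Transition maps, and inverting τ on homotopy groups. -/

theorem trans_comp (X : Fil.{u}) {l m n : ℤ} (h : l ≤ m) (h' : m ≤ n) :
    X.trans h' ≫ X.trans h = X.trans (h.trans h') := by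
  rw [← X.map_comp]
  rfl

theorem trans_refl (X : Fil.{u}) {n : ℤ} (h : n ≤ n) : X.trans h = 𝟙 _ := X.map_id _

theorem trans_natural {X Y : Fil.{u}} (f : X ⟶ Y) {m n : ℤ} (h : m ≤ n) :
    X.trans h ≫ f.app (op m) = f.app (op n) ≫ Y.trans h := f.naturality _

theorem piMap_trans_trans (X : Fil.{u}) {l m n : ℤ} (h : l ≤ m) (h' : m ≤ n) (k : ℤ)
    (a : (X.obj (op n)).pi k) :
    piMap (X.trans h) k (piMap (X.trans h') k a) = piMap (X.trans (h.trans h')) k a := by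
  rw [← piMap_comp, trans_comp]

theorem piMap_trans_self (X : Fil.{u}) {n : ℤ} (h : n ≤ n) (k : ℤ) (a : (X.obj (op n)).pi k) :
    piMap (X.trans h) k a = a := by
  rw [trans_refl, piMap_id]

theorem piMap_trans_natural {X Y : Fil.{u}} (f : X ⟶ Y) {m n : ℤ} (h : m ≤ n) (k : ℤ)
    (a : (X.obj (op n)).pi k) :
    piMap (f.app (op m)) k (piMap (X.trans h) k a) =
      piMap (Y.trans h) k (piMap (f.app (op n)) k a) := by
  rw [← piMap_comp, ← piMap_comp, trans_natural]

theorem telIter_eq_trans (X : Fil.{u}) (m : ℤ) {n N : ℕ} (h : n ≤ N)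
    (z : (X.obj (op (-(n : ℤ)))).level m) :
    telIter (P := fun n : ℕ => (X.obj (op (-(n : ℤ)))).level m)
      (fun n => (X.trans (by push_cast; omega : -((n + 1 : ℕ) : ℤ) ≤ -(n : ℤ))).app m) h z =
      (X.trans (by omega : -(N : ℤ) ≤ -(n : ℤ))).app m z := by
  induction N, h using Nat.le_induction with
  | base =>
    rw [telIter_self, trans_refl]; rfl
  | succ N h ih =>
    rw [telIter_succ h, ih]
    exact congrArg (fun g : X.obj (op (-(n : ℤ))) ⟶ X.obj (op (-((N + 1 : ℕ) : ℤ))) => g.app m z)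
      (trans_comp X (by push_cast; omega : -((N + 1 : ℕ) : ℤ) ≤ -(N : ℤ)) _)

theorem TauInvEquiv.exists_lift {X Y : Fil.{u}} {f : X ⟶ Y}
    (hY : Y.IsSpectrum) (hf : TauInvEquiv f) {n k : ℤ} (b : (Y.obj (op n)).pi k) :
    ∃ (n' : ℤ) (h : n' ≤ n) (a : (X.obj (op n')).pi k),
      piMap (f.app (op n')) k a = piMap (Y.trans h) k b := by
  obtain ⟨m, rfl⟩ : ∃ m, k = -m := ⟨-k, by omega⟩
  -- The telescope only contains the stages `-N` with `N` a natural number, so `b` is first moved to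
  -- such a stage at or below `n`.
  have hN : -((-n).toNat : ℤ) ≤ n := by omega
  obtain ⟨z, hz⟩ := (hY _).exists_point (piMap (Y.trans hN) (-m) b)
  obtain ⟨N, h, x, hx⟩ := (surjective_telescope_iff _ _).1 (hf m).2 _ z
  rw [telIter_eq_trans, (hY _).joined_iff, componentsToPi_natural, componentsToPi_natural, hz,
    piMap_trans_trans] at hx
  exact ⟨_, _, _, hx⟩

theorem TauInvEquiv.exists_eq_zero {X Y : Fil.{u}} {f : X ⟶ Y} (hX : X.IsSpectrum)
    (hY : Y.IsSpectrum) (hf : TauInvEquiv f) {n k : ℤ} (a : (X.obj (op n)).pi k)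
    (ha : piMap (f.app (op n)) k a = 0) :
    ∃ (n' : ℤ) (h : n' ≤ n), piMap (X.trans h) k a = 0 := by
  obtain ⟨m, rfl⟩ : ∃ m, k = -m := ⟨-k, by omega⟩
  have hN : -((-n).toNat : ℤ) ≤ n := by omega
  obtain ⟨x, hx⟩ := (hX _).exists_point (piMap (X.trans hN) (-m) a)
  obtain ⟨x', hx'⟩ := (hX (-((-n).toNat : ℤ))).exists_point (m := m) 0
  obtain ⟨N, h, H⟩ := (injective_telescope_iff _ _).1 (hf m).1 _ x x' (by
    rw [(hY _).joined_iff, componentsToPi_natural, componentsToPi_natural, hx, hx',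
      piMap_trans_natural, ha, map_zero, map_zero])
  rw [telIter_eq_trans, telIter_eq_trans, (hX _).joined_iff, componentsToPi_natural,
    componentsToPi_natural, hx, hx', piMap_trans_trans, map_zero] at H
  exact ⟨_, _, H⟩

theorem tauInvEquiv_of_bijective {X Y : Fil.{u}} {f : X ⟶ Y} (hX : X.IsSpectrum)
    (hY : Y.IsSpectrum)
    (hf : ∀ k, ∃ n₀, ∀ n ≤ n₀, Function.Bijective (piMap (f.app (op n)) k)) :
    TauInvEquiv f := by
  intro m
  obtain ⟨n₀, hn₀⟩ := hf (-m)
  constructor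
  · refine (injective_telescope_iff _ _).2 fun n x x' hj => ?_
    have hle : -((max n (-n₀).toNat : ℕ) : ℤ) ≤ -(n : ℤ) := by omega
    refine ⟨max n (-n₀).toNat, le_max_left _ _, ?_⟩
    rw [(hY _).joined_iff, componentsToPi_natural, componentsToPi_natural] at hj
    rw [telIter_eq_trans, telIter_eq_trans, (hX _).joined_iff, componentsToPi_natural,
      componentsToPi_natural]
    refine (hn₀ _ (by omega)).1 ?_
    rw [piMap_trans_natural, piMap_trans_natural, hj]
  · refine (surjective_telescope_iff _ _).2 fun n z => ?_
    have hle : -((max n (-n₀).toNat : ℕ) : ℤ) ≤ -(n : ℤ) := by omega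
    obtain ⟨a, ha⟩ := (hn₀ _ (by omega : -((max n (-n₀).toNat : ℕ) : ℤ) ≤ n₀)).2
      (piMap (Y.trans hle) (-m) ((Y.obj _).componentsToPi m (Quotient.mk _ z)))
    obtain ⟨x, rfl⟩ := (hX _).exists_point a
    refine ⟨max n (-n₀).toNat, le_max_left _ _, x, ?_⟩
    rw [telIter_eq_trans, (hY _).joined_iff, componentsToPi_natural, componentsToPi_natural, ha]

end Fil

/-! ### Homotopy groups of homotopy limits -/

section Holim

variable {P : ℕ → PtdSpace.{u}} {p : ∀ n, PMap (P (n + 1)) (P n)}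

/-- If `π₂` of the homotopy limit of a tower vanishes, so does the limit of the groups `π₂`. -/
theorem eq_zero_of_compatible (hs : Subsingleton (PiTwo (holimSpace P p)))
    (a : ∀ n, PiTwo (P n)) (ha : ∀ n, piTwoMap (p n) (a (n + 1)) = a n) (n : ℕ) : a n = 0 := by
  choose g hg using fun n => PiTwo.mk_surjective (a n)
  have hh : ∀ n, GenLoop.Homotopic (g n) ((p n).genLoop (g (n + 1))) := fun n => by
    rw [← PiTwo.mk_eq_mk, ← piTwoMap_mk, hg, hg, ha]
  choose H hc h0 h1 hb using fun n => exists_of_genLoop_homotopic (hh n)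
  -- Representatives of the `a n`, joined by the chosen homotopies, are exactly a generalized loop
  -- in the homotopy limit; projecting a null homotopy of it to the n-th space kills `a n`.
  let W : GenLoop (Fin 2) (holimSpace P p) (holimSpace P p).pt :=
    ⟨{ toFun := fun t => ⟨(fun n => g n t, fun n => ⟨fun s => H n s t, (hc n).comp
          (by fun_prop : Continuous fun s : I => (s, t))⟩), fun n => ⟨h0 n t, h1 n t⟩⟩
       continuous_toFun := Continuous.subtype_mk (Continuous.prodMk
        (continuous_pi fun n => (g n).1.continuous)
        (continuous_pi fun n => ContinuousMap.continuous_of_continuous_uncurry _ (by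
          exact (hc n).comp (by fun_prop : Continuous fun q : (Fin 2 → I) × I => (q.2, q.1)))))
        _ },
      fun t ht => Subtype.ext (Prod.ext (funext fun n => (g n).2 t ht)
        (funext fun n => ContinuousMap.ext fun s => hb n s t ht))⟩
  have hW : GenLoop.Homotopic W GenLoop.const := PiTwo.mk_eq_zero.1 (Subsingleton.elim _ _)
  obtain ⟨K, kc, k0, k1, kb⟩ := exists_of_genLoop_homotopic hW
  rw [← hg, PiTwo.mk_eq_zero]
  refine genLoop_homotopic_of (fun u t => (K u t).1.1 n) ?_ (fun t => ?_) (fun t => ?_)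
    fun u t ht => ?_
  · exact (continuous_apply n).comp ((continuous_fst.comp continuous_subtype_val).comp kc)
  · rw [k0]; rfl
  · rw [k1]; rfl
  · rw [kb u t ht]; rfl

/-- The first half of the square runs the homotopy from `G` to `γ.trans G'`; the second half cuts
off longer and longer initial pieces of `γ` until only `G'` remains. Hence the starting point rests
at `x` and then runs along `γ`. Such squares are what a path to the base point of a homotopy limit
consists of. -/
theorem exists_square {Q : Type u} [TopologicalSpace Q] {x y z : Q} {G : Path x z}
    {γ : Path x y} {G' : Path y z} (K : G.Homotopic (γ.trans G')) :
    ∃ S : I → I → Q, (Continuous fun q : I × I => S q.1 q.2) ∧ (∀ t, S 0 t = G t) ∧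
      (∀ t, S 1 t = G' t) ∧ (∀ s, S s 1 = z) ∧
      ∀ s, S s 0 = γ (Set.projIcc 0 1 zero_le_one (2 * (s : ℝ) - 1)) := by
  obtain ⟨K⟩ := K
  let pr : ℝ → I := Set.projIcc 0 1 zero_le_one
  have hpr : Continuous pr := continuous_projIcc
  have pr_coe : ∀ s : I, pr s = s := fun s => Set.projIcc_val _ s
  have htr : ∀ v : I, (γ.trans G') (pr (v / 2)) = γ v := fun v => by
    have h1 : pr (v / 2) = ⟨v / 2, by constructor <;> linarith [v.2.1, v.2.2]⟩ :=
      Set.projIcc_of_mem _ _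
    rw [h1, Path.trans_apply, dif_pos (by change (v : ℝ) / 2 ≤ 1 / 2; linarith [v.2.2])]
    exact congrArg γ (Subtype.ext (by change 2 * ((v : ℝ) / 2) = v; ring))
  have htr' : ∀ t : I, (γ.trans G') (pr (1 / 2 + t * (1 / 2))) = G' t := fun t => by
    have h1 : pr (1 / 2 + t * (1 / 2)) = ⟨1 / 2 + t * (1 / 2),
        by constructor <;> linarith [t.2.1, t.2.2]⟩ := Set.projIcc_of_mem _ _
    rw [h1, Path.trans_apply]
    split_ifs with h
    · have ht : t = 0 := by
        refine le_antisymm ?_ t.2.1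
        change (t : ℝ) ≤ 0
        change (1 / 2 + t * (1 / 2) : ℝ) ≤ 1 / 2 at h
        linarith
      subst ht
      rw [G'.source]
      exact (congrArg γ (Subtype.ext (by simp))).trans γ.target
    · exact congrArg G' (Subtype.ext (by
        change 2 * (1 / 2 + (t : ℝ) * (1 / 2)) - 1 = t
        ring))
  refine ⟨fun s t => if (s : ℝ) ≤ 1 / 2 then K (pr (2 * s), t)
    else (γ.trans G') (pr ((pr (2 * s - 1) : ℝ) / 2 + t * (1 - (pr (2 * s - 1) : ℝ) / 2))),
    ?_, ?_, ?_, ?_, ?_⟩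
  · refine Continuous.if_le ?_ ?_ (by fun_prop) continuous_const ?_
    · fun_prop
    · fun_prop
    · rintro ⟨s, t⟩ h
      change (s : ℝ) = 1 / 2 at h
      have e1 : pr (2 * s) = 1 := by
        rw [h, mul_one_div_cancel two_ne_zero]; exact Set.projIcc_right _
      have e0 : pr (2 * s - 1) = 0 := by
        rw [h, mul_one_div_cancel two_ne_zero, sub_self]; exact Set.projIcc_left _
      simp only [e1, e0, Set.Icc.coe_zero, zero_div, sub_zero, mul_one, zero_add, pr_coe]
      exact K.apply_one t
  · intro t
    have e0 : pr (2 * ((0 : I) : ℝ)) = 0 := by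
      rw [Set.Icc.coe_zero, mul_zero]; exact Set.projIcc_left _
    dsimp only
    rw [if_pos (by norm_num), e0]
    exact K.apply_zero t
  · intro t
    have e1 : pr (2 * ((1 : I) : ℝ) - 1) = 1 := by
      rw [Set.Icc.coe_one, show (2 * 1 - 1 : ℝ) = 1 by norm_num]; exact Set.projIcc_right _
    dsimp only
    rw [if_neg (by norm_num), e1, ← htr' t]
    norm_num
  · intro s
    dsimp only
    split_ifs
    · exact K.target _
    · have e1 : pr (1 : ℝ) = 1 := Set.projIcc_right _
      rw [Set.Icc.coe_one, one_mul, add_sub_cancel, e1, Path.target]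
  · intro s
    dsimp only
    split_ifs with h
    · rw [K.source, Set.projIcc_of_le_left _ (by linarith)]
      exact γ.source.symm
    · rw [Set.Icc.coe_zero, zero_mul, add_zero, htr]

theorem path_homotopic_of_loops {Q : Type u} [TopologicalSpace Q] {x y : Q}
    (hl : ∀ γ : Path y y, γ.Homotopic (Path.refl y)) (a b : Path x y) : a.Homotopic b := by
  have h := Path.Homotopic.Quotient.eq.2 (hl (a.symm.trans b))
  rw [Path.Homotopic.Quotient.mk_trans, Path.Homotopic.Quotient.mk_symm,
    Path.Homotopic.Quotient.mk_refl] at h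
  rw [← Path.Homotopic.Quotient.eq, ← Path.Homotopic.Quotient.trans_refl (.mk a), ← h,
    ← Path.Homotopic.Quotient.trans_assoc, Path.Homotopic.Quotient.trans_symm,
    Path.Homotopic.Quotient.refl_trans]

/-- A point of the homotopy limit of a tower of spaces that are eventually connected and have
eventually trivial fundamental groups lies in the component of the base point. -/
theorem joined_holimSpace_pt (N : ℕ) (hc : ∀ n, N ≤ n → ∀ x : P n, Joined x (P n).pt)
    (hl : ∀ n, N ≤ n → ∀ γ : Path (P n).pt (P n).pt, γ.Homotopic (Path.refl _))
    (w : holimSpace P p) : Joined w (holimSpace P p).pt := by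
  let x : ∀ n, P n := w.1.1
  let γ : ∀ n, Path (x n) (p n (x (n + 1))) := fun n =>
    { toContinuousMap := w.1.2 n, source' := (w.2 n).1, target' := (w.2 n).2 }
  let next : ∀ n, Path (x (n + 1)) (P (n + 1)).pt → Path (x n) (P n).pt := fun n g =>
    (γ n).trans ((g.map (p n).continuous).cast rfl (p n).map_pt.symm)
  -- Finitely many compatibilities are free: at stage `M` the path is redefined as the one forced by
  -- stage `M + 1`, working downwards from `M` to 0.
  have hex : ∀ M, (∃ G : ∀ n, Path (x n) (P n).pt,
      ∀ n, M ≤ n → (G n).Homotopic (next n (G (n + 1)))) →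
      ∃ G : ∀ n, Path (x n) (P n).pt, ∀ n, (G n).Homotopic (next n (G (n + 1))) := by
    intro M
    induction M with
    | zero => exact fun ⟨G, hG⟩ => ⟨G, fun n => hG n n.zero_le⟩
    | succ M ih =>
      rintro ⟨G, hG⟩
      refine ih ⟨Function.update G M (next M (G (M + 1))), fun n hn => ?_⟩
      rw [Function.update_of_ne (by omega : n + 1 ≠ M)]
      obtain rfl | hn := hn.eq_or_lt
      · rw [Function.update_self]
      · rw [Function.update_of_ne hn.ne']
        exact hG n hn
  have htail : ∃ G : ∀ n, Path (x n) (P n).pt,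
      ∀ n, N ≤ n → (G n).Homotopic (next n (G (n + 1))) := by
    have hj : ∀ j n, N ≤ n + j → Joined (x n) (P n).pt := by
      intro j
      induction j with
      | zero => exact fun n hn => hc n hn _
      | succ j ih => exact fun n hn => ⟨next n (ih (n + 1) (by omega)).some⟩
    -- From stage `N` on any choice of paths is compatible, because loops at the base point contract
    -- there.
    exact ⟨fun n => (hj N n (by omega)).some, fun n hn => path_homotopic_of_loops (hl n hn) _ _⟩
  obtain ⟨G, hG⟩ := hex N htail
  choose S Sc S0 S1 St Ss using fun n => exists_square (hG n)
  -- stretch the paths of `w`, then contract along the squares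
  let D : I → ∀ n, C(I, P n) := fun u n =>
    ⟨fun s => γ n (Set.projIcc 0 1 zero_le_one ((s : ℝ) * (1 + u) - u)), by fun_prop⟩
  have hD : ∀ u n, D u n 0 = x n ∧ D u n 1 = p n (x (n + 1)) := fun u n => by
    constructor
    · change γ n _ = _
      rw [Set.projIcc_of_le_left _ (by simpa using u.2.1)]
      exact (γ n).source
    · change γ n _ = _
      rw [Set.projIcc_of_right_le _ (by simp)]
      exact (γ n).target
  -- `D 1 n` rests during the first half and then runs along `γ n`, matching the edge at time 0 of
  -- the square `S n`.
  let w' : holimSpace P p := ⟨(x, D 1), hD 1⟩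
  have h₁ : Joined w w' :=
    ⟨{ toFun := fun u => ⟨(x, D u), hD u⟩
       continuous_toFun := Continuous.subtype_mk (continuous_const.prodMk
        (continuous_pi fun n => ContinuousMap.continuous_of_continuous_uncurry _ (by
          change Continuous fun q : I × I =>
            γ n (Set.projIcc 0 1 zero_le_one ((q.2 : ℝ) * (1 + q.1) - q.1))
          fun_prop))) _
       source' := Subtype.ext (Prod.ext rfl (funext fun n => ContinuousMap.ext fun s => by
        change γ n _ = γ n s
        congr 1
        simp))
       target' := rfl }⟩
  refine h₁.trans ⟨{ toFun := fun t => ⟨(fun n => G n t, fun n => ⟨fun s => S n s t, (Sc n).comp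
      (by fun_prop : Continuous fun s : I => (s, t))⟩), fun n => ⟨S0 n t, S1 n t⟩⟩
                     continuous_toFun := ?_
                     source' := ?_
                     target' := ?_ }⟩
  · refine Continuous.subtype_mk (Continuous.prodMk (continuous_pi fun n => (G n).continuous)
      (continuous_pi fun n => ContinuousMap.continuous_of_continuous_uncurry _ ?_)) _
    exact (Sc n).comp (by fun_prop : Continuous fun q : I × I => (q.2, q.1))
  · refine Subtype.ext (Prod.ext (funext fun n => (G n).source) (funext fun n =>
      ContinuousMap.ext fun s => ?_))
    change S n s 0 = γ n _
    rw [Ss]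
    congr 2
    rw [Set.Icc.coe_one]
    ring
  · exact Subtype.ext (Prod.ext (funext fun n => (G n).target) (funext fun n =>
      ContinuousMap.ext fun s => St n s))

/-- The space of two-dimensional generalized loops. -/
def loopTwo (P : PtdSpace.{u}) : PtdSpace.{u} where
  carrier := GenLoop (Fin 2) P P.pt
  pt := GenLoop.const

/-- The map induced on spaces of two-dimensional generalized loops. -/
def loopTwoMap {P Q : PtdSpace.{u}} (f : PMap P Q) : PMap (loopTwo P) (loopTwo Q) where
  toMap := ⟨fun g : GenLoop (Fin 2) P P.pt => f.genLoop g,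
    Continuous.subtype_mk ((ContinuousMap.continuous_postcomp f.toMap).comp
      continuous_subtype_val) _⟩
  map_pt := GenLoop.ext _ _ fun _ => f.map_pt

theorem continuous_loopTwo_eval {P : PtdSpace.{u}} {Z : Type*} [TopologicalSpace Z]
    {g : Z → GenLoop (Fin 2) P P.pt} {t : Z → (Fin 2 → I)} (hg : Continuous g)
    (ht : Continuous t) : Continuous fun z => g z (t z) :=
  ContinuousEval.continuous_eval.comp (hg.prodMk ht)

theorem joined_loopTwo_pt {P : PtdSpace.{u}} (h : Subsingleton (PiTwo P)) (g : loopTwo P) :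
    Joined g (loopTwo P).pt := by
  have hg : GenLoop.Homotopic (g : GenLoop (Fin 2) P P.pt) GenLoop.const :=
    PiTwo.mk_eq_zero.1 (Subsingleton.elim _ _)
  obtain ⟨H, hc, h0, h1, hb⟩ := exists_of_genLoop_homotopic hg
  exact ⟨{ toFun := fun u => ⟨⟨H u, hc.comp (by fun_prop :
              Continuous fun t : Fin 2 → I => (u, t))⟩, hb u⟩
           continuous_toFun := Continuous.subtype_mk
            (ContinuousMap.continuous_of_continuous_uncurry _ hc) _
           source' := GenLoop.ext _ _ h0
           target' := GenLoop.ext _ _ h1 }⟩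

theorem loopTwo_homotopic_refl {P : PtdSpace.{u}} (h : Subsingleton (PiTwo (loop P)))
    (γ : Path (loopTwo P).pt (loopTwo P).pt) : γ.Homotopic (Path.refl _) := by
  let γ' : I → GenLoop (Fin 2) P P.pt := γ
  have hγ' : Continuous γ' := γ.continuous
  have e0 : γ' 0 = GenLoop.const := γ.source
  have e1 : γ' 1 = GenLoop.const := γ.target
  have hg := PiTwo.mk_eq_zero.1 (Subsingleton.elim (PiTwo.mk (loopGenLoop
    (fun t s => γ' s t) (continuous_loopTwo_eval (hγ'.comp continuous_snd) continuous_fst)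
    (fun t => by rw [e0]; rfl) (fun t => by rw [e1]; rfl) fun t ht s => (γ' s).2 t ht)) 0)
  obtain ⟨H, hc, h0, h1, hb⟩ := exists_of_genLoop_homotopic hg
  have hcont : Continuous fun q : (I × I) × (Fin 2 → I) => asPath (H q.1.1 q.2) q.1.2 :=
    continuous_asPath (hc.comp (by fun_prop :
      Continuous fun q : (I × I) × (Fin 2 → I) => (q.1.1, q.2))) (by fun_prop)
  let K : I × I → loopTwo P := fun q => ⟨⟨fun t => asPath (H q.1 t) q.2, hcont.comp
    (by fun_prop : Continuous fun t : Fin 2 → I => (q, t))⟩, fun t ht => by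
      change asPath (H q.1 t) q.2 = _
      rw [hb q.1 t ht]; rfl⟩
  refine ⟨{ toFun := K
            continuous_toFun := Continuous.subtype_mk
              (ContinuousMap.continuous_of_continuous_uncurry _ hcont) _
            map_zero_left := fun s => GenLoop.ext _ _ fun t => ?_
            map_one_left := fun s => GenLoop.ext _ _ fun t => ?_
            prop' := fun u s hs => GenLoop.ext _ _ fun t => ?_ }⟩
  · change asPath (H 0 t) s = γ' s t
    rw [h0]; rfl
  · change asPath (H 1 t) s = P.pt
    rw [h1]; rfl
  · obtain rfl | rfl : s = 0 ∨ s = 1 := by simpa using hs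
    · change asPath (H u t) 0 = γ' 0 t
      rw [Path.source, e0]; rfl
    · change asPath (H u t) 1 = γ' 1 t
      rw [Path.target, e1]; rfl

/-- `π₂` of the homotopy limit of a tower vanishes if `π₂` and `π₃` vanish eventually. -/
theorem subsingleton_piTwo_holimSpace (N : ℕ) (h₂ : ∀ n, N ≤ n → Subsingleton (PiTwo (P n)))
    (h₃ : ∀ n, N ≤ n → Subsingleton (PiTwo (loop (P n)))) :
    Subsingleton (PiTwo (holimSpace P p)) := by
  refine subsingleton_of_forall_eq 0 fun a => ?_
  obtain ⟨W, rfl⟩ := PiTwo.mk_surjective a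
  have hW : Continuous fun t => W t := W.1.continuous
  have hW2 : ∀ n, Continuous fun q : I × (Fin 2 → I) => (W q.2).1.2 n q.1 := fun n =>
    ContinuousEval.continuous_eval.comp (((continuous_apply n).comp
      ((continuous_snd.comp continuous_subtype_val).comp (hW.comp continuous_snd))).prodMk
        continuous_fst)
  have hWb : ∀ t ∈ Cube.boundary (Fin 2), W t = (holimSpace P p).pt := W.2
  -- A two-dimensional loop in the homotopy limit is a point of the homotopy limit of the spaces of
  -- two-dimensional loops. Those spaces are eventually connected because π₂ vanishes, and have
  -- trivial fundamental group because π₂ of the loop space does.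
  let w : holimSpace (fun n => loopTwo (P n)) (fun n => loopTwoMap (p n)) :=
    ⟨(fun n => ⟨⟨fun t => (W t).1.1 n, (continuous_apply n).comp
          ((continuous_fst.comp continuous_subtype_val).comp hW)⟩, fun t ht => by
            change (W t).1.1 n = _
            rw [hWb t ht]; rfl⟩,
      fun n => ⟨fun s => ⟨⟨fun t => (W t).1.2 n s, (hW2 n).comp
          (by fun_prop : Continuous fun t : Fin 2 → I => (s, t))⟩, fun t ht => by
            change (W t).1.2 n s = _
            rw [hWb t ht]; rfl⟩, Continuous.subtype_mk
          (ContinuousMap.continuous_of_continuous_uncurry _ (hW2 n)) _⟩),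
      fun n => ⟨GenLoop.ext _ _ fun t => ((W t).2 n).1, GenLoop.ext _ _ fun t => ((W t).2 n).2⟩⟩
  obtain ⟨γ⟩ := joined_holimSpace_pt N (fun n hn => joined_loopTwo_pt (h₂ n hn))
    (fun n hn => loopTwo_homotopic_refl (h₃ n hn)) w
  let g : ∀ (u : I) (n : ℕ), GenLoop (Fin 2) (P n) (P n).pt := fun u n => (γ u).1.1 n
  let k : ∀ (u : I) (n : ℕ), I → GenLoop (Fin 2) (P n) (P n).pt := fun u n s => (γ u).1.2 n s
  have hg : ∀ n, Continuous fun u => g u n := fun n =>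
    (continuous_apply n).comp ((continuous_fst.comp continuous_subtype_val).comp γ.continuous)
  have hk : ∀ n, Continuous fun q : I × I => k q.1 n q.2 := fun n =>
    ContinuousEval.continuous_eval.comp (((continuous_apply n).comp
      ((continuous_snd.comp continuous_subtype_val).comp
        (γ.continuous.comp continuous_fst))).prodMk continuous_snd)
  have hk' : ∀ n, Continuous fun q : (I × (Fin 2 → I)) × I => k q.1.1 n q.2 q.1.2 := fun n =>
    continuous_loopTwo_eval ((hk n).comp (by fun_prop :
      Continuous fun q : (I × (Fin 2 → I)) × I => (q.1.1, q.2))) (by fun_prop)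
  let ev : ∀ (n : ℕ) (t : Fin 2 → I), loopTwo (P n) → P n :=
    fun n t (e : GenLoop (Fin 2) (P n) (P n).pt) => e t
  rw [PiTwo.mk_eq_zero]
  refine genLoop_homotopic_of (fun u t => ⟨(fun n => g u n t, fun n => ⟨fun s => k u n s t,
    (hk' n).comp (by fun_prop : Continuous fun s : I => ((u, t), s))⟩), fun n =>
      ⟨congrArg (ev n t) ((γ u).2 n).1, congrArg (ev n t) ((γ u).2 n).2⟩⟩) ?_ ?_ ?_ ?_
  · refine Continuous.subtype_mk (Continuous.prodMk (continuous_pi fun n => ?_)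
      (continuous_pi fun n => ContinuousMap.continuous_of_continuous_uncurry _ (hk' n))) _
    exact continuous_loopTwo_eval ((hg n).comp continuous_fst) continuous_snd
  · intro t
    refine Subtype.ext (Prod.ext (funext fun n => ?_) (funext fun n => ContinuousMap.ext fun s => ?_))
    · exact congrArg (fun v : holimSpace (fun n => loopTwo (P n)) (fun n => loopTwoMap (p n)) =>
        ev n t (v.1.1 n)) γ.source
    · exact congrArg (fun v : holimSpace (fun n => loopTwo (P n)) (fun n => loopTwoMap (p n)) =>
        ev n t (v.1.2 n s)) γ.source
  · intro t
    refine Subtype.ext (Prod.ext (funext fun n => ?_) (funext fun n => ContinuousMap.ext fun s => ?_))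
    · exact congrArg (fun v : holimSpace (fun n => loopTwo (P n)) (fun n => loopTwoMap (p n)) =>
        ev n t (v.1.1 n)) γ.target
    · exact congrArg (fun v : holimSpace (fun n => loopTwo (P n)) (fun n => loopTwoMap (p n)) =>
        ev n t (v.1.2 n s)) γ.target
  · intro u t ht
    exact Subtype.ext (Prod.ext (funext fun n => (g u n).2 t ht)
      (funext fun n => ContinuousMap.ext fun s => (k u n s).2 t ht))

end Holim

theorem PreSpec.IsOmega.subsingleton_piTwo_loop {E : PreSpec.{u}} (hE : E.IsOmega) {k : ℤ}
    (h : Subsingleton (E.pi (k + 1))) : Subsingleton (PiTwo (loop (E.level (2 - k)))) := by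
  have key : Subsingleton (PiTwo (loop (E.level (2 - (k + 1) + 1)))) :=
    (hE (2 - (k + 1))).piTwoMap_bijective.2.subsingleton
  rwa [show 2 - (k + 1) + 1 = 2 - k by ring] at key

namespace Fil

open PreSpec

/-! ### Multiplication by powers of `τ` -/

theorem tau_eq (X : Fil.{u}) {x y y' : ℤ} (h : y' ≤ y) (a : bi X x y) :
    tau X x y y' a = piMap (X.trans (by omega : x + y' ≤ x + y)) x a := by
  rw [tau, dif_pos h]

theorem tau_tau (X : Fil.{u}) {x y y' y'' : ℤ} (h : y' ≤ y) (h' : y'' ≤ y') (a : bi X x y) :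
    tau X x y' y'' (tau X x y y' a) = tau X x y y'' a := by
  rw [tau_eq X h, tau_eq X h', tau_eq X (h'.trans h), piMap_trans_trans]

theorem tau_self (X : Fil.{u}) {x y : ℤ} (a : bi X x y) : tau X x y y a = a := by
  rw [tau_eq X le_rfl, piMap_trans_self]

/-! ### Completeness -/

/-- In a complete filtered spectrum there are no nonzero sequences of successive `τ`-divisions. -/
theorem IsComplete.eq_zero_of_compatible {X : Fil.{u}} (hX : IsComplete X) {x y : ℤ}
    (a : ∀ j : ℕ, bi X x (y + j))
    (ha : ∀ j : ℕ, tau X x (y + ((j + 1 : ℕ) : ℤ)) (y + j) (a (j + 1)) = a j) : a 0 = 0 := by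
  have hij : ∀ i j : ℕ, i ≤ j → tau X x (y + j) (y + i) (a j) = a i := by
    intro i j h
    induction j, h using Nat.le_induction with
    | base => exact tau_self X _
    | succ j h ih => rw [← tau_tau X (by push_cast; omega : y + (j : ℤ) ≤ _) (by omega), ha, ih]
  -- Completeness uses the tower over natural filtrations, while `a j` lives in filtration `x + y +
  -- j`; `J n` is the least `j` for which this is at least `n`.
  let J : ℕ → ℕ := fun n => ((n : ℤ) - x - y).toNat
  let b : ∀ n : ℕ, (X.obj (op (n : ℤ))).pi x := fun n =>
    piMap (X.trans (by simp only [J]; omega : (n : ℤ) ≤ x + (y + (J n : ℤ)))) x (a (J n))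
  have hb : ∀ n : ℕ, piMap (X.trans (by push_cast; omega : (n : ℤ) ≤ ((n + 1 : ℕ) : ℤ))) x
      (b (n + 1)) = b n := fun n => by
    have hJ : J n ≤ J (n + 1) := by simp only [J]; omega
    simp only [b]
    rw [piMap_trans_trans, ← hij _ _ hJ, tau_eq X (by omega), piMap_trans_trans]
  have h0 : b (x + y).toNat = 0 := LinearT.eq_zero_of_compatible (hX x) b hb _
  have h1 := congrArg (piMap (X.trans
    (by push_cast; omega : x + (y + ((0 : ℕ) : ℤ)) ≤ ((x + y).toNat : ℤ))) x) h0
  simp only [b] at h1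
  rw [piMap_trans_trans, map_zero, ← tau_eq X (by omega), hij _ _ (Nat.zero_le _)] at h1
  exact h1

/-- A homotopy limit sees the limit of the groups π_k and the lim¹ of the groups π_(k+1), so
vanishing is needed in both degrees. -/
theorem isComplete_of_subsingleton {X : Fil.{u}} (hX : X.IsSpectrum)
    (h : ∀ k : ℤ, ∃ N : ℤ, ∀ n, N ≤ n → Subsingleton ((X.obj (op n)).pi k)) : IsComplete X := by
  intro k
  obtain ⟨N, hN⟩ := h k
  obtain ⟨M, hM⟩ := h (k + 1)
  exact subsingleton_piTwo_holimSpace (max N M).toNat (fun n hn => hN n (by omega))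
    fun n hn => (hX n).subsingleton_piTwo_loop (hM n (by omega))

end Fil

namespace Fil

open PreSpec

/-! ### The long exact sequences of `τ` -/

/-- Filtrations such as `x' + y'` and `x + y + 1` are equal only propositionally; the transition map
between them serves as the identification. -/
theorem piMap_trans_bijective_of_eq (X : Fil.{u}) {m n : ℤ} (h : m ≤ n) (e : m = n) (k : ℤ) :
    Function.Bijective (piMap (X.trans h) k) := by
  subst e
  exact ⟨fun a b hab => by rwa [piMap_trans_self, piMap_trans_self] at hab,
    fun a => ⟨a, piMap_trans_self X h k a⟩⟩

theorem red_eq_zero_iff {X : Fil.{u}} (hX : X.IsSpectrum) {x y y₁ : ℤ} (hy : y₁ = y + 1)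
    (a : bi X x y) : red X x y a = 0 ↔ ∃ c : bi X x y₁, tau X x y₁ y c = a := by
  have h : x + y₁ = x + y + ((1 : ℕ) : ℤ) := by push_cast; omega
  refine (toCofib_eq_zero_iff _ (hX _) (hX _) x a).trans ⟨?_, ?_⟩
  · rintro ⟨c, hc⟩
    refine ⟨piMap (X.trans h.le) x c, ?_⟩
    rw [tau_eq X (by omega)]
    exact (piMap_trans_trans X _ h.le x c).trans hc
  · rintro ⟨c, hc⟩
    refine ⟨piMap (X.trans h.ge) x c, ?_⟩
    rw [tau_eq X (by omega)] at hc
    exact (piMap_trans_trans X _ h.ge x c).trans hc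

theorem delta_eq_zero_iff {X : Fil.{u}} (hX : X.IsSpectrum) {x y x' y' : ℤ} (hx : x' + 1 = x)
    (hy : y' = y + 2) (z : gr X x y) : delta X hx hy z = 0 ↔ ∃ a, red X x y a = z := by
  have h : x' + y' = x + y + ((1 : ℕ) : ℤ) := by push_cast; omega
  refine (map_eq_zero_iff _ (piMap_trans_bijective_of_eq X h.le h x').1).trans ?_
  exact boundary_eq_zero_iff _ (hX _) hx z

theorem tau_eq_zero_iff {X : Fil.{u}} {x y x' y' y'' : ℤ} (hx : x' + 1 = x)
    (hy : y' = y + 2) (hy' : y'' = y + 1) (c : bi X x' y') :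
    tau X x' y' y'' c = 0 ↔ ∃ z : gr X x y, delta X hx hy z = c := by
  have h : x' + y' = x + y + ((1 : ℕ) : ℤ) := by push_cast; omega
  have h' : x' + y'' = x + y := by omega
  obtain ⟨c, rfl⟩ := (piMap_trans_bijective_of_eq X h.le h x').2 c
  have h1 : tau X x' y' y'' (piMap (X.trans h.le) x' c) =
      piMap (X.trans h'.le) x' (piMap ((tauPow X 1).app (op (x + y))) x' c) := by
    rw [tau_eq X (by omega), piMap_trans_trans]
    exact (piMap_trans_trans X h'.le _ x' c).symm
  rw [h1]
  refine (map_eq_zero_iff _ (piMap_trans_bijective_of_eq X h'.le h' x').1).trans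
    ((piMap_eq_zero_iff _ hx c).trans ?_)
  exact ⟨fun ⟨z, hz⟩ => ⟨z, congrArg _ hz⟩,
    fun ⟨z, hz⟩ => ⟨z, (piMap_trans_bijective_of_eq X h.le h x').1 hz⟩⟩

theorem delta_red {X : Fil.{u}} (hX : X.IsSpectrum) {x y x' y' : ℤ} (hx : x' + 1 = x)
    (hy : y' = y + 2) (a : bi X x y) : delta X hx hy (red X x y a) = 0 :=
  (delta_eq_zero_iff hX hx hy _).2 ⟨a, rfl⟩

theorem red_tau {X : Fil.{u}} (hX : X.IsSpectrum) {x y y₁ : ℤ} (h : y < y₁) (c : bi X x y₁) :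
    red X x y (tau X x y₁ y c) = 0 :=
  (red_eq_zero_iff hX rfl _).2 ⟨tau X x y₁ (y + 1) c, tau_tau X (by omega) (by omega) c⟩

theorem tau_delta {X : Fil.{u}} {x y x' y' y'' : ℤ} (hx : x' + 1 = x)
    (hy : y' = y + 2) (h : y'' < y') (z : gr X x y) :
    tau X x' y' y'' (delta X hx hy z) = 0 := by
  rw [← tau_tau X (by omega : y + 1 ≤ y') (by omega), (tau_eq_zero_iff hx hy rfl _).2 ⟨z, rfl⟩,
    map_zero]

/-! ### Strong completeness -/

/-- Where the maps are surjective the equations are solved upwards by choosing preimages; the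
finitely many earlier coordinates are then determined downwards. -/
theorem limOneVanishes_of_surjective (R : ℕ) (A : ℕ → Type u) [∀ n, AddCommGroup (A n)]
    (p : ∀ n, A (n + 1) →+ A n) (h : ∀ n, R ≤ n → Function.Surjective (p n)) :
    LimOneVanishes A p := by
  induction R generalizing A with
  | zero =>
    intro w
    choose g hg using fun n => h n (Nat.zero_le n)
    refine ⟨fun n => Nat.rec (motive := fun n => A n) 0 (fun n v => g n (v - w n)) n,
      funext fun n => ?_⟩
    change _ - p n (g n _) = w n
    rw [hg, sub_sub_cancel]
  | succ R ih =>
    intro w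
    obtain ⟨v, hv⟩ := ih (fun n => A (n + 1)) (fun n => p (n + 1)) (fun n hn => h _ (by omega))
      fun n => w (n + 1)
    refine ⟨fun n => Nat.casesOn (motive := fun n => A n) n (w 0 + p 0 (v 0)) v,
      funext fun n => ?_⟩
    cases n with
    | zero => exact add_sub_cancel_right _ _
    | succ n => exact congrFun hv n

/-- In a strongly complete filtered spectrum, infinitely `τ`-divisible classes are zero. -/
theorem IsStronglyComplete.eq_zero_of_divisible {X : Fil.{u}}
    (h : IsStronglyComplete X) {x y : ℤ} (a : bi X x y)
    (ha : ∀ j : ℕ, ∃ c : bi X x (y + j), tau X x (y + j) y c = a) : a = 0 := by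
  choose c hc using ha
  have hN : x + 1 + (y - 1) = x + y := by omega
  have hj : ∀ j : ℕ, x + 1 + (y - 1) + (j : ℤ) = x + (y + j) := fun j => by omega
  -- Both `c j` and `τ c (j + 1)` divide `a` by τ^j, so their difference is killed by τ^j and is a
  -- boundary from X/τ^j. Bidegree (x + 1, y - 1) has filtration x + y, so the boundary lands in
  -- π_{x,y+j} X.
  have hw : ∀ j : ℕ, ∃ w : bi (modTau X j) (x + 1) (y - 1),
      boundary ((tauPow X j).app (op (x + 1 + (y - 1)))) (rfl : x + 1 = x + 1) w =
        piMap (X.trans (hj j).le) x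
          (c j - tau X x (y + ((j + 1 : ℕ) : ℤ)) (y + j) (c (j + 1))) := fun j => by
    refine (piMap_eq_zero_iff _ rfl _).1 ?_
    refine (piMap_trans_trans X _ (hj j).le x _).trans ?_
    have h1 : piMap (X.trans hN.le) x (tau X x (y + j) y
        (c j - tau X x (y + ((j + 1 : ℕ) : ℤ)) (y + j) (c (j + 1)))) = 0 := by
      rw [map_sub, tau_tau X (by push_cast; omega) (by omega), hc, hc, sub_self, map_zero]
    rw [tau_eq X (by omega), piMap_trans_trans] at h1
    exact h1
  choose w hw using hw
  obtain ⟨v, hv⟩ := h.2 (x + 1) (y - 1) w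
  -- Solving the lim¹ equation for `w` gives τ^j-torsion corrections `k j` for which the `c j - k j`
  -- are strictly compatible; completeness then applies.
  let k : ∀ j : ℕ, bi X x (y + j) := fun j => piMap (X.trans (hj j).ge) x
    (boundary ((tauPow X j).app (op (x + 1 + (y - 1)))) (rfl : x + 1 = x + 1) (v j))
  have hk : ∀ j, k j - tau X x (y + ((j + 1 : ℕ) : ℤ)) (y + j) (k (j + 1)) =
      c j - tau X x (y + ((j + 1 : ℕ) : ℤ)) (y + j) (c (j + 1)) := fun j => by
    have h1 : boundary ((tauPow X j).app (op (x + 1 + (y - 1)))) (rfl : x + 1 = x + 1) (v j) -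
        boundary ((tauPow X j).app (op (x + 1 + (y - 1)))) (rfl : x + 1 = x + 1)
          (piMap (modTauProj X j (x + 1 + (y - 1))) (x + 1) (v (j + 1))) =
        piMap (X.trans (hj j).le) x
          (c j - tau X x (y + ((j + 1 : ℕ) : ℤ)) (y + j) (c (j + 1))) :=
      (map_sub _ _ _).symm.trans ((congrArg _ (congrFun hv j)).trans (hw j))
    have h2 := boundary_natural (f := (tauPow X (j + 1)).app (op (x + 1 + (y - 1))))
      (f' := (tauPow X j).app (op (x + 1 + (y - 1))))
      (X.trans (by push_cast; omega : x + 1 + (y - 1) + (j : ℤ) ≤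
        x + 1 + (y - 1) + ((j + 1 : ℕ) : ℤ))) (𝟙 _) (by
          change X.map _ ≫ 𝟙 _ = X.map _ ≫ X.map _
          rw [← X.map_comp, Category.comp_id]
          rfl) (rfl : x + 1 = x + 1) (v (j + 1))
    have h3 := congrArg (piMap (X.trans (hj j).ge) x) h1
    rw [piMap_trans_trans, piMap_trans_self] at h3
    refine Eq.trans ?_ ((map_sub _ _ _).symm.trans h3)
    refine congrArg (fun t => k j - t) ?_
    refine Eq.trans ?_ (congrArg (piMap (X.trans (hj j).ge) x) h2)
    simp only [k]
    rw [tau_eq X (by push_cast; omega)]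
    exact (piMap_trans_trans X _ (hj (j + 1)).ge x _).trans
      (piMap_trans_trans X (hj j).ge _ x _).symm
  -- `k 0` is killed by τ^0, a transition map between equal filtrations.
  have hk0 : k 0 = 0 := by
    have h1 : piMap ((tauPow X 0).app (op (x + 1 + (y - 1)))) x
        (boundary ((tauPow X 0).app (op (x + 1 + (y - 1)))) (rfl : x + 1 = x + 1) (v 0)) = 0 :=
      (piMap_eq_zero_iff _ rfl _).2 ⟨v 0, rfl⟩
    have h2 := (map_eq_zero_iff _ (piMap_trans_bijective_of_eq X
      (by omega : x + 1 + (y - 1) ≤ x + 1 + (y - 1) + ((0 : ℕ) : ℤ)) (by simp) x).1).1 h1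
    simp only [k]
    rw [h2, map_zero]
  have h0 := h.1.eq_zero_of_compatible (fun j => c j - k j) fun j => by
    have := hk j
    rw [sub_eq_sub_iff_add_eq_add] at this
    rw [map_sub, sub_eq_sub_iff_add_eq_add, ← this]
    exact add_comm _ _
  rw [hk0, sub_zero] at h0
  rw [← hc 0, h0, map_zero]

/-- For large r the obstruction π_{x-1} (X^{x+y+r}) vanishes, so classes of X/τ^r come from X and
hence lift to X/τ^(r+1): the tower is eventually surjective. -/
theorem isStronglyComplete_of_subsingleton {X : Fil.{u}} (hX : X.IsSpectrum)
    (h : ∀ k : ℤ, ∃ N : ℤ, ∀ n, N ≤ n → Subsingleton ((X.obj (op n)).pi k)) :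
    IsStronglyComplete X := by
  refine ⟨isComplete_of_subsingleton hX h, fun x y => ?_⟩
  obtain ⟨N, hN⟩ := h (x - 1)
  refine limOneVanishes_of_surjective (N - (x + y)).toNat _ _ fun r hr w => ?_
  have hs : Subsingleton ((X.obj (op (x + y + (r : ℤ)))).pi (x - 1)) := hN _ (by omega)
  obtain ⟨z, rfl⟩ := (boundary_eq_zero_iff ((tauPow X r).app (op (x + y))) (hX _)
    (sub_add_cancel x 1) w).1 (hs.elim _ _)
  refine ⟨toCofib ((tauPow X (r + 1)).app (op (x + y))) x z, ?_⟩
  refine (toCofib_natural _ _ _ x z).trans ?_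
  rw [piMap_id]

/-! ### Connective covers in terms of bigraded homotopy groups -/

theorem lt_ceil_iff {α : ℝ} (hα : -1 < α) (x y : ℤ) :
    x < ⌈((x + y : ℤ) : ℝ) / (α + 1)⌉ ↔ ⌊α * x⌋ < y := by
  rw [Int.lt_ceil, lt_div_iff₀ (by linarith), Int.floor_lt]
  push_cast
  constructor <;> intro h <;> linarith

/-- This is where the slope condition enters: passing from (x, y) to (x - 1, y + 1), which keeps the
filtration, never leaves the region above the line. -/
theorem floor_le_floor_add_one {α : ℝ} (hα : -1 < α) (x : ℤ) :
    ⌊α * (x - 1 : ℤ)⌋ ≤ ⌊α * x⌋ + 1 := by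
  rw [← Int.floor_add_one]
  refine Int.floor_le_floor ?_
  push_cast
  linarith

theorem isConnective_iff {α : ℝ} (hα : -1 < α) (X : Fil.{u}) :
    IsConnective α X ↔ ∀ x y : ℤ, ⌊α * x⌋ < y → Subsingleton (bi X x y) := by
  constructor
  · exact fun h x y hy => h (x + y) x ((lt_ceil_iff hα x y).2 hy)
  · intro h n k hk
    obtain ⟨y, rfl⟩ : ∃ y, n = k + y := ⟨n - k, by omega⟩
    exact h k y ((lt_ceil_iff hα k y).1 hk)

/-- The cofibre vanishes in bidegrees (x, y) with y ≤ L x. In the long exact sequence the kernel of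
`f` at (x, y) comes from the cofibre at (x + 1, y - 1), again on or below the line, and the cokernel
embeds in the cofibre at (x, y). -/
theorem exhibitsCover_iff {α : ℝ} (hα : -1 < α) {X Y : Fil.{u}} (hX : X.IsSpectrum)
    (hY : Y.IsSpectrum) (f : X ⟶ Y) :
    ExhibitsCover α f ↔ (∀ x y : ℤ, ⌊α * x⌋ < y → Subsingleton (bi X x y)) ∧
      ∀ x y : ℤ, y ≤ ⌊α * x⌋ → Function.Bijective (biMap f x y) := by
  have hc : ∀ x y : ℤ, ⌈((x + y : ℤ) : ℝ) / (α + 1)⌉ ≤ x ↔ y ≤ ⌊α * x⌋ := fun x y => by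
    rw [← not_lt, lt_ceil_iff hα, not_lt]
  have hL := floor_le_floor_add_one hα
  unfold ExhibitsCover
  rw [isConnective_iff hα]
  refine and_congr_right fun h0 => ⟨fun h x y hy => ⟨?_, fun b => ?_⟩, fun h n k hk => ?_⟩
  · rw [injective_iff_map_eq_zero]
    intro a ha
    have hs : Subsingleton (((cofib f).obj (op (x + y))).pi (x + 1)) := by
      refine h _ _ ?_
      rw [show x + y = x + 1 + (y - 1) by ring, hc]
      have := hL (x + 1)
      rw [add_sub_cancel_right] at this
      omega
    obtain ⟨w, rfl⟩ := (piMap_eq_zero_iff (f.app (op (x + y))) rfl a).1 ha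
    exact (congrArg _ (hs.elim w 0)).trans (map_zero _)
  · have hs : Subsingleton (((cofib f).obj (op (x + y))).pi x) := h _ _ ((hc x y).2 hy)
    exact (toCofib_eq_zero_iff (f.app (op (x + y))) (hX _) (hY _) x b).1 (hs.elim _ _)
  · obtain ⟨y, rfl⟩ : ∃ y, n = k + y := ⟨n - k, by omega⟩
    have hy := (hc k y).1 hk
    refine subsingleton_of_forall_eq 0 fun w => ?_
    have hb : boundary (f.app (op (k + y))) (sub_add_cancel k 1) w = 0 := by
      have h1 : piMap (f.app (op (k + y))) (k - 1)
          (boundary (f.app (op (k + y))) (sub_add_cancel k 1) w) = 0 :=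
        (piMap_eq_zero_iff _ _ _).2 ⟨w, rfl⟩
      have hk : k + y = k - 1 + (y + 1) := by omega
      -- The boundary of `w` lies at (k - 1, y + 1): above the line that group is zero, otherwise
      -- `f` is injective there.
      by_cases hy' : ⌊α * (k - 1 : ℤ)⌋ < y + 1
      · have hs : Subsingleton ((X.obj (op (k + y))).pi (k - 1)) := by
          rw [hk]
          exact h0 _ _ hy'
        exact hs.elim _ _
      · have hi : Function.Injective (piMap (f.app (op (k + y))) (k - 1)) := by
          rw [hk]
          exact (h _ _ (not_lt.1 hy')).1
        exact (map_eq_zero_iff _ hi).1 h1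
    obtain ⟨b, rfl⟩ := (boundary_eq_zero_iff _ (hY _) _ _).1 hb
    obtain ⟨a, rfl⟩ := (h k y hy).2 b
    exact (toCofib_eq_zero_iff (f.app (op (k + y))) (hX _) (hY _) k _).2 ⟨a, rfl⟩

end Fil

namespace Fil

open PreSpec

/-! ### Pages of the spectral sequence -/

theorem tau_delta_self {X : Fil.{u}} {x y x' y' y'' : ℤ} (hx : x' + 1 = x) (hy : y' = y + 2)
    (hy' : y'' = y + 2) (z : gr X x y) :
    tau X x' y' y'' (delta X hx hy z) = delta X hx hy' z := by
  subst hy hy'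
  exact tau_self X _

theorem mem_cycles_iff {X : Fil.{u}} {r x y x' y' : ℤ} (hx : x' + 1 = x) (hy : y' = y + r)
    (z : gr X x y) : z ∈ cycles X r x y ↔
      ∃ c : bi X x' y', delta X hx rfl z = tau X x' y' (y + 2) c := by
  obtain rfl : x' = x - 1 := by omega
  subst hy
  exact ⟨fun ⟨c, hc⟩ => ⟨c, hc.symm⟩, fun ⟨c, hc⟩ => ⟨c, hc.symm⟩⟩

theorem mem_cycles_of_delta_eq_zero {X : Fil.{u}} {r x y x' : ℤ} (hx : x' + 1 = x)
    {z : gr X x y} (hz : delta X hx rfl z = 0) : z ∈ cycles X r x y :=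
  (mem_cycles_iff hx rfl z).2 ⟨0, by rw [hz, map_zero]⟩

theorem red_mem_cycles {X : Fil.{u}} (hX : X.IsSpectrum) (r : ℤ) {x y : ℤ} (a : bi X x y) :
    red X x y a ∈ cycles X r x y :=
  mem_cycles_of_delta_eq_zero (sub_add_cancel x 1) (delta_red hX _ _ a)

theorem mem_boundaries_iff {X : Fil.{u}} {r x y y' : ℤ} (hy : y' = y - (r - 2))
    (z : gr X x y) : z ∈ boundaries X r x y ↔
      ∃ c : bi X x y, tau X x y y' c = 0 ∧ red X x y c = z := by
  subst hy
  exact Iff.rfl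

theorem delta_eq_zero_of_mem_boundaries {X : Fil.{u}} (hX : X.IsSpectrum) {r x y x' y' : ℤ}
    (hx : x' + 1 = x) (hy : y' = y + 2) {z : gr X x y} (hz : z ∈ boundaries X r x y) :
    delta X hx hy z = 0 := by
  obtain ⟨c, -, rfl⟩ := (mem_boundaries_iff rfl z).1 hz
  exact delta_red hX hx hy c

theorem exists_represents {X : Fil.{u}} {r x y : ℤ} (e : Page X r x y) :
    ∃ z : gr X x y, Represents z e := by
  obtain ⟨z, rfl⟩ := QuotientAddGroup.mk_surjective e
  exact ⟨z.1, z.2, rfl⟩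

theorem exists_page {X : Fil.{u}} {r x y : ℤ} {z : gr X x y} (hz : z ∈ cycles X r x y) :
    ∃ e : Page X r x y, Represents z e := ⟨_, hz, rfl⟩

theorem Represents.eq_zero_iff {X : Fil.{u}} {r x y : ℤ} {z : gr X x y} {e : Page X r x y}
    (h : Represents z e) : e = 0 ↔ z ∈ boundaries X r x y := by
  obtain ⟨hz, rfl⟩ := h
  exact QuotientAddGroup.eq_zero_iff _

theorem Represents.sub {X : Fil.{u}} {r x y : ℤ} {z z' : gr X x y} {e e' : Page X r x y}
    (h : Represents z e) (h' : Represents z' e') : Represents (z - z') (e - e') := by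
  obtain ⟨hz, rfl⟩ := h
  obtain ⟨hz', rfl⟩ := h'
  exact ⟨sub_mem hz hz', rfl⟩

theorem Represents.eq_iff {X : Fil.{u}} {r x y : ℤ} {z z' : gr X x y} {e e' : Page X r x y}
    (h : Represents z e) (h' : Represents z' e') : e = e' ↔ z - z' ∈ boundaries X r x y := by
  rw [← sub_eq_zero, (h.sub h').eq_zero_iff]

theorem Represents.map {X Y : Fil.{u}} (f : X ⟶ Y) {r x y : ℤ} {z : gr X x y}
    {e : Page X r x y} (h : Represents z e) :
    Represents (grMap f x y z) (pageMap f r x y e) := by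
  obtain ⟨hz, rfl⟩ := h
  exact ⟨grMap_mem_cycles f r x y hz, rfl⟩

theorem Represents.congr {X : Fil.{u}} {r x y : ℤ} {z z' : gr X x y} {e : Page X r x y}
    (h : Represents z e) (hz' : z' ∈ cycles X r x y) (hb : z - z' ∈ boundaries X r x y) :
    Represents z' e := by
  obtain ⟨e', he'⟩ := exists_page hz'
  rwa [(h.eq_iff he').2 hb]

/-- All representatives of a class have the same image under `δ`. -/
theorem Represents.delta_eq {X : Fil.{u}} (hX : X.IsSpectrum) {r x y x' y' : ℤ}
    {z z' : gr X x y} {e : Page X r x y} (h : Represents z e) (h' : Represents z' e)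
    (hx : x' + 1 = x) (hy : y' = y + 2) : delta X hx hy z = delta X hx hy z' := by
  rw [← sub_eq_zero, ← map_sub]
  exact delta_eq_zero_of_mem_boundaries hX hx hy ((h.eq_iff h').1 rfl)

/-- `delta` does not depend on the representative, so it vanishes on all of them. If δ a = τ^(s-2)
c, then τ^(s-2) c = 0, which says that [c] is a boundary on E_s. -/
theorem not_supportsLineCrossing {α : ℝ} {X : Fil.{u}} (hX : X.IsSpectrum) {r x y : ℤ}
    {e : Page X r x y} (he : IsPermanentCycle e) :
    ¬ SupportsLineCrossing α e := by
  rintro ⟨s, e', w, -, ⟨z, hz, hz'⟩, ⟨hx, -, z₁, c, hz₁, hc, hw⟩, hw0, -⟩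
  obtain ⟨z₀, hz₀, h0⟩ := he
  have h1 := hz₁.delta_eq hX hz' hx rfl
  rw [hz.delta_eq hX hz₀ hx rfl, h0, hc] at h1
  refine hw0 (hw.eq_zero_iff.2 ((mem_boundaries_iff (by ring) _).2 ⟨c, h1, rfl⟩))

/-! ### The criterion -/

/-- The description of connective covers in terms of bigraded homotopy groups; `L x` is the
height of the line over `x`. -/
structure IsBiCover (L : ℤ → ℤ) {X Y : Fil.{u}} (f : X ⟶ Y) : Prop where
  eq_zero : ∀ {x y : ℤ}, L x < y → ∀ a : bi X x y, a = 0
  bijective : ∀ {x y : ℤ}, y ≤ L x → Function.Bijective (biMap f x y)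

section Sufficiency

variable {X Y : Fil.{u}} {f : X ⟶ Y} {L : ℤ → ℤ}

/-- Above the line X/τ is zero, so every class can be divided by τ again and again, in a compatible
way; completeness forbids this for nonzero classes. -/
theorem IsComplete.eq_zero_of_gr (hXs : X.IsSpectrum) (hX : IsComplete X)
    (hgr : ∀ x y : ℤ, L x < y → Subsingleton (gr X x y)) {x y : ℤ} (hy : L x < y)
    (a : bi X x y) : a = 0 := by
  have step : ∀ (j : ℕ) (c : bi X x (y + j)), ∃ c' : bi X x (y + ((j + 1 : ℕ) : ℤ)),
      tau X x (y + ((j + 1 : ℕ) : ℤ)) (y + j) c' = c := fun j c =>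
    (red_eq_zero_iff hXs (by push_cast; ring) c).1 ((hgr x (y + j) (by omega)).elim _ _)
  choose g hg using step
  have hz : y + ((0 : ℕ) : ℤ) = y := by simp
  have h := hX.eq_zero_of_compatible
    (fun j => Nat.rec (motive := fun j : ℕ => bi X x (y + j)) (tau X x y _ a) g j)
    fun j => hg j _
  rw [← tau_self X a, ← tau_tau X hz.le hz.ge]
  exact (congrArg _ h).trans (map_zero _)

/-- The boundaries on E₂ are zero, so E₂ detects `red X x y a` itself. -/
theorem grMap_injective_of_page (hXs : X.IsSpectrum) {x y : ℤ}
    (h : Function.Injective (pageMap f 2 x y)) {a : bi X x y}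
    (ha : grMap f x y (red X x y a) = 0) : red X x y a = 0 := by
  obtain ⟨e, he⟩ := exists_page (red_mem_cycles hXs 2 a)
  have h0 : pageMap f 2 x y e = 0 := by
    rw [(he.map f).eq_zero_iff, ha]
    exact zero_mem _
  obtain ⟨c, hc, hca⟩ := (mem_boundaries_iff (show y = y - (2 - 2) by ring) _).1
    (he.eq_zero_iff.1 ((map_eq_zero_iff _ h).1 h0))
  rw [tau_self] at hc
  rw [← hca, hc, map_zero]

/-- Since [a] maps to [τ b] = 0 and its bidegree is strictly below the line, E₂-injectivity gives a
= τ a'. The error b - f(a') is killed by τ, so it equals δ z. As δ z has height y ≤ L x, the class z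
lies where E₂ is bijective; lifting it corrects a'. -/
theorem exists_lift_of_lift_tau (hXs : X.IsSpectrum) (hYs : Y.IsSpectrum)
    (hbij : ∀ r x y : ℤ, 2 ≤ r → y + r ≤ L (x - 1) → Function.Bijective (pageMap f r x y))
    (hinj : ∀ r x y : ℤ, 2 ≤ r → y ≠ L x → Function.Injective (pageMap f r x y))
    {x y y₂ : ℤ} (hy : y ≤ L x) (hy₂ : y₂ = y - 1) {b : bi Y x y} {a : bi X x y₂}
    (h : biMap f x y₂ a = tau Y x y y₂ b) : ∃ a', biMap f x y a' = b := by
  have h1 : red X x y₂ a = 0 := by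
    refine grMap_injective_of_page hXs (hinj 2 x y₂ le_rfl (by omega)) ?_
    rw [red_natural, h, red_tau hYs (by omega)]
  obtain ⟨a', rfl⟩ := (red_eq_zero_iff hXs (show y = y₂ + 1 by omega) a).1 h1
  have h2 : tau Y x y y₂ (b - biMap f x y a') = 0 := by
    rw [map_sub, ← tau_natural, h, sub_self]
  obtain ⟨z, hz⟩ := (tau_eq_zero_iff (x := x + 1) (y := y - 2) rfl (by ring) (by omega) _).1 h2
  have hzc : z ∈ cycles Y 2 (x + 1) (y - 2) :=
    (mem_cycles_iff rfl rfl z).2 ⟨delta Y rfl rfl z, (tau_self Y _).symm⟩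
  obtain ⟨e, he⟩ := exists_page hzc
  obtain ⟨e₀, rfl⟩ := (hbij 2 (x + 1) (y - 2) le_rfl
    (by rw [add_sub_cancel_right]; omega)).2 e
  obtain ⟨z₀, hz₀⟩ := exists_represents e₀
  refine ⟨a' + delta X (x := x + 1) (y := y - 2) rfl (by ring) z₀, ?_⟩
  rw [map_add, delta_natural, (hz₀.map f).delta_eq hYs he, hz, add_sub_cancel]

/-- Surjectivity of τ⁻¹f lifts some τ^d b, and the preceding lemma removes the factors τ one by one.
-/
theorem exists_lift_of_pages (hXs : X.IsSpectrum) (hYs : Y.IsSpectrum) (hf : TauInvEquiv f)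
    (hbij : ∀ r x y : ℤ, 2 ≤ r → y + r ≤ L (x - 1) → Function.Bijective (pageMap f r x y))
    (hinj : ∀ r x y : ℤ, 2 ≤ r → y ≠ L x → Function.Injective (pageMap f r x y))
    {x y : ℤ} (hy : y ≤ L x) (b : bi Y x y) : ∃ a, biMap f x y a = b := by
  have key : ∀ (d : ℕ) (a : bi X x (y - d)), biMap f x (y - d) a = tau Y x y (y - d) b →
      ∃ a, biMap f x y a = b := by
    intro d
    induction d with
    | zero =>
      intro a ha
      have hz : y - ((0 : ℕ) : ℤ) = y := by simp
      refine ⟨tau X x _ y a, ?_⟩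
      rw [tau_natural, ha, tau_tau Y hz.le hz.ge, tau_self]
    | succ d ih =>
      intro a ha
      obtain ⟨a', ha'⟩ := exists_lift_of_lift_tau (y := y - d) hXs hYs hbij hinj (by omega)
        (by push_cast; ring) (b := tau Y x y (y - d) b) (a := a)
        (by rw [ha, tau_tau Y (by omega) (by push_cast; omega)])
      exact ih a' ha'
  obtain ⟨n, hn, a, ha⟩ := hf.exists_lift hYs b
  obtain ⟨d, rfl⟩ : ∃ d : ℕ, n = x + (y - d) := ⟨(x + y - n).toNat, by omega⟩
  exact key d a (ha.trans (tau_eq Y (by omega) b).symm)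

/-- A class in the kernel is divided up to the line as τ^k a'. If τ^N is the least power killing a',
then τ^(N-1) a' = δ z, and unless a = 0 this element is a τ-multiple of a, so δ f(z) = 0. The
contradiction comes from comparing z with a class having the same image modulo boundaries but δ = 0.
-/
theorem eq_zero_of_pages (hL : ∀ x, L (x - 1) ≤ L x + 1) (hXs : X.IsSpectrum)
    (hYs : Y.IsSpectrum) (hf : TauInvEquiv f)
    (hzero : ∀ {x y : ℤ}, L x < y → ∀ a : bi X x y, a = 0)
    (hbij : ∀ r x y : ℤ, 2 ≤ r → y + r ≤ L (x - 1) → Function.Bijective (pageMap f r x y))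
    (himg : ∀ r x y : ℤ, 2 ≤ r → L (x - 1) < y + r → y ≤ L x → ∀ e : Page Y r x y,
      IsPermanentCycle e → ∃ e₀, pageMap f r x y e₀ = e)
    (hinj : ∀ r x y : ℤ, 2 ≤ r → y ≠ L x → Function.Injective (pageMap f r x y))
    {x y : ℤ} (hy : y ≤ L x) (a : bi X x y) (ha : biMap f x y a = 0) : a = 0 := by
  -- divide `a` by powers of `τ` up to the line
  have hdiv : ∀ k : ℕ, y + k ≤ L x → ∃ c : bi X x (y + k), tau X x (y + k) y c = a := by
    intro k
    induction k with
    | zero =>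
      intro _
      have hz : y + ((0 : ℕ) : ℤ) = y := by simp
      exact ⟨tau X x y _ a, by rw [tau_tau X hz.le hz.ge, tau_self]⟩
    | succ k ih =>
      intro hk
      push_cast at hk
      obtain ⟨c, hc⟩ := ih (by omega)
      obtain ⟨e, he⟩ := exists_page (red_mem_cycles hXs (k + 2) c)
      have h0 : pageMap f (k + 2) x (y + k) e = 0 := by
        rw [(he.map f).eq_zero_iff, red_natural]
        refine (mem_boundaries_iff (show y = _ by ring) _).2 ⟨_, ?_, rfl⟩
        rw [← tau_natural, hc, ha]
      obtain ⟨c', hc', hcc⟩ := (mem_boundaries_iff (show y = _ by ring) _).1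
        (he.eq_zero_iff.1 ((map_eq_zero_iff _ (hinj (k + 2) x (y + k) (by omega) (by omega))).1 h0))
      obtain ⟨d, hd⟩ := (red_eq_zero_iff hXs (show y + ((k + 1 : ℕ) : ℤ) = y + k + 1 by
        push_cast; ring) (c - c')).1 (by rw [map_sub, hcc, sub_self])
      refine ⟨d, ?_⟩
      rw [← tau_tau X (by push_cast; omega : y + (k : ℤ) ≤ _) (by omega), hd, map_sub, hc, hc',
        sub_zero]
  obtain ⟨k, hk⟩ : ∃ k : ℕ, L x = y + k := ⟨(L x - y).toNat, by omega⟩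
  obtain ⟨a', ha'⟩ : ∃ a' : bi X x (L x), tau X x (L x) y a' = a := by
    rw [hk]
    exact hdiv k hk.ge
  -- the order of `τ`-torsion of the quotient
  have htors : ∃ N : ℕ, tau X x (L x) (L x - N) a' = 0 := by
    obtain ⟨n, hn, h⟩ := hf.exists_eq_zero hXs hYs a ha
    obtain ⟨N, rfl⟩ : ∃ N : ℕ, n = x + (L x - N) := ⟨(x + L x - n).toNat, by omega⟩
    refine ⟨N, ?_⟩
    rw [← tau_tau X hy (by omega), ha', tau_eq X (by omega)]
    exact h
  classical
  let N := Nat.find htors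
  have hN : tau X x (L x) (L x - N) a' = 0 := Nat.find_spec htors
  by_cases hNy : y ≤ L x - N
  · rw [← ha', ← tau_tau X (by omega : L x - N ≤ L x) hNy, hN, map_zero]
  exfalso
  have hN1 : tau X x (L x) (L x - N + 1) a' ≠ 0 := fun h => by
    refine Nat.find_min htors (show N - 1 < N by omega) ?_
    rwa [show L x - ((N - 1 : ℕ) : ℤ) = L x - N + 1 by omega]
  obtain ⟨z, hz⟩ := (tau_eq_zero_iff (x := x + 1) (y := L x - N - 1) (y'' := L x - N) rfl (by ring) (by ring)
    (tau X x (L x) (L x - N + 1) a')).1 (by rw [tau_tau X (by omega) (by omega), hN])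
  have hfz : delta Y (x' := x) rfl rfl (grMap f (x + 1) (L x - N - 1) z) = 0 := by
    have h1 : delta Y (x' := x) (y' := L x - N + 1) rfl (by ring)
        (grMap f (x + 1) (L x - N - 1) z) = 0 := by
      rw [← delta_natural, hz, ← tau_tau X hy (by omega), ha', tau_natural, ha, map_zero]
    rw [delta_eq_zero_iff hYs] at h1 ⊢
    exact h1
  have hL1 := hL (x + 1)
  rw [add_sub_cancel_right] at hL1
  -- the image of `z` is a permanent cycle, so that it comes from a class with `δ = 0`
  obtain ⟨e, he⟩ := exists_page (mem_cycles_of_delta_eq_zero (r := (N : ℤ) + 2) rfl hfz)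
  -- E_(N+2) is the first page on which the differential out of this bidegree ends above the line,
  -- at height L x + 1; there X vanishes, so a lift of `e` has δ = 0.
  obtain ⟨e₂, rfl⟩ := himg (N + 2) (x + 1) (L x - N - 1) (by omega)
    (by rw [add_sub_cancel_right]; omega) (by omega) e ⟨_, he, by
      rw [delta_eq_zero_iff hYs] at hfz ⊢
      exact hfz⟩
  obtain ⟨z₂, hz₂⟩ := exists_represents e₂
  have hδ₂ : delta X (x' := x) (y' := L x - N + 1) rfl (by ring) z₂ = 0 := by
    obtain ⟨c, hc⟩ := (mem_cycles_iff (x' := x) rfl rfl z₂).1 hz₂.1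
    rw [hzero (by omega) c, map_zero] at hc
    rw [delta_eq_zero_iff hXs] at hc ⊢
    exact hc
  obtain ⟨c, -, hc⟩ := (mem_boundaries_iff rfl _).1 (((hz₂.map f).eq_iff he).1 rfl)
  obtain ⟨c', rfl⟩ := exists_lift_of_pages hXs hYs hf hbij hinj (by omega) c
  have hzc : z ∈ cycles X (N + 1) (x + 1) (L x - N - 1) := by
    refine (mem_cycles_iff (x' := x) (y' := L x) rfl (by ring) z).2 ⟨a', ?_⟩
    have h1 := congrArg (tau X x (L x - N + 1) (L x - N - 1 + 2)) hz
    rw [tau_tau X (by omega) (by omega)] at h1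
    rw [← h1, tau_delta_self _ _ rfl]
  -- This combination maps to zero in Y/τ. On E_(N+1) its differential ends exactly on the line,
  -- where the page map is still injective, so its δ vanishes; but that δ is -δ z.
  have hu : z₂ - z - red X (x + 1) (L x - N - 1) c' ∈ cycles X (N + 1) (x + 1) (L x - N - 1) := by
    refine sub_mem (sub_mem ?_ hzc) (red_mem_cycles hXs _ _)
    refine mem_cycles_of_delta_eq_zero (x' := x) rfl ?_
    rw [delta_eq_zero_iff hXs] at hδ₂ ⊢
    exact hδ₂
  obtain ⟨e₃, he₃⟩ := exists_page hu
  have h3 : pageMap f (N + 1) (x + 1) (L x - N - 1) e₃ = 0 := by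
    rw [(he₃.map f).eq_zero_iff, map_sub, map_sub, red_natural, hc, sub_self]
    exact zero_mem _
  have h4 := he₃.eq_zero_iff.1 ((map_eq_zero_iff _ (hbij (N + 1) (x + 1) (L x - N - 1) (by omega)
    (by rw [add_sub_cancel_right]; omega)).1).1 h3)
  have h5 := delta_eq_zero_of_mem_boundaries hXs (x' := x) (y' := L x - N + 1) rfl (by ring) h4
  rw [map_sub, map_sub, hδ₂, delta_red hXs, hz, zero_sub, sub_zero, neg_eq_zero] at h5
  exact hN1 h5

theorem isBiCover_of_pages (hL : ∀ x, L (x - 1) ≤ L x + 1) (hXs : X.IsSpectrum)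
    (hYs : Y.IsSpectrum) (hX : IsComplete X)
    (hgr : ∀ x y : ℤ, L x < y → Subsingleton (gr X x y)) (hf : TauInvEquiv f)
    (hbij : ∀ r x y : ℤ, 2 ≤ r → y + r ≤ L (x - 1) → Function.Bijective (pageMap f r x y))
    (himg : ∀ r x y : ℤ, 2 ≤ r → L (x - 1) < y + r → y ≤ L x → ∀ e : Page Y r x y,
      IsPermanentCycle e → ∃ e₀, pageMap f r x y e₀ = e)
    (hinj : ∀ r x y : ℤ, 2 ≤ r → y ≠ L x → Function.Injective (pageMap f r x y)) :
    IsBiCover L f where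
  eq_zero := hX.eq_zero_of_gr hXs hgr
  bijective hy := ⟨(injective_iff_map_eq_zero _).2 (eq_zero_of_pages hL hXs hYs hf
    (hX.eq_zero_of_gr hXs hgr) hbij himg hinj hy), exists_lift_of_pages hXs hYs hf hbij hinj hy⟩

end Sufficiency

end Fil

namespace Fil

open PreSpec

/-! ### Pages of a connective cover -/

theorem IsDiff.map {X Y : Fil.{u}} (f : X ⟶ Y) {r x y x' y' : ℤ} {z : Page X r x y}
    {w : Page X r x' y'} (h : IsDiff z w) :
    IsDiff (pageMap f r x y z) (pageMap f r x' y' w) := by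
  obtain ⟨hx, hy, a, c, ha, hc, hw⟩ := h
  refine ⟨hx, hy, grMap f x y a, biMap f x' y' c, ha.map f, ?_, ?_⟩
  · rw [← delta_natural, hc, tau_natural]
  · rw [← red_natural]
    exact hw.map f

namespace IsBiCover

variable {X Y : Fil.{u}} {f : X ⟶ Y} {L : ℤ → ℤ}

theorem injective (hf : IsBiCover L f) (x y : ℤ) : Function.Injective (biMap f x y) := by
  by_cases hy : y ≤ L x
  · exact (hf.bijective hy).1
  · exact fun a b _ => (hf.eq_zero (not_le.1 hy) a).trans (hf.eq_zero (not_le.1 hy) b).symm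

theorem map_eq_zero_iff (hf : IsBiCover L f) {x y : ℤ} {a : bi X x y} :
    biMap f x y a = 0 ↔ a = 0 :=
  _root_.map_eq_zero_iff _ (hf.injective x y)

theorem subsingleton_gr (hf : IsBiCover L f) (hL : ∀ x, L (x - 1) ≤ L x + 1)
    (hX : X.IsSpectrum) {x y : ℤ} (hy : L x < y) : Subsingleton (gr X x y) := by
  refine subsingleton_of_forall_eq 0 fun z => ?_
  have hLx := hL x
  obtain ⟨a, rfl⟩ := (delta_eq_zero_iff hX (sub_add_cancel x 1) rfl z).1
    (hf.eq_zero (by omega) _)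
  rw [hf.eq_zero hy a, map_zero]

/-- If f(z) = [c] is a boundary, c lifts to a class with the same torsion, and z may be changed by
that boundary so that f(z) = 0 in Y/τ. Then f(δ z) = 0, so δ z = 0 and z = [a], and f(a) is
divisible by τ because its reduction vanishes. -/
theorem exists_red_of_pageMap_eq_zero (hf : IsBiCover L f) (hX : X.IsSpectrum)
    (hY : Y.IsSpectrum) {r x y : ℤ} (hy : y ≤ L x) {e : Page X r x y}
    (he : pageMap f r x y e = 0) :
    ∃ (a : bi X x y) (b : bi Y x (y + 1)), Represents (red X x y a) e ∧
      biMap f x y a = tau Y x (y + 1) y b := by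
  obtain ⟨z, hz⟩ := exists_represents e
  obtain ⟨c, hc, hcz⟩ := (mem_boundaries_iff rfl _).1 ((hz.map f).eq_zero_iff.1 he)
  obtain ⟨c', rfl⟩ := (hf.bijective hy).2 c
  rw [← tau_natural, hf.map_eq_zero_iff] at hc
  have h0 : grMap f x y (z - red X x y c') = 0 := by
    rw [map_sub, red_natural, hcz, sub_self]
  have hδ : delta X (sub_add_cancel x 1) rfl (z - red X x y c') = 0 := by
    rw [← hf.map_eq_zero_iff, delta_natural, h0, map_zero]
  obtain ⟨a, ha⟩ := (delta_eq_zero_iff hX _ _ _).1 hδ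
  obtain ⟨b, hb⟩ := (red_eq_zero_iff hY rfl (biMap f x y a)).1 (by
    rw [← red_natural, ha, h0])
  refine ⟨a, b, hz.congr (red_mem_cycles hX r a) ?_, hb.symm⟩
  rw [ha, sub_sub_cancel]
  exact (mem_boundaries_iff rfl _).2 ⟨c', hc, rfl⟩

/-- Strictly below the line the quotient of f(a) by τ still lifts to X, so a is itself divisible and
[a] = 0. Above the line X/τ is zero. Only on the line may the quotient fail to lift. -/
theorem pageMap_injective (hf : IsBiCover L f) (hL : ∀ x, L (x - 1) ≤ L x + 1)
    (hX : X.IsSpectrum) (hY : Y.IsSpectrum) {r x y : ℤ} (hy : y ≠ L x) :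
    Function.Injective (pageMap f r x y) := by
  rw [injective_iff_map_eq_zero]
  intro e he
  by_cases hy' : y ≤ L x
  · obtain ⟨a, b, ha, hab⟩ := hf.exists_red_of_pageMap_eq_zero hX hY hy' he
    obtain ⟨c, rfl⟩ := (hf.bijective (by omega)).2 b
    rw [← tau_natural] at hab
    rw [ha.eq_zero_iff, hf.injective _ _ hab, red_tau hX (by omega)]
    exact zero_mem _
  · obtain ⟨z, hz⟩ := exists_represents e
    have := hf.subsingleton_gr hL hX (not_le.1 hy')
    rw [hz.eq_zero_iff, Subsingleton.elim z 0]
    exact zero_mem _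

/-- With δ z = τ^(r-2) c, the class c lifts to X, and its multiple by τ^(r-2) is killed by τ, hence
equals δ z'. Then z - f(z') has δ = 0, so it is the reduction of a class below the line, which also
lifts. -/
theorem pageMap_surjective (hf : IsBiCover L f) (hL : ∀ x, L (x - 1) ≤ L x + 1)
    (hX : X.IsSpectrum) (hY : Y.IsSpectrum) {r x y : ℤ} (hr : 2 ≤ r) (hy : y + r ≤ L (x - 1)) :
    Function.Surjective (pageMap f r x y) := by
  intro e
  have hLx := hL x
  obtain ⟨z, hz⟩ := exists_represents e
  obtain ⟨c, hc⟩ := (mem_cycles_iff (sub_add_cancel x 1) rfl z).1 hz.1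
  obtain ⟨c, rfl⟩ := (hf.bijective hy).2 c
  obtain ⟨z', hz'⟩ := (tau_eq_zero_iff (sub_add_cancel x 1) rfl rfl
    (tau X (x - 1) (y + r) (y + 2) c)).1 (by
      rw [← hf.map_eq_zero_iff, tau_natural, tau_natural, ← hc, tau_delta _ _ (by omega)])
  obtain ⟨b, hb⟩ := (delta_eq_zero_iff hY (sub_add_cancel x 1) rfl (z - grMap f x y z')).1 (by
    rw [map_sub, ← delta_natural, hz', tau_natural, hc, sub_self])
  obtain ⟨b, rfl⟩ := (hf.bijective (by omega)).2 b
  have hz'c : z' ∈ cycles X r x y := (mem_cycles_iff (sub_add_cancel x 1) rfl z').2 ⟨c, hz'⟩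
  obtain ⟨e₁, he₁⟩ := exists_page (add_mem hz'c (red_mem_cycles hX r b))
  refine ⟨e₁, ((he₁.map f).eq_iff hz).2 ?_⟩
  rw [map_add, red_natural, hb, add_sub_cancel, sub_self]
  exact zero_mem _

/-- A cycle of X in this range has δ = τ^(r-2) c with c above the line, so δ = 0. Conversely, a
permanent cycle is a reduction [b], and b lifts. -/
theorem mem_range_pageMap_iff (hf : IsBiCover L f) (hX : X.IsSpectrum) (hY : Y.IsSpectrum)
    {r x y : ℤ} (hr : L (x - 1) < y + r) (hy : y ≤ L x) (e : Page Y r x y) :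
    (∃ e₀, pageMap f r x y e₀ = e) ↔ IsPermanentCycle e := by
  constructor
  · rintro ⟨e₀, rfl⟩
    obtain ⟨z, hz⟩ := exists_represents e₀
    obtain ⟨c, hc⟩ := (mem_cycles_iff (sub_add_cancel x 1) rfl z).1 hz.1
    refine ⟨_, hz.map f, ?_⟩
    rw [← delta_natural, hc, hf.eq_zero hr c, map_zero, map_zero]
  · rintro ⟨z, hz, hδ⟩
    obtain ⟨b, rfl⟩ := (delta_eq_zero_iff hY _ _ _).1 hδ
    obtain ⟨a, rfl⟩ := (hf.bijective hy).2 b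
    obtain ⟨e₀, he₀⟩ := exists_page (red_mem_cycles hX r a)
    refine ⟨e₀, ((he₀.map f).eq_iff hz).2 ?_⟩
    rw [red_natural, sub_self]
    exact zero_mem _

/-- On the line, reduction modulo `τ` is injective. -/
theorem red_eq_zero_iff (hf : IsBiCover L f) (hX : X.IsSpectrum) {x : ℤ} (a : bi X x (L x)) :
    red X x (L x) a = 0 ↔ a = 0 := by
  refine ⟨fun h => ?_, fun h => by rw [h, map_zero]⟩
  obtain ⟨c, rfl⟩ := (Fil.red_eq_zero_iff hX rfl a).1 h
  rw [hf.eq_zero (by omega) c, map_zero]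

/-- On the line [c] = [a] forces c = a, so survival of [a] to E_r is governed by the torsion of a
alone. -/
theorem red_mem_boundaries_iff (hf : IsBiCover L f) (hX : X.IsSpectrum) {r x : ℤ}
    (a : bi X x (L x)) :
    red X x (L x) a ∈ boundaries X r x (L x) ↔ tau X x (L x) (L x - (r - 2)) a = 0 := by
  rw [mem_boundaries_iff rfl]
  refine ⟨?_, fun h => ⟨a, h, rfl⟩⟩
  rintro ⟨c, hc, hca⟩
  rw [← sub_eq_zero, ← map_sub, hf.red_eq_zero_iff hX, sub_eq_zero] at hca
  rwa [← hca]

end IsBiCover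

/-! ### Strongly complete targets -/

/-- A class that supports no line-crossing differential is a permanent cycle. -/
theorem IsStronglyComplete.isPermanentCycle {α : ℝ} {Y : Fil.{u}} (hY : Y.IsSpectrum)
    (hYc : IsStronglyComplete Y) {r x y : ℤ} (hr : 2 ≤ r) (hr' : α * (x - 1) < y + r)
    (hy : (y : ℝ) ≤ α * x) {e : Page Y r x y} (he : ¬ SupportsLineCrossing α e) :
    IsPermanentCycle e := by
  obtain ⟨z, hz⟩ := exists_represents e
  -- If [c] were nonzero on E_(r+j), a line-crossing differential would arise. So [c] = [c'] with c'
  -- killed by the relevant power of τ, c - c' is divisible by τ, and δ z is divisible once more.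
  -- Eventually δ z is infinitely divisible.
  have key : ∀ j : ℕ, z ∈ cycles Y (r + j) x y := by
    intro j
    induction j with
    | zero => simpa using hz.1
    | succ j ih =>
      obtain ⟨e', he'⟩ := exists_page ih
      obtain ⟨c, hc⟩ := (mem_cycles_iff (sub_add_cancel x 1) rfl z).1 ih
      obtain ⟨w, hw⟩ := exists_page (red_mem_cycles hY (r + j) c)
      have hw0 : w = 0 := by
        by_contra hw0
        refine he ⟨r + j, e', w, by omega, ⟨z, hz, he'⟩,
          ⟨sub_add_cancel x 1, rfl, z, c, he', hc, hw⟩, hw0, hy, ?_⟩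
        push_cast
        linarith [(Nat.cast_nonneg j : (0 : ℝ) ≤ j)]
      obtain ⟨c', hc', hcc⟩ := (mem_boundaries_iff (show y + 2 = _ by ring) _).1
        (hw.eq_zero_iff.1 hw0)
      obtain ⟨d, hd⟩ := (red_eq_zero_iff hY (show y + (r + ((j + 1 : ℕ) : ℤ)) = y + (r + j) + 1 by
        push_cast; ring) (c - c')).1 (by rw [map_sub, hcc, sub_self])
      refine (mem_cycles_iff (sub_add_cancel x 1) rfl z).2 ⟨d, ?_⟩
      have h1 := tau_tau Y (by push_cast; omega : y + (r + (j : ℤ)) ≤ _)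
        (by omega : y + 2 ≤ y + (r + (j : ℤ))) d
      rw [hd, map_sub, hc', sub_zero] at h1
      rw [hc, h1]
  refine ⟨z, hz, hYc.eq_zero_of_divisible _ fun j => ?_⟩
  obtain ⟨c, hc⟩ := (mem_cycles_iff (sub_add_cancel x 1) rfl z).1 (key j)
  exact ⟨tau Y (x - 1) _ (y + 2 + j) c, by rw [tau_tau Y (by omega) (by omega), hc]⟩

/-- A class that stays nonzero in `π_{x,y₀}` can be divided by a maximal power of `τ` there. -/
theorem IsStronglyComplete.exists_division {Y : Fil.{u}} (hY : Y.IsSpectrum)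
    (hYc : IsStronglyComplete Y) {x y y₀ : ℤ} (hy : y₀ ≤ y) (b : bi Y x y)
    (hb : tau Y x y y₀ b ≠ 0) :
    ∃ (j : ℕ) (c : bi Y x (y + j)), tau Y x (y + j) y₀ c = tau Y x y y₀ b ∧
      ∀ c' : bi Y x (y + j), tau Y x (y + j) y₀ c' = 0 → red Y x (y + j) c' ≠ red Y x (y + j) c := by
  -- Without a maximal division, any quotient could be modified by a class that dies in π_{x,y₀} so
  -- as to become divisible by τ; the image of `b` would be infinitely divisible. Allowing such
  -- modifications makes the final [c] nonzero on the relevant page, not merely in Y/τ.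
  by_contra! hcon
  refine hb (hYc.eq_zero_of_divisible _ fun j => ?_)
  have key : ∀ j : ℕ, ∃ c : bi Y x (y + j), tau Y x (y + j) y₀ c = tau Y x y y₀ b := by
    intro j
    induction j with
    | zero =>
      have hz : y + ((0 : ℕ) : ℤ) = y := by simp
      exact ⟨tau Y x y _ b, tau_tau Y hz.le (by omega) b⟩
    | succ j ih =>
      obtain ⟨c, hc⟩ := ih
      obtain ⟨c', hc', hcc⟩ := hcon j c hc
      obtain ⟨d, hd⟩ := (red_eq_zero_iff hY (show y + ((j + 1 : ℕ) : ℤ) = y + j + 1 by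
        push_cast; ring) (c - c')).1 (by rw [map_sub, hcc, sub_self])
      refine ⟨d, ?_⟩
      rw [← tau_tau Y (by push_cast; omega : y + (j : ℤ) ≤ _) (by omega), hd, map_sub, hc, hc',
        sub_zero]
  obtain ⟨c, hc⟩ := key j
  exact ⟨tau Y x _ (y₀ + j) c, by rw [tau_tau Y (by omega) (by omega), hc]⟩

/-- The nonzero class δ w is τ^(l+r-2) b, and τ δ = 0, so exactly the next power kills b. -/
theorem isTorsionOrder_of_delta {α : ℝ} {Y : Fil.{u}} {r x₁ y₁ x y : ℤ} (hr : 2 ≤ r)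
    (hx : x + 1 = x₁) (hy₁ : ⌊α * x⌋ = y₁ + r) (hy : ⌊α * x⌋ < y) {b : bi Y x y}
    {w : gr Y x₁ y₁} (hw : delta Y hx rfl w = tau Y x y (y₁ + 2) b)
    (hw0 : delta Y hx rfl w ≠ 0) : IsTorsionOrder α b r := by
  refine ⟨by omega, ?_, fun s hs hsr h => hw0 ?_⟩
  · rw [← tau_tau Y (by omega : y₁ + 2 ≤ y) (by omega), ← hw, tau_delta _ _ (by omega)]
  · rw [hw, ← tau_tau Y (by omega : ⌊α * x⌋ - (s - 1) ≤ y) (by omega), h, map_zero]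

/-- If `δ w = τ ^ (l + r - 2) b`, then `w` survives to `E_{l + r}` and `d_{l + r} w = [b]`. -/
theorem exists_isDiff_of_delta {α : ℝ} (hα : -1 < α) {Y : Fil.{u}} (hY : Y.IsSpectrum)
    {r x₁ y₁ x y : ℤ} (hr : 2 ≤ r) (hx : x + 1 = x₁) (hy₁ : ⌊α * x⌋ = y₁ + r)
    (hy : ⌊α * x⌋ < y) {b : bi Y x y} {w : gr Y x₁ y₁}
    (hw : delta Y hx rfl w = tau Y x y (y₁ + 2) b) {e : Page Y r x₁ y₁} (he : Represents w e) :
    ∃ (z' : Page Y (y - ⌊α * x⌋ + r) x₁ y₁) (v : Page Y (y - ⌊α * x⌋ + r) x y),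
      SurvivesTo e z' ∧ Represents (red Y x y b) v ∧ IsDiff z' v ∧
        (v ≠ 0 → IsLineCrossing α z' v) := by
  have hyr : y = y₁ + (y - ⌊α * x⌋ + r) := by omega
  obtain ⟨z', hz'⟩ := exists_page ((mem_cycles_iff hx hyr w).2 ⟨b, hw⟩)
  obtain ⟨v, hv⟩ := exists_page (red_mem_cycles hY (y - ⌊α * x⌋ + r) b)
  have hd : IsDiff z' v := ⟨hx, hyr, w, b, hz', hw, hv⟩
  refine ⟨z', v, ⟨w, he, hz'⟩, hv, hd, fun hv0 => ⟨hd, hv0, ?_, ?_⟩⟩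
  · rw [← Int.le_floor]
    have := floor_le_floor_add_one hα x₁
    rw [show x₁ - 1 = x by omega] at this
    omega
  · have h1 : (y₁ : ℝ) + ((y - ⌊α * x⌋ + r : ℤ) : ℝ) = y := by
      exact_mod_cast hyr.symm
    rw [h1, ← hx]
    push_cast
    rw [add_sub_cancel_right]
    exact Int.floor_lt.1 hy

end Fil

namespace Fil

open PreSpec

/-! ### Connective covers for the line y = αx: the criterion, its converse and dropped lifts. -/

section Cover

variable {α : ℝ} {X Y : Fil.{u}} {f : X ⟶ Y}

theorem exhibitsCover_iff_isBiCover (hα : -1 < α) (hX : X.IsSpectrum) (hY : Y.IsSpectrum) :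
    ExhibitsCover α f ↔ IsBiCover (fun x => ⌊α * x⌋) f := by
  rw [exhibitsCover_iff hα hX hY]
  exact ⟨fun h => ⟨fun hy a => (h.1 _ _ hy).elim _ _, fun hy => h.2 _ _ hy⟩,
    fun h => ⟨fun x y hy => subsingleton_of_forall_eq 0 (h.eq_zero hy), fun x y => h.bijective⟩⟩

theorem le_mul_sub_one_iff (x y r : ℤ) :
    (y + r : ℝ) ≤ α * (x - 1) ↔ y + r ≤ ⌊α * (x - 1 : ℤ)⌋ := by
  rw [Int.le_floor]
  push_cast
  rfl

/-- Of the image condition only the lifting of permanent cycles is used, so any predicate implied by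
being a permanent cycle suffices; this covers both forms of the criterion. -/
theorem PageConditions.exhibitsCover (hα : -1 < α) (hX : X.IsSpectrum) (hY : Y.IsSpectrum)
    {S : ∀ {r x y : ℤ}, Page Y r x y → Prop}
    (hS : ∀ {r x y : ℤ} (e : Page Y r x y), IsPermanentCycle e → S e)
    (h1 : IsStronglyComplete X) (h2 : IsConnective α (modTau X 1)) (h3 : TauInvEquiv f)
    (h4 : PageConditions α f S) : ExhibitsCover α f := by
  rw [exhibitsCover_iff_isBiCover hα hX hY]
  refine isBiCover_of_pages (floor_le_floor_add_one hα) hX hY h1.1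
    ((isConnective_iff hα _).1 h2) h3
    (fun r x y hr hy => h4.bijective r x y hr ((le_mul_sub_one_iff x y r).2 hy))
    (fun r x y hr hy hy' e he => (h4.image r x y hr ?_ (Int.le_floor.1 hy') e).2 (hS e he))
    h4.injective
  rw [← not_le, le_mul_sub_one_iff]
  exact not_le.2 hy

namespace IsBiCover

theorem pageConditions (hα : -1 < α) (hX : X.IsSpectrum) (hY : Y.IsSpectrum)
    (hf : IsBiCover (fun x => ⌊α * x⌋) f) {S : ∀ {r x y : ℤ}, Page Y r x y → Prop}
    (hS : ∀ {r x y : ℤ}, 2 ≤ r → α * (x - 1) < y + r → (y : ℝ) ≤ α * x →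
      ∀ e : Page Y r x y, IsPermanentCycle e ↔ S e) : PageConditions α f S where
  bijective r x y hr hy := by
    have hL := floor_le_floor_add_one hα x
    rw [le_mul_sub_one_iff] at hy
    exact ⟨hf.pageMap_injective (floor_le_floor_add_one hα) hX hY (by omega),
      hf.pageMap_surjective (floor_le_floor_add_one hα) hX hY hr hy⟩
  image r x y hr hy hy' e := by
    rw [← hS hr hy hy' e]
    rw [← not_le, le_mul_sub_one_iff, not_le] at hy
    exact hf.mem_range_pageMap_iff hX hY hy (Int.le_floor.2 hy') e
  injective r x y _ hy := hf.pageMap_injective (floor_le_floor_add_one hα) hX hY hy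

theorem isStronglyComplete (hX : X.IsSpectrum)
    (hf : IsBiCover (fun x => ⌊α * x⌋) f) : IsStronglyComplete X := by
  refine isStronglyComplete_of_subsingleton hX fun k => ⟨k + ⌊α * k⌋ + 1, fun n hn => ?_⟩
  obtain ⟨y, rfl⟩ : ∃ y, n = k + y := ⟨n - k, by omega⟩
  exact subsingleton_of_forall_eq 0 (hf.eq_zero (by omega))

theorem tauInvEquiv (hX : X.IsSpectrum) (hY : Y.IsSpectrum)
    (hf : IsBiCover (fun x => ⌊α * x⌋) f) : TauInvEquiv f := by
  refine tauInvEquiv_of_bijective hX hY fun k => ⟨k + ⌊α * k⌋, fun n hn => ?_⟩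
  obtain ⟨y, rfl⟩ : ∃ y, n = k + y := ⟨n - k, by omega⟩
  exact hf.bijective (by omega)

theorem isConnective_modTau (hα : -1 < α) (hX : X.IsSpectrum)
    (hf : IsBiCover (fun x => ⌊α * x⌋) f) : IsConnective α (modTau X 1) :=
  (isConnective_iff hα _).2 fun _ _ hy => hf.subsingleton_gr (floor_le_floor_add_one hα) hX hy

/-! ### Dropped lifts and differentials -/

theorem existsUnique_isDroppedLift (hf : IsBiCover (fun x => ⌊α * x⌋) f) {x y : ℤ}
    {b : bi Y x y} (hb : Drops α b) : ∃! a : bi X x ⌊α * x⌋, IsDroppedLift α f b a := by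
  obtain ⟨a, ha⟩ := (hf.bijective (le_refl ⌊α * x⌋)).2 (tau Y x y ⌊α * x⌋ b)
  exact ⟨a, ⟨hb, rfl, ha⟩, fun a' ha' => hf.injective _ _ (ha'.2.2.trans ha.symm)⟩

theorem map_tau_droppedLift {x y y' : ℤ} {b : bi Y x y} {a : bi X x ⌊α * x⌋}
    (h : IsDroppedLift α f b a) (hy' : y' ≤ ⌊α * x⌋) :
    biMap f x y' (tau X x ⌊α * x⌋ y' a) = tau Y x y y' b := by
  rw [tau_natural, h.2.2, tau_tau Y (Int.floor_lt.2 h.1.1).le hy']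

theorem tau_droppedLift_eq_zero_iff (hf : IsBiCover (fun x => ⌊α * x⌋) f) {x y y' : ℤ}
    {b : bi Y x y} {a : bi X x ⌊α * x⌋} (h : IsDroppedLift α f b a) (hy' : y' ≤ ⌊α * x⌋) :
    tau X x ⌊α * x⌋ y' a = 0 ↔ tau Y x y y' b = 0 := by
  rw [← map_tau_droppedLift h hy', hf.map_eq_zero_iff]

theorem represents_droppedLift_eq_zero_iff (hX : X.IsSpectrum)
    (hf : IsBiCover (fun x => ⌊α * x⌋) f) {r x y : ℤ} (hr : 2 ≤ r)
    {b : bi Y x y} {a : bi X x ⌊α * x⌋} (h : IsDroppedLift α f b a) {e : Page X r x ⌊α * x⌋}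
    (he : Represents (red X x ⌊α * x⌋ a) e) :
    e = 0 ↔ tau Y x y (⌊α * x⌋ - (r - 2)) b = 0 := by
  rw [he.eq_zero_iff, ← hf.tau_droppedLift_eq_zero_iff h (by omega)]
  exact hf.red_mem_boundaries_iff hX a

theorem kernel_iff (hX : X.IsSpectrum) (hY : Y.IsSpectrum) (hYc : IsStronglyComplete Y)
    (hf : IsBiCover (fun x => ⌊α * x⌋) f) {r x : ℤ} (hr : 2 ≤ r) (e : Page X r x ⌊α * x⌋) :
    (e ≠ 0 ∧ pageMap f r x ⌊α * x⌋ e = 0) ↔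
      ∃ (y : ℤ) (b : bi Y x y) (a : bi X x ⌊α * x⌋), IsDroppedLift α f b a ∧
        Represents (red X x ⌊α * x⌋ a) e ∧ tau Y x y (⌊α * x⌋ - (r - 2)) b ≠ 0 := by
  constructor
  · rintro ⟨he0, he⟩
    obtain ⟨a, b₁, ha, hab⟩ := hf.exists_red_of_pageMap_eq_zero hX hY le_rfl he
    have ha0 : tau X x ⌊α * x⌋ (⌊α * x⌋ - (r - 2)) a ≠ 0 := fun h =>
      he0 (ha.eq_zero_iff.2 ((hf.red_mem_boundaries_iff hX a).2 h))
    have hb₁ : tau Y x (⌊α * x⌋ + 1) ⌊α * x⌋ b₁ ≠ 0 := fun h => by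
      rw [h, hf.map_eq_zero_iff] at hab
      exact ha0 (by rw [hab, map_zero])
    -- `b₁` lies one step above the line but may itself be divisible by τ; a maximal division has
    -- nonzero reduction and therefore drops to the line.
    obtain ⟨j, b, hb, hmax⟩ := hYc.exists_division hY (by omega) b₁ hb₁
    have hlift : IsDroppedLift α f b a := by
      refine ⟨⟨Int.floor_lt.1 (by omega), fun h => hmax 0 (map_zero _) ?_, ?_⟩, rfl, ?_⟩
      · rw [h, map_zero]
      · rw [hb]
        exact hb₁
      · rw [hab, hb]
    exact ⟨_, b, a, hlift, ha, fun h => ha0 ((hf.tau_droppedLift_eq_zero_iff hlift (by omega)).2 h)⟩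
  · rintro ⟨y, b, a, hlift, ha, hb⟩
    refine ⟨fun h => hb ((hf.represents_droppedLift_eq_zero_iff hX hr hlift ha).1 h), ?_⟩
    rw [(ha.map f).eq_zero_iff, red_natural, hlift.2.2, red_tau hY (Int.floor_lt.2 hlift.1.1)]
    exact zero_mem _

theorem exists_differential (hα : -1 < α) (hX : X.IsSpectrum) (hY : Y.IsSpectrum)
    (hf : IsBiCover (fun x => ⌊α * x⌋) f) {x y r : ℤ} {b : bi Y x y} {a : bi X x ⌊α * x⌋}
    (h : IsDroppedLift α f b a) (hr : IsTorsionOrder α b r) :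
    ∃ z : Page Y r (x + 1) (⌊α * x⌋ - r), HitsDropping α z b ∧
      ∃ zt : Page X r (x + 1) (⌊α * x⌋ - r),
        pageMap f r (x + 1) (⌊α * x⌋ - r) zt = z ∧
        (∀ zt', pageMap f r (x + 1) (⌊α * x⌋ - r) zt' = z → zt' = zt) ∧
        ∃ v : Page X r x ⌊α * x⌋, Represents (red X x ⌊α * x⌋ a) v ∧ v ≠ 0 ∧ IsDiff zt v := by
  obtain ⟨hr1, hb0, hmin⟩ := hr
  have hy : ⌊α * x⌋ < y := Int.floor_lt.2 h.1.1
  -- For r = 2 minimality among integers r > 1 says nothing, and nonvanishing comes from the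
  -- definition of dropping instead.
  have hb : tau Y x y (⌊α * x⌋ - (r - 2)) b ≠ 0 := by
    by_cases hr2 : r = 2
    · subst hr2
      rw [sub_self, sub_zero]
      exact h.1.2.2
    · have := hmin (r - 1) (by omega) (by omega)
      rwa [show r - 1 - 1 = r - 2 by ring] at this
  -- The torsion of `b` transfers to τ^(r-1) a = 0, so τ^(r-2) a = δ u. This single `u` represents
  -- the source of both differentials.
  obtain ⟨u, hu⟩ := (tau_eq_zero_iff (x := x + 1) (y := ⌊α * x⌋ - r) rfl rfl
    (show ⌊α * x⌋ - (r - 1) = _ by ring) (tau X x ⌊α * x⌋ (⌊α * x⌋ - r + 2) a)).1 (by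
      rw [tau_tau X (by omega) (by omega), hf.tau_droppedLift_eq_zero_iff h (by omega), hb0])
  have hfu : delta Y rfl rfl (grMap f (x + 1) (⌊α * x⌋ - r) u) =
      tau Y x y (⌊α * x⌋ - r + 2) b := by
    rw [← delta_natural, hu, map_tau_droppedLift h (by omega)]
  obtain ⟨zt, hzt⟩ := exists_page ((mem_cycles_iff rfl (sub_add_cancel _ r).symm u).2 ⟨a, hu⟩)
  obtain ⟨v, hv⟩ := exists_page (red_mem_cycles hX r a)
  have hL := floor_le_floor_add_one hα (x + 1)
  rw [add_sub_cancel_right] at hL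
  refine ⟨_, exists_isDiff_of_delta hα hY (by omega) rfl (by ring) hy hfu (hzt.map f), zt, rfl,
    fun zt' hzt' => hf.pageMap_injective (floor_le_floor_add_one hα) hX hY (by omega) hzt',
    v, hv, ?_, rfl, (sub_add_cancel _ r).symm, u, a, hzt, hu, hv⟩
  rwa [Ne, hf.represents_droppedLift_eq_zero_iff hX (by omega) h hv]

theorem differential_of_droppedLift (hα : -1 < α) (hX : X.IsSpectrum) (hY : Y.IsSpectrum)
    (hYc : IsStronglyComplete Y) (hf : IsBiCover (fun x => ⌊α * x⌋) f) {r x₁ y₁ x y : ℤ}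
    {b : bi Y x y} {a : bi X x ⌊α * x⌋} {zt : Page X r x₁ y₁} {v : Page X r x ⌊α * x⌋}
    (hr : 2 ≤ r) (h : IsDroppedLift α f b a) (hv : Represents (red X x ⌊α * x⌋ a) v)
    (hv0 : v ≠ 0) (hd : IsDiff zt v) :
    IsTorsionOrder α b r ∧ HitsDropping α (pageMap f r x₁ y₁ zt) b ∧ IsDroppedDiff α f zt v := by
  have hd' := hd
  obtain ⟨hx, hy₁, u, c, hu, hδ, hc⟩ := hd
  have hy : ⌊α * x⌋ < y := Int.floor_lt.2 h.1.1
  have hidx : y₁ + 2 = ⌊α * x⌋ - (r - 2) := by omega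
  -- `c` and `a` need only agree on E_r, but on the line this already gives equal multiples by
  -- τ^(r-2).
  have hca : tau X x ⌊α * x⌋ (y₁ + 2) c = tau X x ⌊α * x⌋ (y₁ + 2) a := by
    have h1 := (hc.eq_iff hv).1 rfl
    rw [← map_sub] at h1
    have h2 := (hf.red_mem_boundaries_iff hX (c - a)).1 h1
    rw [← hidx, map_sub, sub_eq_zero] at h2
    exact h2
  rw [hca] at hδ
  have hfu : delta Y hx rfl (grMap f x₁ y₁ u) = tau Y x y (y₁ + 2) b := by
    rw [← delta_natural, hδ, map_tau_droppedLift h (by omega)]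
  have hb0 : tau Y x y (y₁ + 2) b ≠ 0 := by
    rw [hidx]
    rwa [Ne, hf.represents_droppedLift_eq_zero_iff hX hr h hv] at hv0
  have hne : delta Y hx rfl (grMap f x₁ y₁ u) ≠ 0 := hfu ▸ hb0
  refine ⟨isTorsionOrder_of_delta hr hx hy₁ hy hfu hne,
    exists_isDiff_of_delta hα hY hr hx hy₁ hy hfu (hu.map f), hd', ?_⟩
  -- replace `b` by a maximal division
  obtain ⟨j, b', hb', hmax⟩ := hYc.exists_division hY (by omega) b hb0
  have hfu' : delta Y hx rfl (grMap f x₁ y₁ u) = tau Y x (y + j) (y₁ + 2) b' := by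
    rw [hb', hfu]
  have hdrop : Drops α b' := by
    refine ⟨Int.floor_lt.1 (by omega), fun h0 => hmax 0 (map_zero _) ?_, fun h0 => hne ?_⟩
    · rw [h0, map_zero]
    · rw [hfu', ← tau_tau Y (by omega : ⌊α * x⌋ ≤ y + j) (by omega), h0, map_zero]
  obtain ⟨a', ha', -⟩ := hf.existsUnique_isDroppedLift hdrop
  obtain ⟨z', w, hz', hw, -, hcross⟩ :=
    exists_isDiff_of_delta hα hY hr hx hy₁ (by omega) hfu' (hu.map f)
  refine ⟨y + j, b', a', ha', isTorsionOrder_of_delta hr hx hy₁ (by omega) hfu' hne, ?_, z', w,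
    hz', hw, hcross fun hw0 => ?_⟩
  · refine hv.congr (red_mem_cycles hX r a') ?_
    rw [← map_sub]
    refine (hf.red_mem_boundaries_iff hX (a - a')).2 ?_
    rw [← hf.map_eq_zero_iff, map_sub, map_sub, map_tau_droppedLift h (by omega),
      map_tau_droppedLift ha' (by omega), ← hidx, hb', sub_self]
  -- A boundary on E_(l'+r) in the bidegree of `b'` is [c'] with τ^(l'+r-2) c' = 0, that is, with
  -- `c'` dying at height y₁ + 2; this is what maximality of the division excludes.
  · obtain ⟨c', hc', hcc⟩ := (mem_boundaries_iff (show y₁ + 2 = _ by omega) _).1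
      (hw.eq_zero_iff.1 hw0)
    exact hmax c' hc' hcc

/-- If f(v) = 0 with v ≠ 0, injectivity off the line places v on the line, where the kernel consists
of dropped lifts. -/
theorem differential_cases (hα : -1 < α) (hX : X.IsSpectrum) (hY : Y.IsSpectrum)
    (hYc : IsStronglyComplete Y) (hf : IsBiCover (fun x => ⌊α * x⌋) f) {r x₁ y₁ x y : ℤ}
    {zt : Page X r x₁ y₁} {v : Page X r x y} (hr : 2 ≤ r) (hv0 : v ≠ 0) (hd : IsDiff zt v) :
    (IsDiff (pageMap f r x₁ y₁ zt) (pageMap f r x y v) ∧ pageMap f r x y v ≠ 0) ∨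
      IsDroppedDiff α f zt v := by
  by_cases hfv : pageMap f r x y v = 0
  · right
    obtain rfl : y = ⌊α * x⌋ := by
      by_contra hy
      exact hv0 ((_root_.map_eq_zero_iff _ (hf.pageMap_injective (floor_le_floor_add_one hα)
        hX hY hy)).1 hfv)
    obtain ⟨y, b, a, hlift, ha, -⟩ := (hf.kernel_iff hX hY hYc hr v).1 ⟨hv0, hfv⟩
    exact (hf.differential_of_droppedLift hα hX hY hYc hr hlift ha hv0 hd).2.2
  · exact Or.inl ⟨hd.map f, hfv⟩

end IsBiCover

end Cover

end Fil

end LinearT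

end

open CategoryTheory LinearT LinearT.Fil

theorem theorem5p7 (α : ℝ) (hα : -1 < α) (X Y : Fil.{u}) (hX : X.IsSpectrum)
    (hY : Y.IsSpectrum) (f : X ⟶ Y) :
    -- the criterion, with the image described by permanent cycles
    (ExhibitsCover α f ↔
      IsStronglyComplete X ∧ IsConnective α (modTau X 1) ∧ TauInvEquiv f ∧
        PageConditions α f IsPermanentCycle) ∧
    -- sufficiency, with the image described by line-crossing differentials
    (IsStronglyComplete X → IsConnective α (modTau X 1) → TauInvEquiv f →
      PageConditions α f (fun e => ¬ SupportsLineCrossing α e) → ExhibitsCover α f) ∧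
    -- consequences for strongly complete `Y`
    (IsStronglyComplete Y → ExhibitsCover α f →
      -- necessity, with the image described by line-crossing differentials
      PageConditions α f (fun e => ¬ SupportsLineCrossing α e) ∧
      -- (5) dropped lifts exist and are unique, and `τ ^ k a = 0 ↔ τ ^ (k + l) b = 0`
      (∀ (x y : ℤ) (b : bi Y x y), Drops α b →
        (∃! a : bi X x ⌊α * x⌋, IsDroppedLift α f b a) ∧
        ∀ a : bi X x ⌊α * x⌋, IsDroppedLift α f b a → ∀ k : ℤ, 0 ≤ k →
          (tau X x ⌊α * x⌋ (⌊α * x⌋ - k) a = 0 ↔ tau Y x y (⌊α * x⌋ - k) b = 0)) ∧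
      -- (6) the nonzero elements of the kernel on the line; the last condition is
      -- `τ ^ (l + r - 2) b ≠ 0`
      (∀ r x : ℤ, 2 ≤ r → ∀ e : Page X r x ⌊α * x⌋,
        (e ≠ 0 ∧ pageMap f r x ⌊α * x⌋ e = 0) ↔
          ∃ (y : ℤ) (b : bi Y x y) (a : bi X x ⌊α * x⌋), IsDroppedLift α f b a ∧
            Represents (red X x ⌊α * x⌋ a) e ∧ tau Y x y (⌊α * x⌋ - (r - 2)) b ≠ 0) ∧
      -- (7) differentials onto dropped lifts
      (∀ (x y r : ℤ) (b : bi Y x y) (a : bi X x ⌊α * x⌋), IsDroppedLift α f b a →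
        IsTorsionOrder α b r →
        ∃ z : Page Y r (x + 1) (⌊α * x⌋ - r), HitsDropping α z b ∧
          ∃ zt : Page X r (x + 1) (⌊α * x⌋ - r),
            pageMap f r (x + 1) (⌊α * x⌋ - r) zt = z ∧
            (∀ zt', pageMap f r (x + 1) (⌊α * x⌋ - r) zt' = z → zt' = zt) ∧
            ∃ v : Page X r x ⌊α * x⌋, Represents (red X x ⌊α * x⌋ a) v ∧ v ≠ 0 ∧ IsDiff zt v) ∧
      -- (7), converse
      (∀ (r x₁ y₁ x y : ℤ) (b : bi Y x y) (a : bi X x ⌊α * x⌋) (zt : Page X r x₁ y₁)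
        (v : Page X r x ⌊α * x⌋), 2 ≤ r → IsDroppedLift α f b a →
        Represents (red X x ⌊α * x⌋ a) v → v ≠ 0 → IsDiff zt v →
          IsTorsionOrder α b r ∧ HitsDropping α (pageMap f r x₁ y₁ zt) b ∧
          IsDroppedDiff α f zt v) ∧
      -- (8) all differentials of `X`
      (∀ (r x₁ y₁ x y : ℤ) (zt : Page X r x₁ y₁) (v : Page X r x y), 2 ≤ r → v ≠ 0 →
        IsDiff zt v →
          (IsDiff (pageMap f r x₁ y₁ zt) (pageMap f r x y v) ∧ pageMap f r x y v ≠ 0) ∨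
          IsDroppedDiff α f zt v)) := by
  refine ⟨⟨fun h => ?_, fun h => ?_⟩, fun h1 h2 h3 h4 => ?_, fun hYc h => ?_⟩
  · have hf := (exhibitsCover_iff_isBiCover hα hX hY).1 h
    exact ⟨hf.isStronglyComplete hX, hf.isConnective_modTau hα hX, hf.tauInvEquiv hX hY,
      hf.pageConditions hα hX hY fun _ _ _ _ => Iff.rfl⟩
  · exact h.2.2.2.exhibitsCover hα hX hY (fun _ he => he) h.1 h.2.1 h.2.2.1
  · exact h4.exhibitsCover hα hX hY (fun _ he => not_supportsLineCrossing hY he) h1 h2 h3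
  · have hf := (exhibitsCover_iff_isBiCover hα hX hY).1 h
    refine ⟨hf.pageConditions hα hX hY fun hr hr' hy e =>
        ⟨not_supportsLineCrossing hY, fun he => hYc.isPermanentCycle hY hr hr' hy he⟩,
      fun x y b hb => ⟨hf.existsUnique_isDroppedLift hb, fun a ha k hk =>
        hf.tau_droppedLift_eq_zero_iff ha (by omega)⟩,
      fun r x hr e => hf.kernel_iff hX hY hYc hr e,
      fun x y r b a hlift hr => hf.exists_differential hα hX hY hlift hr,
      fun r x₁ y₁ x y b a zt v hr hlift hv hv0 hd =>
        hf.differential_of_droppedLift hα hX hY hYc hr hlift hv hv0 hd,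
      fun r x₁ y₁ x y zt v hr hv0 hd => hf.differential_cases hα hX hY hYc hr hv0 hd⟩
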